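/- Conventions. Let $\tilde{\mathcal A}=\{\sum_{\nu\ge 0}P_\nu(a)b^\nu : P_\nu\in\mathbb C[x]\}$ be the $\mathbb C$-algebra determined by $ab-ba=b^2$ and $b$-adic continuity of left and right multiplication by $a$; modules are left $\tilde{\mathcal A}$-modules, and $\mathbb C[[b]]\subset\tilde{\mathcal A}$. For $\Lambda\subset\mathbb Q\cap\,]0,1]$ finite and $N\in\mathbb N$, let $\Xi^{(N)}_\Lambda=\bigoplus_{\lambda\in\Lambda}\bigoplus_{j=0}^N\mathbb C[[s]]\,s^{\lambda-1}(\log s)^j$, where $a$ acts as multiplication by $s$ and $b$ as the primitive in $s$ without constant. A *fresco* is a module isomorphic to $\tilde{\mathcal A}\varphi$ for some $\varphi\in\Xi^{(N)}_\Lambda\otimes_{\mathbb C} V$ with $V$ a finite dimensional complex vector space ($\tilde{\mathcal A}$ acts on the first factor); it is a *theme* if one may take $V=\mathbb C$. An (a,b)-module is a module that is free of finite rank over $\mathbb C[[b]]$; "rank" means this rank. It has a simple pole if $aE\subset bE$, and is regular if it embeds in a simple pole (a,b)-module; the smallest such is its saturation $E^\sharp$. Its Bernstein polynomial is the minimal polynomial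 of $-b^{-1}a$ on $E^\sharp/bE^\sharp$, and, for $\lambda\in\mathbb Q\cap\,]0,1]$, $E$ is $[\lambda]$-primitive if all roots of this polynomial lie in $-\lambda+\mathbb Z$. A regular (a,b)-module is semi-simple if it embeds in a finite direct sum of regular (a,b)-modules of rank $1$. A submodule $F\subset E$ is normal if $F\cap bE=bF$. Put $E_\mu=\tilde{\mathcal A}/\tilde{\mathcal A}(a-\mu b)$. A rank $k$ $[\lambda]$-primitive fresco $E$ has a unique principal Jordan–Hölder sequence $0=F_0\subset F_1\subset\dots\subset F_k=E$: the $F_j$ are normal, $F_j/F_{j-1}\simeq E_{\lambda_j}$ with $\lambda_j$ rational, and $\lambda_j+j$ is non-decreasing. The numbers $\lambda_1,\dots,\lambda_k$ are the fundamental invariants of $E$; put $p_j=\lambda_{j+1}-\lambda_j+1\in\mathbb N$ and $p(E)=\sum_{j=1}^{k-1}p_j$. When $k\ge 2$ and $F_{k-1}$ and $E/F_1$ are semi-simple, the invariant $\alpha(E)\in\mathbb C$ is defined as follows. If $k=2$ and $p_1\ge 1$, it is the number $\alpha$ such that $E\simeq\tilde{\mathcal A}/\tilde{\mathcal A}(a-\lambda_1b)(1+\alpha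 b^{p_1})^{-1}(a-\lambda_2b)$; if $k=2$ and $p_1=0$ (so that $E\simeq\tilde{\mathcal A}/\tilde{\mathcal A}(a-\lambda_1b)(a-(\lambda_1-1)b)$), one puts $\alpha(E)=1$. If $k\ge 3$, then $\alpha(E)=\alpha(G)$, where $G=\tilde{\mathcal A}(a-(\lambda_{k-1}-1)b)e$ (a fresco of rank $k-1$) for any generator $e$ of $E$ with $(a-\lambda_{k-1}b)(a-\lambda_kb)e\in F_{k-2}$; the value does not depend on the choice of $e$. Corollary. Let $\lambda\in\mathbb Q\cap\,]0,1]$ and let $E$ be a $[\lambda]$-primitive fresco of rank $k\ge 2$ with fundamental invariants $\lambda_1,\dots,\lambda_k$ and principal Jordan–Hölder sequence $(F_j)$, such that $F_{k-1}$ and $E/F_1$ are semi-simple and $\alpha(E)\ne 0$. Then $E$ has a quotient which is a theme of rank $2$, and every quotient of $E$ which is a theme of rank $2$ is isomorphic to $$\tilde{\mathcal A}\big/\tilde{\mathcal A}\,(a-(\lambda_1-k+2)b)\,(1+\beta(E)\,b^{p(E)})^{-1}\,(a-\lambda_kb),$$ where $$\beta(E)=(-1)^k\,\frac{p_1(p_1+p_2)\cdots(p_1+\dots+p_{k-2})}{p_{k-1}(p_{k-2}+p_{k-1})\cdots(p_2+\dots+p_{k-1})}\,\alpha(E)$$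 (for $k=2$ both products are empty and $\beta(E)=\alpha(E)$). -/

import Mathlib

open Polynomial
open scoped TensorProduct

noncomputable section

namespace ABTheory

/-! ### The algebra of formal series `∑ P_ν(a) b^ν`

A sequence `f : ℕ → ℂ[X]` stands for the formal series `∑ f_ν(a) b^ν`. -/

/-- Left multiplication by `b` on formal series `∑ g_ν(a) b^ν`: the relation `a b - b a = b ^ 2` forces
`b Q(a) = ∑ j, (-1)^j Q^{(j)}(a) b^(j+1)`. -/
def bLeft : Module.End ℂ (ℕ → ℂ[X]) where
  toFun g := fun n => match n with
    | 0 => 0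
    | n + 1 => ∑ j ∈ Finset.range (n + 1),
        (-1 : ℂ) ^ j • ((derivative : ℂ[X] →ₗ[ℂ] ℂ[X]) ^ j) (g (n - j))
  map_add' f g := by
    funext n
    cases n with
    | zero => simp
    | succ n => simp [Finset.sum_add_distrib]
  map_smul' c g := by
    funext n
    cases n with
    | zero => simp
    | succ n => simp [Finset.smul_sum, smul_comm c]

theorem bLeft_apply_succ (g : ℕ → ℂ[X]) (n : ℕ) :
    bLeft g (n + 1) = ∑ j ∈ Finset.range (n + 1),
      (-1 : ℂ) ^ j • ((derivative : ℂ[X] →ₗ[ℂ] ℂ[X]) ^ j) (g (n - j)) := rfl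

/-- `a` and `b` satisfy `a b - b a = b ^ 2` on sequences with values in `W`, `a` preserves the filtration
by order of vanishing and `b` raises it by one, so that formal series `∑ P_ν(a) b^ν` act. -/
structure IsRep {W : Type*} [AddCommGroup W] [Module ℂ W]
    (a b : Module.End ℂ (ℕ → W)) : Prop where
  comm : a * b - b * a = b ^ 2
  filt_a : ∀ (n : ℕ) (x : ℕ → W), (∀ i < n, x i = 0) → ∀ i < n, a x i = 0
  filt_b : ∀ (n : ℕ) (x : ℕ → W), (∀ i < n, x i = 0) → ∀ i < n + 1, b x i = 0

/-- The operator `∑ f_ν(a) b^ν` applied to `x`; in each degree the sum is finite. -/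
def act {W : Type*} [AddCommGroup W] [Module ℂ W]
    (a b : Module.End ℂ (ℕ → W)) (f : ℕ → ℂ[X]) (x : ℕ → W) : ℕ → W :=
  fun n => ∑ ν ∈ Finset.range (n + 1), (aeval a (f ν) ((b ^ ν) x)) n

namespace IsRep

variable {W : Type*} [AddCommGroup W] [Module ℂ W] {a b : Module.End ℂ (ℕ → W)}

theorem aeval_vanish (h : IsRep a b) (P : ℂ[X]) (n : ℕ) (x : ℕ → W) (hx : ∀ i < n, x i = 0) :
    ∀ i < n, aeval a P x i = 0 := by
  induction P using Polynomial.induction_on' with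
  | add p q hp hq => intro i hi; simp [hp i hi, hq i hi]
  | monomial m c =>
    have key : ∀ m : ℕ, ∀ i < n, (a ^ m) x i = 0 := by
      intro m
      induction m with
      | zero => simpa using hx
      | succ m ih => intro i hi; rw [pow_succ']; exact h.filt_a n _ ih i hi
    intro i hi
    simp [aeval_monomial, Algebra.algebraMap_eq_smul_one, key m i hi]

theorem pow_vanish (h : IsRep a b) (m n : ℕ) (x : ℕ → W) (hx : ∀ i < n, x i = 0) :
    ∀ i < n + m, (b ^ m) x i = 0 := by
  induction m with
  | zero => simpa using hx
  | succ m ih => intro i hi; rw [pow_succ']; exact h.filt_b (n + m) _ ih i (by omega)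

theorem term_zero (h : IsRep a b) (P : ℂ[X]) (m n : ℕ) (x : ℕ → W) (hn : n < m) :
    aeval a P ((b ^ m) x) n = 0 :=
  h.aeval_vanish P m _ (fun i hi => h.pow_vanish m 0 x (by simp) i (by omega)) n hn

theorem aeval_congr (h : IsRep a b) (P : ℂ[X]) (n : ℕ) (x y : ℕ → W)
    (hx : ∀ i ≤ n, x i = y i) : aeval a P x n = aeval a P y n := by
  have := h.aeval_vanish P (n + 1) (x - y)
    (fun i hi => by simp [hx i (by omega)]) n (by omega)
  rw [map_sub] at this
  exact sub_eq_zero.mp this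

theorem b_congr (h : IsRep a b) (n : ℕ) (x y : ℕ → W)
    (hx : ∀ i ≤ n, x i = y i) : b x n = b y n := by
  have := h.filt_b (n + 1) (x - y)
    (fun i hi => by simp [hx i (by omega)]) n (by omega)
  rw [map_sub] at this
  exact sub_eq_zero.mp this

theorem act_eq (h : IsRep a b) (f : ℕ → ℂ[X]) (x : ℕ → W) (n K : ℕ) (hK : n ≤ K) :
    act a b f x n = (∑ ν ∈ Finset.range (K + 1), aeval a (f ν) ((b ^ ν) x)) n := by
  rw [Finset.sum_apply]
  refine Finset.sum_subset (by intro i; simp; omega) ?_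
  intro i _ hi
  exact h.term_zero _ _ _ _ (by simpa using hi)

theorem b_mul_aeval (h : IsRep a b) (Q : ℂ[X]) :
    b * aeval a Q = aeval a Q * b - b * aeval a (derivative Q) * b := by
  induction Q using Polynomial.induction_on with
  | C c => simp [Algebra.algebraMap_eq_smul_one]
  | add p q hp hq => simp only [map_add, mul_add, add_mul, hp, hq]; abel
  | monomial n c ih =>
    set R : ℂ[X] := C c * X ^ n with hR
    have e : C c * X ^ (n + 1) = X * R := by rw [hR]; ring
    rw [e]
    have hba : b * a = a * b - b ^ 2 := by rw [← h.comm]; abel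
    have hd : derivative (X * R) = R + X * derivative R := by simp
    rw [hd]
    simp only [map_add, map_mul, aeval_X]
    have h1 : b * (a * aeval a R) = a * (b * aeval a R) - b * (b * aeval a R) := by
      rw [← mul_assoc, hba, sub_mul, sq, mul_assoc, mul_assoc]
    have h2 : b * (a * aeval a (derivative R))
        = a * (b * aeval a (derivative R)) - b * (b * aeval a (derivative R)) := by
      rw [← mul_assoc, hba, sub_mul, sq, mul_assoc, mul_assoc]
    rw [ih] at h1
    rw [h1, mul_add, h2]
    simp only [mul_sub, sub_mul, add_mul, mul_assoc]
    abel

theorem b_mul_aeval_sum (h : IsRep a b) (K : ℕ) (Q : ℂ[X]) :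
    b * aeval a Q = ∑ j ∈ Finset.range K,
        (-1 : ℂ) ^ j • (aeval a (((derivative : ℂ[X] →ₗ[ℂ] ℂ[X]) ^ j) Q) * b ^ (j + 1))
      + (-1 : ℂ) ^ K • (b * aeval a (((derivative : ℂ[X] →ₗ[ℂ] ℂ[X]) ^ K) Q) * b ^ K) := by
  induction K with
  | zero => simp
  | succ K ih =>
    rw [ih, Finset.sum_range_succ, add_assoc]
    congr 1
    rw [h.b_mul_aeval, pow_succ' (derivative : ℂ[X] →ₗ[ℂ] ℂ[X]) K, Module.End.mul_apply,
      sub_mul, smul_sub, sub_eq_add_neg, pow_succ' (-1 : ℂ) K]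
    congr 1
    · rw [mul_assoc, ← pow_succ']
    · rw [neg_one_mul, mul_assoc _ b, ← pow_succ']
      exact (neg_smul _ _).symm

theorem act_bLeft (h : IsRep a b) (g : ℕ → ℂ[X]) (x : ℕ → W) :
    act a b (bLeft g) x = b (act a b g x) := by
  funext n
  rw [h.b_congr n _ _ (fun i hi => h.act_eq g x i n hi), map_sum, Finset.sum_apply]
  have h1 : ∀ μ, b (aeval a (g μ) ((b ^ μ) x)) n = ∑ j ∈ Finset.range (n + 1),
      (-1 : ℂ) ^ j •
        aeval a (((derivative : ℂ[X] →ₗ[ℂ] ℂ[X]) ^ j) (g μ)) ((b ^ (j + μ + 1)) x) n := by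
    intro μ
    rw [← Module.End.mul_apply, h.b_mul_aeval_sum (n + 1)]
    simp only [LinearMap.add_apply, LinearMap.sum_apply, Pi.add_apply, Finset.sum_apply,
      LinearMap.smul_apply, Pi.smul_apply, Module.End.mul_apply]
    have hz : b (aeval a (((derivative : ℂ[X] →ₗ[ℂ] ℂ[X]) ^ (n + 1)) (g μ))
        ((b ^ (n + 1)) ((b ^ μ) x))) n = 0 :=
      h.filt_b n _ (h.aeval_vanish _ n _ (fun i hi =>
        h.pow_vanish (n + 1) 0 _ (by simp) i (by omega))) n (by omega)
    rw [hz, smul_zero, add_zero]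
    refine Finset.sum_congr rfl fun j _ => ?_
    rw [← Module.End.mul_apply (b ^ (j + 1)), ← pow_add, add_right_comm]
  simp only [h1]
  unfold act
  rw [Finset.sum_range_succ']
  have h0 : (aeval a (bLeft g 0) ((b ^ 0) x)) n = 0 := by simp [bLeft]
  rw [h0, add_zero]
  set t : ℕ → ℕ → W := fun j μ => (-1 : ℂ) ^ j •
    aeval a (((derivative : ℂ[X] →ₗ[ℂ] ℂ[X]) ^ j) (g μ)) ((b ^ (j + μ + 1)) x) n with ht
  have hzero : ∀ j μ, n ≤ j + μ → t j μ = 0 := by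
    intro j μ hj
    simp only [ht]
    rw [h.term_zero _ _ _ _ (by omega), smul_zero]
  have h2 : ∀ m, aeval a (bLeft g (m + 1)) ((b ^ (m + 1)) x) n
      = ∑ j ∈ Finset.range (m + 1), t j (m - j) := by
    intro m
    simp only [bLeft, LinearMap.coe_mk, AddHom.coe_mk, map_sum, LinearMap.sum_apply,
      Finset.sum_apply, map_smul, LinearMap.smul_apply, Pi.smul_apply]
    refine Finset.sum_congr rfl fun j hj => ?_
    have : j + (m - j) = m := by simp at hj; omega
    simp [ht, this]
  simp only [h2]
  rw [Finset.sum_range_diag_flip, Finset.sum_comm, Finset.sum_range_succ _ n]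
  rw [Finset.sum_eq_zero (s := Finset.range (n + 1)) (fun μ _ => hzero n μ (by omega)), add_zero]
  refine Finset.sum_congr rfl fun j _ => ?_
  refine Finset.sum_subset (by intro i; simp; omega) ?_
  intro i _ hi
  exact hzero j i (by simp at hi; omega)

theorem act_bLeft_pow (h : IsRep a b) (ν : ℕ) (g : ℕ → ℂ[X]) (x : ℕ → W) :
    act a b ((bLeft ^ ν) g) x = (b ^ ν) (act a b g x) := by
  induction ν with
  | zero => simp
  | succ ν ih => rw [pow_succ', pow_succ', Module.End.mul_apply, Module.End.mul_apply,
      h.act_bLeft, ih]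

theorem act_mul (h : IsRep a b) (f g : ℕ → ℂ[X]) (x : ℕ → W) :
    act a b (fun n => ∑ ν ∈ Finset.range (n + 1), f ν * (bLeft ^ ν) g n) x
      = act a b f (act a b g x) := by
  funext n
  have hL : ∀ ν m, m < ν → (bLeft ^ ν) g m = 0 := by
    intro ν
    induction ν with
    | zero => intro m hm; omega
    | succ ν ih =>
      intro m hm
      rw [pow_succ', Module.End.mul_apply]
      cases m with
      | zero => rfl
      | succ m =>
        simp only [bLeft_apply_succ]
        refine Finset.sum_eq_zero fun j _ => ?_
        rw [ih _ (by omega), map_zero, smul_zero]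
  have h1 : ∀ ν, aeval a (f ν) ((b ^ ν) (act a b g x)) n = ∑ m ∈ Finset.range (n + 1),
      aeval a (f ν) (aeval a ((bLeft ^ ν) g m) ((b ^ m) x)) n := by
    intro ν
    rw [← h.act_bLeft_pow, h.aeval_congr _ n _ _ (fun i hi => h.act_eq _ x i n hi), map_sum,
      Finset.sum_apply]
  change ∑ m ∈ Finset.range (n + 1),
      aeval a (∑ ν ∈ Finset.range (m + 1), f ν * (bLeft ^ ν) g m) ((b ^ m) x) n
    = ∑ ν ∈ Finset.range (n + 1), aeval a (f ν) ((b ^ ν) (act a b g x)) n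
  simp only [h1]
  rw [Finset.sum_comm]
  refine Finset.sum_congr rfl fun m hm => ?_
  rw [map_sum, LinearMap.sum_apply, Finset.sum_apply]
  simp only [map_mul, Module.End.mul_apply]
  refine Finset.sum_subset (by intro i; simp at hm ⊢; omega) ?_
  intro ν _ hν
  rw [hL ν m (by simpa using hν)]
  simp

theorem act_one (a b : Module.End ℂ (ℕ → W)) (x : ℕ → W) :
    act a b (Pi.single 0 1) x = x := by
  funext n
  unfold act
  rw [Finset.sum_eq_single 0]
  · simp
  · intro ν _ hν
    simp [Pi.single_eq_of_ne hν]
  · simp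

theorem act_add (a b : Module.End ℂ (ℕ → W)) (f : ℕ → ℂ[X]) (x y : ℕ → W) :
    act a b f (x + y) = act a b f x + act a b f y := by
  funext n
  simp [act, Finset.sum_add_distrib]

theorem add_act (a b : Module.End ℂ (ℕ → W)) (f g : ℕ → ℂ[X]) (x : ℕ → W) :
    act a b (f + g) x = act a b f x + act a b g x := by
  funext n
  simp [act, Finset.sum_add_distrib]

theorem act_smul (a b : Module.End ℂ (ℕ → W)) (f : ℕ → ℂ[X]) (c : ℂ) (x : ℕ → W) :
    act a b f (c • x) = c • act a b f x := by
  funext n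
  simp [act, Finset.smul_sum]

theorem smul_act (a b : Module.End ℂ (ℕ → W)) (f : ℕ → ℂ[X]) (c : ℂ) (x : ℕ → W) :
    act a b (c • f) x = c • act a b f x := by
  funext n
  simp [act, Finset.smul_sum]

theorem act_zero (a b : Module.End ℂ (ℕ → W)) (f : ℕ → ℂ[X]) :
    act a b f 0 = 0 := by
  funext n
  simp [act]

theorem zero_act (a b : Module.End ℂ (ℕ → W)) (x : ℕ → W) :
    act a b 0 x = 0 := by
  funext n
  simp [act]

end IsRep

/-- Left multiplication by `a`. -/
def aLeft : Module.End ℂ (ℕ → ℂ[X]) where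
  toFun g := fun n => X * g n
  map_add' f g := by funext n; simp [mul_add]
  map_smul' c g := by funext n; simp

theorem aeval_aLeft (P : ℂ[X]) (g : ℕ → ℂ[X]) (n : ℕ) : aeval aLeft P g n = P * g n := by
  induction P using Polynomial.induction_on generalizing g with
  | C c => simp [Algebra.algebraMap_eq_smul_one, smul_eq_C_mul]
  | add p q hp hq => simp [hp, hq, add_mul]
  | monomial m c ih =>
    rw [pow_succ, ← mul_assoc, map_mul, aeval_X, Module.End.mul_apply, ih]
    simp [aLeft, mul_assoc]

theorem bLeft_succ (g : ℕ → ℂ[X]) (n : ℕ) :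
    bLeft g (n + 1) = g n - derivative (bLeft g n) := by
  cases n with
  | zero => simp [bLeft]
  | succ n =>
    simp only [bLeft, LinearMap.coe_mk, AddHom.coe_mk]
    rw [Finset.sum_range_succ', map_sum, sub_eq_add_neg, add_comm, ← Finset.sum_neg_distrib]
    congr 1
    · simp
    · refine Finset.sum_congr rfl fun j _ => ?_
      rw [pow_succ' (derivative : ℂ[X] →ₗ[ℂ] ℂ[X]), Module.End.mul_apply, Nat.succ_sub_succ,
        pow_succ' (-1 : ℂ), map_smul, neg_one_mul]
      exact neg_smul _ _

theorem isRep_left : IsRep aLeft bLeft where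
  comm := by
    ext1 g
    funext n
    simp only [LinearMap.sub_apply, Module.End.mul_apply, sq, Pi.sub_apply]
    induction n with
    | zero => simp [aLeft, bLeft]
    | succ n ih =>
      rw [bLeft_succ (bLeft g), ← ih, bLeft_succ (aLeft g)]
      simp only [aLeft, LinearMap.coe_mk, AddHom.coe_mk, bLeft_succ g, map_sub, derivative_mul,
        derivative_X]
      ring
  filt_a n x hx i hi := by simp [aLeft, hx i hi]
  filt_b n x hx i hi := by
    cases i with
    | zero => rfl
    | succ i =>
      rw [bLeft_apply_succ]
      refine Finset.sum_eq_zero fun j _ => ?_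
      rw [hx _ (by omega), map_zero, smul_zero]

theorem bLeft_single (ν : ℕ) :
    bLeft (Pi.single ν 1) = Pi.single (ν + 1) 1 := by
  funext n
  induction n with
  | zero => simp [bLeft]
  | succ n ih =>
    rw [bLeft_succ, ih]
    by_cases h : n = ν <;> by_cases h' : n = ν + 1 <;> simp [h, h']

theorem bLeft_pow_one (ν : ℕ) : (bLeft ^ ν) (Pi.single 0 1) = Pi.single ν 1 := by
  induction ν with
  | zero => simp
  | succ ν ih => rw [pow_succ', Module.End.mul_apply, ih, bLeft_single]

theorem act_left_one (f : ℕ → ℂ[X]) : act aLeft bLeft f (Pi.single 0 1) = f := by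
  funext n
  unfold act
  simp only [bLeft_pow_one, aeval_aLeft]
  rw [Finset.sum_eq_single n]
  · simp
  · intro ν _ hν
    simp [hν.symm]
  · simp

theorem act_left_a (f : ℕ → ℂ[X]) : act aLeft bLeft (Pi.single 0 X) f = aLeft f := by
  funext n
  unfold act
  rw [Finset.sum_eq_single 0]
  · simp
  · intro ν _ hν
    simp [Pi.single_eq_of_ne hν]
  · simp

theorem act_left_b (f : ℕ → ℂ[X]) : act aLeft bLeft (Pi.single 1 1) f = bLeft f := by
  funext n
  cases n with
  | zero => simp [act, bLeft]
  | succ n =>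
    unfold act
    rw [Finset.sum_eq_single 1]
    · simp
    · intro ν _ hν
      simp [Pi.single_eq_of_ne hν]
    · simp

/-- The algebra `Ã` of the series `∑ P_ν(a) b^ν`, `P_ν ∈ ℂ[X]`; `f ν` is the polynomial `P_ν`. -/
def ATilde : Type := ℕ → ℂ[X]

namespace ATilde

instance : AddCommGroup ATilde := inferInstanceAs (AddCommGroup (ℕ → ℂ[X]))
instance : Module ℂ ATilde := inferInstanceAs (Module ℂ (ℕ → ℂ[X]))
instance : One ATilde := ⟨(Pi.single 0 1 : ℕ → ℂ[X])⟩
/-- `(∑ f_ν(a) b^ν) g = ∑ f_ν(a) (b^ν g)`. -/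
instance : Mul ATilde :=
  ⟨fun f g => fun n => ∑ ν ∈ Finset.range (n + 1), f ν * (bLeft ^ ν) g n⟩

theorem mul_eq_act (f g : ATilde) : f * g = act aLeft bLeft f g := by
  funext n
  exact Finset.sum_congr rfl fun ν _ => (aeval_aLeft _ _ _).symm

instance : Ring ATilde :=
  { (inferInstance : AddCommGroup ATilde), (inferInstance : One ATilde),
    (inferInstance : Mul ATilde) with
    left_distrib := fun f g h => by
      simp only [mul_eq_act]; exact IsRep.act_add _ _ _ _ _
    right_distrib := fun f g h => by
      simp only [mul_eq_act]; exact IsRep.add_act _ _ _ _ _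
    zero_mul := fun f => by
      simp only [mul_eq_act]; exact IsRep.zero_act _ _ _
    mul_zero := fun f => by
      simp only [mul_eq_act]; exact IsRep.act_zero _ _ _
    mul_assoc := fun f g h => by
      rw [mul_eq_act (f * g), mul_eq_act f (g * h), mul_eq_act g h]
      exact isRep_left.act_mul f g h
    one_mul := fun f => by
      rw [mul_eq_act]; exact IsRep.act_one _ _ _
    mul_one := fun f => by
      rw [mul_eq_act]; exact act_left_one f
    neg_add_cancel := fun f => neg_add_cancel f
    zsmul := fun n f => n • f
    zsmul_zero' := fun f => zero_zsmul f
    zsmul_succ' := fun n f => SubNegMonoid.zsmul_succ' n f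
    zsmul_neg' := fun n f => SubNegMonoid.zsmul_neg' n f
    nsmul := fun n f => n • f
    nsmul_zero := fun f => zero_nsmul f
    nsmul_succ := fun n f => succ_nsmul f n }

instance : Algebra ℂ ATilde :=
  Algebra.ofModule
    (fun c f g => by simp only [mul_eq_act]; exact IsRep.smul_act _ _ _ _ _)
    (fun c f g => by simp only [mul_eq_act]; exact IsRep.act_smul _ _ _ _ _)

/-- The element `a`. -/
def a : ATilde := (Pi.single 0 X : ℕ → ℂ[X])

/-- The element `b`. -/
def b : ATilde := (Pi.single 1 1 : ℕ → ℂ[X])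

theorem comm_rel : a * b - b * a = b ^ 2 := by
  rw [sq, mul_eq_act a b, mul_eq_act b a, mul_eq_act b b]
  have h := congrArg (fun T : Module.End ℂ (ℕ → ℂ[X]) => T (Pi.single 0 1)) isRep_left.comm
  have ha : aLeft (Pi.single 0 1) = (Pi.single 0 X : ℕ → ℂ[X]) := by
    funext n
    by_cases hn : n = 0 <;> simp [aLeft, hn]
  have hb : bLeft (Pi.single 0 1) = Pi.single 1 1 := bLeft_single 0
  have h' : aLeft (Pi.single 1 1) - bLeft (Pi.single 0 X) = bLeft (Pi.single 1 1) := by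
    rw [← ha, ← hb]
    simpa [sq] using h
  rw [← act_left_a, ← act_left_b, ← act_left_b] at h'
  exact h'

/-- The inclusion of `ℂ[[b]]` in `Ã`. -/
def ofPS : PowerSeries ℂ →+* ATilde where
  toFun S := fun ν => C (PowerSeries.coeff ν S)
  map_one' := by
    funext ν
    change C _ = (Pi.single 0 1 : ℕ → ℂ[X]) ν
    by_cases h : ν = 0 <;> simp [PowerSeries.coeff_one, h]
  map_zero' := by funext ν; change C _ = (0 : ℂ[X]); simp
  map_add' S T := by funext ν; change C _ = C _ + C _; simp
  map_mul' S T := by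
    have hb : ∀ g : ℕ → ℂ, bLeft (fun n => C (g n))
        = fun n => C (match n with | 0 => 0 | m + 1 => g m) := by
      intro g
      funext n
      induction n with
      | zero => simp [bLeft]
      | succ n ih => rw [bLeft_succ, ih]; simp
    have hpow : ∀ ν n, (bLeft ^ ν) (fun n => C (PowerSeries.coeff n T)) n
        = if ν ≤ n then C (PowerSeries.coeff (n - ν) T) else 0 := by
      intro ν
      have : (bLeft ^ ν) (fun n => C (PowerSeries.coeff n T))
          = fun n => C (if ν ≤ n then PowerSeries.coeff (n - ν) T else 0) := by
        induction ν with
        | zero => simp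
        | succ ν ih =>
          rw [pow_succ', Module.End.mul_apply, ih, hb]
          funext n
          cases n <;> simp
      intro n
      rw [this]
      by_cases h : ν ≤ n <;> simp only [h, if_true, if_false, map_zero]
    funext n
    change C _ = ∑ ν ∈ Finset.range (n + 1), C _ * (bLeft ^ ν) _ n
    rw [PowerSeries.coeff_mul, Finset.Nat.sum_antidiagonal_eq_sum_range_succ
      (fun i j => PowerSeries.coeff i S * PowerSeries.coeff j T), map_sum]
    refine Finset.sum_congr rfl fun ν hν => ?_
    rw [hpow, if_pos (by simp at hν; omega), map_mul]

end ATilde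

/-! ### Asymptotic expansions

A vector `q : Fin (N + 1) → ℂ` stands for the polynomial `∑ q_j (log s)^j`. -/

/-- The derivative with respect to `log s` on polynomials of degree at most `N` in `log s`. -/
def logDer (N : ℕ) : Module.End ℂ (Fin (N + 1) → ℂ) where
  toFun q := fun j => if h : (j : ℕ) + 1 < N + 1 then ((j : ℕ) + 1 : ℂ) * q ⟨j + 1, h⟩ else 0
  map_add' p q := by
    funext j
    by_cases h : (j : ℕ) + 1 < N + 1
    · simp only [h, dif_pos, Pi.add_apply, mul_add]
    · simp only [h, dif_neg, Pi.add_apply, not_false_eq_true, add_zero]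
  map_smul' c q := by
    funext j
    by_cases h : (j : ℕ) + 1 < N + 1
    · simp only [h, dif_pos, Pi.smul_apply, smul_eq_mul, RingHom.id_apply]; ring
    · simp only [h, dif_neg, Pi.smul_apply, not_false_eq_true, smul_zero]

/-- For `c ≠ 0` the primitive without constant of `s^(c-1) q(log s)` is `s^c (c + D)⁻¹ q (log s)` with `D`
the derivative in `log s`; this is `(c + D)⁻¹ = ∑ k, (-1)^k c^(-k-1) D^k`. -/
def logPrim (N : ℕ) (c : ℂ) : Module.End ℂ (Fin (N + 1) → ℂ) :=
  ∑ k ∈ Finset.range (N + 1), ((-1 : ℂ) ^ k * (c ^ (k + 1))⁻¹) • logDer N ^ k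

theorem logDer_pow (N : ℕ) : logDer N ^ (N + 1) = 0 := by
  have key : ∀ k (q : Fin (N + 1) → ℂ) (j : Fin (N + 1)), N + 1 ≤ (j : ℕ) + k →
      (logDer N ^ k) q j = 0 := by
    intro k
    induction k with
    | zero => intro q j hj; omega
    | succ k ih =>
      intro q j hj
      rw [pow_succ', Module.End.mul_apply]
      simp only [logDer, LinearMap.coe_mk, AddHom.coe_mk]
      split_ifs with h
      · have := ih q ⟨j + 1, h⟩ (by simp; omega)
        simp only [logDer] at this
        rw [this, mul_zero]
      · rfl
  ext1 q
  exact LinearMap.ext fun r => funext fun j => key (N + 1) _ j (by omega)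

theorem logPrim_left (N : ℕ) {c : ℂ} (hc : c ≠ 0) :
    (c • (1 : Module.End ℂ (Fin (N + 1) → ℂ)) + logDer N) * logPrim N c = 1 := by
  have key : ∀ K, (c • (1 : Module.End ℂ (Fin (N + 1) → ℂ)) + logDer N)
      * (∑ k ∈ Finset.range K, ((-1 : ℂ) ^ k * (c ^ (k + 1))⁻¹) • logDer N ^ k)
      = 1 - ((-1 : ℂ) ^ K * (c ^ K)⁻¹) • logDer N ^ K := by
    intro K
    induction K with
    | zero => simp
    | succ K ih =>
      rw [Finset.sum_range_succ, mul_add, ih, add_mul, mul_smul_comm, mul_smul_comm, smul_mul_assoc,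
        one_mul, smul_smul, ← pow_succ']
      have e1 : (-1 : ℂ) ^ K * (c ^ (K + 1))⁻¹ * c = (-1 : ℂ) ^ K * (c ^ K)⁻¹ := by
        rw [pow_succ c K, mul_inv, mul_assoc, mul_assoc, inv_mul_cancel₀ hc, mul_one]
      have e2 : (-1 : ℂ) ^ (K + 1) * (c ^ (K + 1))⁻¹ = - ((-1 : ℂ) ^ K * (c ^ (K + 1))⁻¹) := by
        ring
      have e3 : (-((-1 : ℂ) ^ K * (c ^ (K + 1))⁻¹)) • logDer N ^ (K + 1)
          = -(((-1 : ℂ) ^ K * (c ^ (K + 1))⁻¹) • logDer N ^ (K + 1)) := by module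
      rw [e1, e2, e3]
      abel
  rw [logPrim, key, logDer_pow, smul_zero, sub_zero]

theorem logPrim_right (N : ℕ) {c : ℂ} (hc : c ≠ 0) :
    logPrim N c * (c • (1 : Module.End ℂ (Fin (N + 1) → ℂ)) + logDer N) = 1 :=
  mul_eq_one_comm.mp (logPrim_left N hc)

theorem logPrim_sub (N : ℕ) {c : ℂ} (hc : c ≠ 0) (hc' : c + 1 ≠ 0) :
    logPrim N c - logPrim N (c + 1) = logPrim N (c + 1) * logPrim N c := by
  calc logPrim N c - logPrim N (c + 1)
      = logPrim N (c + 1) * ((c + 1) • (1 : Module.End ℂ (Fin (N + 1) → ℂ)) + logDer N)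
          * logPrim N c
        - logPrim N (c + 1) * ((c • (1 : Module.End ℂ (Fin (N + 1) → ℂ)) + logDer N)
          * logPrim N c) := by
        rw [logPrim_left N hc, logPrim_right N hc', one_mul, mul_one]
    _ = _ := by
        rw [mul_assoc, ← mul_sub, ← sub_mul]
        congr 1
        rw [add_smul, one_smul, add_assoc, add_sub_add_left_eq_sub, add_sub_cancel_right, one_mul]

/-- Multiplication by `s`. -/
def xiA (N : ℕ) : Module.End ℂ (ℕ → Fin (N + 1) → ℂ) where
  toFun x := fun n => match n with
    | 0 => 0
    | n + 1 => x n
  map_add' x y := by funext n; cases n <;> simp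
  map_smul' c x := by funext n; cases n <;> simp

/-- The primitive without constant of `∑ n, s^(l - 1 + n) x_n(log s)`. -/
def xiB (l : ℚ) (N : ℕ) : Module.End ℂ (ℕ → Fin (N + 1) → ℂ) where
  toFun x := fun n => match n with
    | 0 => 0
    | n + 1 => logPrim N ((n : ℂ) + (l : ℂ)) (x n)
  map_add' x y := by funext n; cases n <;> simp
  map_smul' c x := by funext n; cases n <;> simp

theorem isRep_xi {l : ℚ} (hl : 0 < l) (N : ℕ) : IsRep (xiA N) (xiB l N) where
  comm := by
    have hne : ∀ n : ℕ, (n : ℂ) + (l : ℂ) ≠ 0 := by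
      intro n
      have : (n : ℚ) + l ≠ 0 := by positivity
      exact_mod_cast this
    refine LinearMap.ext fun x => funext fun n => ?_
    simp only [LinearMap.sub_apply, Module.End.mul_apply, sq, Pi.sub_apply]
    rcases n with _ | _ | n
    · simp [xiA, xiB]
    · simp [xiA, xiB]
    · have h1 : ((n + 1 : ℕ) : ℂ) + (l : ℂ) = (n : ℂ) + l + 1 := by push_cast; ring
      have h2 := LinearMap.congr_fun (logPrim_sub N (hne n) (h1 ▸ hne (n + 1))) (x n)
      rw [← h1] at h2
      exact h2
  filt_a n x hx i hi := by
    cases i with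
    | zero => rfl
    | succ i => exact hx i (by omega)
  filt_b n x hx i hi := by
    cases i with
    | zero => rfl
    | succ i =>
      change logPrim N _ (x i) = 0
      rw [hx i (by omega), map_zero]

/-- The module `Ξ_l^{(N)} = ⨁_{j ≤ N} ℂ[[s]] s^(l-1) (log s)^j`: the value `x n j` is the coefficient of
`s^(l - 1 + n) (log s)^j`. -/
def XiOne (_l : Set.Ioc (0 : ℚ) 1) (N : ℕ) : Type := ℕ → Fin (N + 1) → ℂ

namespace XiOne

variable (l : Set.Ioc (0 : ℚ) 1) (N : ℕ)

instance : AddCommGroup (XiOne l N) := inferInstanceAs (AddCommGroup (ℕ → Fin (N + 1) → ℂ))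
instance : Module ℂ (XiOne l N) := inferInstanceAs (Module ℂ (ℕ → Fin (N + 1) → ℂ))

/-- `a` acts as multiplication by `s`, `b` as the primitive without constant. -/
instance : Module ATilde (XiOne l N) where
  smul f x := act (xiA N) (xiB l N) f x
  one_smul _ := IsRep.act_one _ _ _
  mul_smul f g x := (isRep_xi l.2.1 N).act_mul f g x
  smul_zero _ := IsRep.act_zero _ _ _
  smul_add _ _ _ := IsRep.act_add _ _ _ _ _
  add_smul _ _ _ := IsRep.add_act _ _ _ _ _
  zero_smul _ := IsRep.zero_act _ _ _

instance : SMulCommClass ℂ ATilde (XiOne l N) where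
  smul_comm c f x := (IsRep.act_smul (xiA N) (xiB l N) f c x).symm

instance : SMulCommClass ATilde ℂ (XiOne l N) := SMulCommClass.symm _ _ _

end XiOne

/-- `Ξ_Λ^{(N)}`, the direct sum of the `Ξ_l^{(N)}` over the finite set `Λ`. -/
abbrev Xi (L : Finset (Set.Ioc (0 : ℚ) 1)) (N : ℕ) : Type := (l : L) → XiOne l N

/-! ### Frescos, themes and (a,b)-modules -/

open ATilde

/-- A fresco: isomorphic to `Ã φ` with `φ ∈ Ξ_Λ^{(N)} ⊗ V`, where `Ã` acts on the first factor. -/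
def IsFresco (E : Type*) [AddCommGroup E] [Module ATilde E] : Prop :=
  ∃ (L : Finset (Set.Ioc (0 : ℚ) 1)) (N : ℕ) (V : Type) (_ : AddCommGroup V) (_ : Module ℂ V)
    (_ : FiniteDimensional ℂ V) (φ : Xi L N ⊗[ℂ] V),
    Nonempty (E ≃ₗ[ATilde] Submodule.span ATilde {φ})

/-- A theme: isomorphic to `Ã φ` with `φ ∈ Ξ_Λ^{(N)}`. -/
def IsTheme (E : Type*) [AddCommGroup E] [Module ATilde E] : Prop :=
  ∃ (L : Finset (Set.Ioc (0 : ℚ) 1)) (N : ℕ) (φ : Xi L N),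
    Nonempty (E ≃ₗ[ATilde] Submodule.span ATilde {φ})

/-- The structure of `ℂ[[b]]`-module. -/
abbrev psModule (E : Type*) [AddCommGroup E] [Module ATilde E] : Module (PowerSeries ℂ) E :=
  Module.compHom E ofPS

/-- The structure of complex vector space. -/
abbrev cModule (E : Type*) [AddCommGroup E] [Module ATilde E] : Module ℂ E :=
  Module.compHom E (algebraMap ℂ ATilde)

/-- An (a,b)-module: free of finite rank over `ℂ[[b]]`. -/
def IsABModule (E : Type*) [AddCommGroup E] [Module ATilde E] : Prop :=
  letI := psModule E
  Module.Free (PowerSeries ℂ) E ∧ Module.Finite (PowerSeries ℂ) E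

/-- The rank over `ℂ[[b]]`. -/
def abRank (E : Type*) [AddCommGroup E] [Module ATilde E] : ℕ :=
  letI := psModule E
  Module.finrank (PowerSeries ℂ) E

/-- A simple pole (a,b)-module: `a E ⊆ b E`. -/
def HasSimplePole (E : Type*) [AddCommGroup E] [Module ATilde E] : Prop :=
  IsABModule E ∧ ∀ x : E, ∃ y : E, a • x = b • y

/-- A regular (a,b)-module: it embeds in a simple pole (a,b)-module. -/
def IsRegular (E : Type*) [AddCommGroup E] [Module ATilde E] : Prop :=
  IsABModule E ∧ ∃ (M : Type) (_ : AddCommGroup M) (_ : Module ATilde M) (ι : E →ₗ[ATilde] M),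
    HasSimplePole M ∧ Function.Injective ι

/-- `ι` is the minimal embedding in a simple pole (a,b)-module, i.e. the saturation by `b⁻¹ a`. -/
def IsSaturation {E M : Type*} [AddCommGroup E] [Module ATilde E] [AddCommGroup M]
    [Module ATilde M] (ι : E →ₗ[ATilde] M) : Prop :=
  HasSimplePole M ∧ Function.Injective ι ∧
    ∀ N : Submodule ATilde M, LinearMap.range ι ≤ N →
      (∀ x ∈ N, ∃ y ∈ N, a • x = b • y) → N = ⊤

/-- The complex subspace `b M`. -/
def bImage (M : Type*) [AddCommGroup M] [Module ATilde M] :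
    letI := cModule M
    Submodule ℂ M :=
  letI := cModule M
  { carrier := {x | ∃ y : M, x = b • y}
    add_mem' := by
      rintro _ _ ⟨x, rfl⟩ ⟨y, rfl⟩
      exact ⟨x + y, (smul_add _ _ _).symm⟩
    zero_mem' := ⟨0, (smul_zero _).symm⟩
    smul_mem' := by
      rintro c _ ⟨x, rfl⟩
      refine ⟨algebraMap ℂ ATilde c • x, ?_⟩
      change algebraMap ℂ ATilde c • b • x = _
      rw [smul_smul, smul_smul, Algebra.commutes] }

/-- The Bernstein polynomial of a simple pole module: the minimal polynomial of `-b⁻¹ a` on `M / b M`. -/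
def IsBernsteinPolynomialSimplePole (M : Type*) [AddCommGroup M] [Module ATilde M]
    (B : ℂ[X]) : Prop :=
  letI := cModule M
  ∃ T : Module.End ℂ (M ⧸ bImage M),
    (∀ x y : M, a • x = b • y → T ((bImage M).mkQ x) = -(bImage M).mkQ y) ∧ B = minpoly ℂ T

/-- The Bernstein polynomial of a regular module is that of its saturation. -/
def IsBernsteinPolynomial (E : Type*) [AddCommGroup E] [Module ATilde E] (B : ℂ[X]) : Prop :=
  ∃ (M : Type) (_ : AddCommGroup M) (_ : Module ATilde M) (ι : E →ₗ[ATilde] M),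
    IsSaturation ι ∧ IsBernsteinPolynomialSimplePole M B

/-- `[l]`-primitive: all roots of the Bernstein polynomial lie in `-l + ℤ`. -/
def IsLambdaPrimitive (l : ℚ) (E : Type*) [AddCommGroup E] [Module ATilde E] : Prop :=
  IsABModule E ∧ ∃ B : ℂ[X], IsBernsteinPolynomial E B ∧
    ∀ r ∈ B.roots, ∃ n : ℤ, r = -(l : ℂ) + n

/-- A normal submodule: `F ∩ b E = b F`. -/
def IsNormal {E : Type*} [AddCommGroup E] [Module ATilde E] (F : Submodule ATilde E) : Prop :=
  ∀ x ∈ F, (∃ y : E, x = b • y) → ∃ z ∈ F, x = b • z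

/-- The left module `Ã / Ã P`. -/
abbrev Cyc (P : ATilde) : Type := ATilde ⧸ Submodule.span ATilde {P}

/-- `a - μ b`; the rank one module `E_μ` is `Cyc (lin μ)`. -/
def lin (μ : ℂ) : ATilde := a - μ • b

/-- `(a - μ b) S⁻¹ (a - ν b)`. -/
def rankTwoElt (μ : ℂ) (S : PowerSeries ℂ) (ν : ℂ) : ATilde :=
  lin μ * ofPS S⁻¹ * lin ν

/-- The `F j`, `0 ≤ j ≤ k`, form the principal Jordan-Hölder sequence of `E`, with
`F_j / F_{j-1} ≃ E_{λ_j}` for `1 ≤ j ≤ k` and `λ_j + j` non decreasing; so `E` has rank `k` and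
fundamental invariants `λ_1, …, λ_k`. Values at indices `> k` (and `lam 0`) are not used. -/
structure IsPrincipalJH {E : Type*} [AddCommGroup E] [Module ATilde E] (k : ℕ) (lam : ℕ → ℚ)
    (F : ℕ → Submodule ATilde E) : Prop where
  bot : F 0 = ⊥
  top : F k = ⊤
  mono : ∀ j < k, F j ≤ F (j + 1)
  normal : ∀ j ≤ k, IsNormal (F j)
  quot : ∀ j < k, Nonempty
    ((F (j + 1) ⧸ (F j).submoduleOf (F (j + 1))) ≃ₗ[ATilde] Cyc (lin (lam (j + 1))))
  principal : ∀ j, 1 ≤ j → j < k → lam j + j ≤ lam (j + 1) + (j + 1)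

/-- Semi-simple: embeds in a finite direct sum of regular (a,b)-modules of rank one. -/
def IsSemisimple (E : Type*) [AddCommGroup E] [Module ATilde E] : Prop :=
  ∃ (n : ℕ) (M : Fin n → Type) (_ : ∀ i, AddCommGroup (M i)) (_ : ∀ i, Module ATilde (M i)),
    (∀ i, IsRegular (M i) ∧ abRank (M i) = 1) ∧
    ∃ f : E →ₗ[ATilde] ((i : Fin n) → M i), Function.Injective f

universe u

/-- `α` is the `α`-invariant of the rank `k` fresco `E`. In rank two it is the parameter of `E`
(by convention `1` when `λ_2 = λ_1 - 1`); in rank `k ≥ 3` it is that of the submodule generated by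
`(a - (λ_{k-1} - 1) b) e`, for a generator `e` of `E` with
`(a - λ_{k-1} b) (a - λ_k b) e ∈ F_{k-2}`, where `F` is the principal Jordan-Hölder sequence. -/
def IsAlphaInvariant : (k : ℕ) → (E : Type u) → [AddCommGroup E] → [Module ATilde E] → ℂ → Prop
  | 0, _, _, _, _ => False
  | 1, _, _, _, _ => False
  | 2, E, _, _, α => ∃ l₁ : ℚ,
      (∃ p : ℕ, 1 ≤ p ∧ Nonempty (E ≃ₗ[ATilde]
        Cyc (rankTwoElt l₁ (1 + PowerSeries.C α * PowerSeries.X ^ p) (l₁ + p - 1)))) ∨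
      (Nonempty (E ≃ₗ[ATilde] Cyc (lin l₁ * lin (l₁ - 1))) ∧ α = 1)
  | m + 3, E, _, _, α => ∃ (lam : ℕ → ℚ) (F : ℕ → Submodule ATilde E) (e : E),
      IsPrincipalJH (m + 3) lam F ∧ Submodule.span ATilde {e} = ⊤ ∧
      (lin (lam (m + 2)) * lin (lam (m + 3))) • e ∈ F (m + 1) ∧
      IsAlphaInvariant (m + 2) (Submodule.span ATilde {lin (lam (m + 2) - 1) • e}) α

/-- The natural number `p_j = λ_{j+1} - λ_j + 1` attached to fundamental invariants. -/
def pInv (lam : ℕ → ℚ) (j : ℕ) : ℕ := ⌊lam (j + 1) - lam j + 1⌋₊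

/-- `p(E) = p_1 + ⋯ + p_{k-1}`. -/
def pTotal (k : ℕ) (lam : ℕ → ℚ) : ℕ := ∑ j ∈ Finset.Icc 1 (k - 1), pInv lam j

/-- `β(E) = (-1)^k (p_1 (p_1 + p_2) ⋯ (p_1 + ⋯ + p_{k-2})) /
(p_{k-1} (p_{k-2} + p_{k-1}) ⋯ (p_2 + ⋯ + p_{k-1})) α(E)`. -/
def betaInv (k : ℕ) (lam : ℕ → ℚ) (α : ℂ) : ℂ :=
  (-1) ^ k * ((∏ j ∈ Finset.Icc 1 (k - 2), ((∑ i ∈ Finset.Icc 1 j, pInv lam i : ℕ) : ℂ)) /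
    ∏ j ∈ Finset.Icc 2 (k - 1), ((∑ i ∈ Finset.Icc j (k - 1), pInv lam i : ℕ) : ℂ)) * α

end ABTheory

end

open ABTheory

open Polynomial
open scoped TensorProduct

noncomputable section

namespace ABTheory

open ATilde

attribute [local instance] psModule

/-! ### Arithmetic of `Ã` -/

namespace ATilde

/-! Up to a denominator b^M, a generator of E involves only eigenvectors of b⁻¹a and one Jordan
block of size two, and α and β are both read off that block. Put e_i = λ_{i+1} + i - (k-1) for 0 ≤ i
< k, so that e_{i+1} - e_i = p_{i+1} and e_{k-1} - e_0 = p(E). Unless k = 2 and p_1 = 0, there is a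
generator g with b^M g = Σ R_i(b) y_i and all R_i(0) ≠ 0, where y_i is killed by a - (e_i + M) b for
i < k-1, and a - (e_{k-1} + M) b sends y_{k-1} to c b^{p(E)+1} y_0 (`IsChain.exists_isNormalForm`).
The y_i are built while climbing the Jordan-Hölder sequence. Each step solves b S' + δ S = W in
ℂ[[b]], which can fail in one degree only, the resonant one. Semi-simplicity means that b⁻¹a has no
Jordan block (`IsSemisimple.noLog`). For F_{k-1} it kills all resonant terms and makes the e_i
distinct; for E/F_1 it leaves, at the last step, only the term along y_0.

An element u of Ã multiplies every R_i(0) by the same scalar, its augmentation, so γ = c R_{k-1}(0)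
/ R_0(0) does not depend on the generator. The recursive definition of α applies a - e_{k-2} b to a
generator; this removes y_{k-2} and multiplies γ by (e_{k-1} - e_{k-2}) / (e_0 - e_{k-2})
(`IsNormalForm.reduce`). In rank two, comparing coefficients gives γ = -α p. Hence γ ∏_{0<j<k-1}
(e_{k-1} - e_j) / (e_0 - e_j) = -α p(E) (`IsNormalForm.alpha_eq`), and this is the formula β(E) = -γ
/ p(E) (`betaInv_eq`).

In a theme the eigenspaces of b⁻¹a have dimension at most one (`IsTheme.simpleEigen`). So in a rank
two theme quotient the image of y_0 is nonzero, since otherwise the rank would be at most one, and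
the images of y_1, …, y_{k-2} are its multiples by constants times positive powers of b. They do not
change R_0(0), hence not γ either, and a rank two module with this γ has parameter -γ / p(E)
(`exists_generator_rankTwoElt`).

For existence, y_0 and y_{k-1} are sent to a power of s and a logarithmic term in Ξ, the other y_i
to 0. This is possible because e_0 > 0 (`IsFresco.chain_pos`), and the image has rank two because α
≠ 0 forces c ≠ 0. The case k = 2, p_1 = 0, where e_0 = e_1, is treated by hand
(`IsPrincipalJH.rank_two_degenerate`). -/

theorem a_mul (f : ATilde) (n : ℕ) : (a * f : ATilde) n = X * f n := by
  rw [mul_eq_act]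
  exact congrFun (act_left_a f) n

theorem b_mul (f : ATilde) : (b * f : ATilde) = bLeft f := by
  rw [mul_eq_act]
  exact act_left_b f

theorem b_pow_mul (n : ℕ) (f : ATilde) : (b ^ n * f : ATilde) = (bLeft ^ n) f := by
  induction n with
  | zero => exact one_mul f
  | succ n ih =>
    rw [pow_succ', mul_assoc, b_mul, pow_succ']
    exact congrArg bLeft ih

theorem b_pow (n : ℕ) : (b ^ n : ATilde) = (Pi.single n 1 : ℕ → ℂ[X]) := by
  rw [← mul_one (b ^ n), b_pow_mul]
  exact bLeft_pow_one n

theorem a_mul_b_pow (n : ℕ) : a * b ^ n = b ^ n * a + (n : ATilde) * b ^ (n + 1) := by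
  induction n with
  | zero => simp
  | succ n ih =>
    have h : a * b = b * a + b ^ 2 := by rw [← comm_rel]; abel
    have hc : (n : ATilde) * b ^ (n + 1) * b = (n : ATilde) * b ^ (n + 2) := by
      rw [mul_assoc, ← pow_succ]
    rw [pow_succ, ← mul_assoc, ih, add_mul, mul_assoc (b ^ n), h, hc, mul_add, ← pow_add,
      ← mul_assoc]
    push_cast
    rw [add_mul, one_mul]
    abel

theorem mul_a_zero (f : ATilde) : (f * a : ATilde) 0 = f 0 * X := by
  change ∑ ν ∈ Finset.range 1, f ν * (bLeft ^ ν) a 0 = _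
  simp [a]

theorem natCast_mul_apply (m : ℕ) (f : ATilde) (n : ℕ) :
    ((m : ATilde) * f) n = (m : ℂ[X]) * f n := by
  rw [← nsmul_eq_mul, ← nsmul_eq_mul]
  rfl

/-- Comes from b^ν a = a b^ν - ν b^(ν+1). Together with `mul_b_succ` it turns right multiplication
by a - μ b into a recursion on coefficients, which is what makes right division possible. -/
theorem mul_a_succ (f : ATilde) (n : ℕ) :
    (f * a : ATilde) (n + 1) = f (n + 1) * X - (n : ℂ[X]) * f n := by
  have h : ∀ ν m, (bLeft ^ ν) a m
      = (if m = ν then X else 0) - if m = ν + 1 then (ν : ℂ[X]) else 0 := by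
    intro ν m
    have h1 : (b ^ ν * a : ATilde) = a * b ^ ν - (ν : ATilde) * b ^ (ν + 1) := by
      rw [a_mul_b_pow]; abel
    rw [← b_pow_mul, h1]
    change (a * b ^ ν : ATilde) m - ((ν : ATilde) * b ^ (ν + 1) : ATilde) m = _
    rw [a_mul, natCast_mul_apply, b_pow, b_pow]
    by_cases h2 : m = ν <;> by_cases h3 : m = ν + 1 <;> simp [h2, h3]
  change ∑ ν ∈ Finset.range (n + 2), f ν * (bLeft ^ ν) a (n + 1) = _
  simp only [h, mul_sub, Finset.sum_sub_distrib, mul_ite, mul_zero]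
  rw [Finset.sum_ite_eq]
  have h4 : ∀ ν ∈ Finset.range (n + 2), (if n + 1 = ν + 1 then f ν * (ν : ℂ[X]) else 0)
      = if n = ν then f ν * (ν : ℂ[X]) else 0 := by
    intro ν _; simp
  rw [Finset.sum_congr rfl h4, Finset.sum_ite_eq]
  simp [mul_comm]

theorem mul_b_zero (f : ATilde) : (f * b : ATilde) 0 = 0 := by
  change ∑ ν ∈ Finset.range 1, f ν * (bLeft ^ ν) b 0 = _
  simp [b]

theorem mul_b_succ (f : ATilde) (n : ℕ) : (f * b : ATilde) (n + 1) = f n := by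
  have h : ∀ ν m, (bLeft ^ ν) b m = if m = ν + 1 then 1 else 0 := by
    intro ν m
    rw [← b_pow_mul, ← pow_succ, b_pow]
    by_cases h2 : m = ν + 1 <;> simp [h2]
  change ∑ ν ∈ Finset.range (n + 2), f ν * (bLeft ^ ν) b (n + 1) = _
  simp only [h, mul_ite, mul_zero]
  have h4 : ∀ ν ∈ Finset.range (n + 2), (if n + 1 = ν + 1 then f ν * (1 : ℂ[X]) else 0)
      = if n = ν then f ν * (1 : ℂ[X]) else 0 := by
    intro ν _; simp
  rw [Finset.sum_congr rfl h4, Finset.sum_ite_eq]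
  simp

/-- The augmentation `Ã → ℂ` killing `a` and `b`. -/
def aug : ATilde →+* ℂ where
  toFun f := (f 0).eval 0
  map_one' := by
    change ((Pi.single 0 1 : ℕ → ℂ[X]) 0).eval 0 = 1
    simp
  map_zero' := by
    change (0 : ℂ[X]).eval 0 = 0
    simp
  map_add' f g := by
    change (f 0 + g 0).eval 0 = _
    simp
  map_mul' f g := by
    change (∑ ν ∈ Finset.range 1, f ν * (bLeft ^ ν) g 0).eval 0 = _
    rw [Finset.sum_range_one, eval_mul]
    rfl

theorem aug_a : aug a = 0 := by
  change ((Pi.single 0 X : ℕ → ℂ[X]) 0).eval 0 = 0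
  simp

theorem aug_b : aug b = 0 := by
  change ((Pi.single 1 1 : ℕ → ℂ[X]) 0).eval 0 = 0
  simp

theorem aug_ofPS (S : PowerSeries ℂ) : aug (ofPS S) = PowerSeries.constantCoeff S := by
  change (C (PowerSeries.coeff 0 S)).eval 0 = _
  simp

theorem ofPS_X : ofPS PowerSeries.X = b := by
  funext n
  change C (PowerSeries.coeff n PowerSeries.X) = (Pi.single 1 1 : ℕ → ℂ[X]) n
  by_cases h : n = 1 <;> simp [PowerSeries.coeff_X, h]

theorem algebraMap_eq (c : ℂ) : algebraMap ℂ ATilde c = ofPS (PowerSeries.C c) := by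
  rw [Algebra.algebraMap_eq_smul_one]
  funext n
  change c • (Pi.single 0 1 : ℕ → ℂ[X]) n = C (PowerSeries.coeff n (PowerSeries.C c))
  by_cases h : n = 0 <;> simp [PowerSeries.coeff_C, h, smul_eq_C_mul]

theorem smul_eq (c : ℂ) (f : ATilde) : c • f = ofPS (PowerSeries.C c) * f := by
  rw [Algebra.smul_def, algebraMap_eq]

theorem a_mul_ofPS (S : PowerSeries ℂ) : a * ofPS S
    = ofPS S * a + ofPS (PowerSeries.X ^ 2 * PowerSeries.derivative (R := ℂ) S) := by
  funext n
  change (a * ofPS S : ATilde) n = (ofPS S * a : ATilde) n + C (PowerSeries.coeff n _)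
  rw [a_mul]
  cases n with
  | zero =>
    rw [mul_a_zero, sq, mul_assoc, PowerSeries.coeff_zero_X_mul, C_0, add_zero, mul_comm]
  | succ n =>
    rw [mul_a_succ]
    change X * C (PowerSeries.coeff (n + 1) S) = C (PowerSeries.coeff (n + 1) S) * X
      - (n : ℂ[X]) * C (PowerSeries.coeff n S) + _
    rw [sq, mul_assoc, PowerSeries.coeff_succ_X_mul]
    cases n with
    | zero =>
      rw [PowerSeries.coeff_zero_X_mul, C_0, Nat.cast_zero, zero_mul, sub_zero, add_zero, mul_comm]
    | succ n =>
      rw [PowerSeries.coeff_succ_X_mul, PowerSeries.coeff_derivative, C_mul]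
      have h : (C ((n : ℂ) + 1) : ℂ[X]) = ((n + 1 : ℕ) : ℂ[X]) := by simp
      rw [h]
      ring

end ATilde

theorem lin_eq (μ : ℂ) : lin μ = a - ofPS (PowerSeries.C μ) * b := by
  rw [lin, smul_eq]

theorem aug_lin (μ : ℂ) : aug (lin μ) = 0 := by
  simp [lin_eq, aug_a, aug_b]

/-- Right division by `a - μ b`. -/
theorem exists_eq_mul_lin_add (μ : ℂ) (f : ATilde) :
    ∃ (q : ATilde) (S : PowerSeries ℂ), f = q * lin μ + ofPS S := by
  -- The equation to solve is f_{n+1} = X q_{n+1} - (n + μ) q_n + s_{n+1}: so q_{n+1} and s_{n+1}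
  -- are the quotient and the remainder of f_{n+1} + (n + μ) q_n in the division by X.
  let q : ATilde := fun n => Nat.rec (divX (f 0))
    (fun n Q => divX (f (n + 1) + C ((n : ℂ) + μ) * Q)) n
  have hq : ∀ n, q (n + 1) = divX (f (n + 1) + C ((n : ℂ) + μ) * q n) := fun n => rfl
  let s : ℕ → ℂ := fun n => match n with
    | 0 => (f 0).coeff 0
    | n + 1 => (f (n + 1) + C ((n : ℂ) + μ) * q n).coeff 0
  refine ⟨q, PowerSeries.mk s, ?_⟩
  have e : (q : ATilde) * lin μ = (q : ATilde) * a - μ • ((q : ATilde) * b) := by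
    rw [lin, mul_sub, mul_smul_comm]
  rw [e]
  funext n
  change f n = ((q : ATilde) * a : ATilde) n - μ • ((q : ATilde) * b : ATilde) n
    + C (PowerSeries.coeff n (PowerSeries.mk s))
  rw [PowerSeries.coeff_mk]
  cases n with
  | zero =>
    rw [mul_a_zero, mul_b_zero, smul_zero, sub_zero]
    exact (divX_mul_X_add (f 0)).symm
  | succ n =>
    rw [mul_a_succ, mul_b_succ]
    have h := divX_mul_X_add (f (n + 1) + C ((n : ℂ) + μ) * q n)
    rw [← hq] at h
    change _ = _ + C ((f (n + 1) + C ((n : ℂ) + μ) * q n).coeff 0)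
    rw [smul_eq_C_mul]
    have h2 : C ((n : ℂ) + μ) = (n : ℂ[X]) + C μ := by simp
    rw [h2] at h ⊢
    linear_combination -h

/-- Uniqueness of the remainder. By induction on the degree, q_n X is a constant polynomial, so both
q_n and that constant vanish. Hence E_μ is free over ℂ[[b]] on the class of 1. -/
theorem eq_zero_of_mul_lin_eq (μ : ℂ) (q : ATilde) (S : PowerSeries ℂ)
    (h : q * lin μ = ofPS S) : S = 0 := by
  have e : q * lin μ = q * a - μ • (q * b) := by
    rw [lin, mul_sub, mul_smul_comm]
  rw [e] at h
  have h0 : q 0 * X = C (PowerSeries.coeff 0 S) := by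
    have := congrFun h 0
    change (q * a : ATilde) 0 - μ • (q * b : ATilde) 0 = C (PowerSeries.coeff 0 S) at this
    rwa [mul_a_zero, mul_b_zero, smul_zero, sub_zero] at this
  have h1 : ∀ n, q (n + 1) * X - (n : ℂ[X]) * q n - μ • q n = C (PowerSeries.coeff (n + 1) S) := by
    intro n
    have := congrFun h (n + 1)
    change (q * a : ATilde) (n + 1) - μ • (q * b : ATilde) (n + 1) = _ at this
    rwa [mul_a_succ, mul_b_succ] at this
  have key : ∀ (p : ℂ[X]) (c : ℂ), p * X = C c → p = 0 ∧ c = 0 := by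
    intro p c hp
    have hc : c = 0 := by
      have := congrArg (fun r => r.coeff 0) hp
      simpa using this.symm
    refine ⟨?_, hc⟩
    rw [hc, C_0] at hp
    exact (mul_eq_zero.mp hp).resolve_right X_ne_zero
  have h2 : ∀ n, q n = 0 ∧ PowerSeries.coeff n S = 0 := by
    intro n
    induction n with
    | zero => exact key _ _ h0
    | succ n ih =>
      refine key _ _ ?_
      have := h1 n
      rwa [ih.1, mul_zero, smul_zero, sub_zero, sub_zero] at this
  ext n
  simpa using (h2 n).2

/-- `b Ã ⊆ Ã b`, compatibly with the augmentation. -/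
theorem exists_b_mul_eq (u : ATilde) : ∃ v : ATilde, b * u = v * b ∧ aug v = aug u := by
  let v : ATilde := fun n => bLeft (u : ℕ → ℂ[X]) (n + 1)
  refine ⟨v, ?_, ?_⟩
  · rw [b_mul]
    funext n
    cases n with
    | zero => exact (mul_b_zero v).symm
    | succ n => exact (mul_b_succ v n).symm
  · change (bLeft (u : ℕ → ℂ[X]) (0 + 1)).eval 0 = (u 0).eval 0
    refine congrArg (eval 0) ?_
    exact (bLeft_succ _ 0).trans (by simp [bLeft])

theorem exists_b_pow_mul_eq (n : ℕ) (u : ATilde) :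
    ∃ v : ATilde, b ^ n * u = v * b ^ n ∧ aug v = aug u := by
  induction n with
  | zero => exact ⟨u, by simp⟩
  | succ n ih =>
    obtain ⟨v, hv, hv'⟩ := ih
    obtain ⟨w, hw, hw'⟩ := exists_b_mul_eq v
    exact ⟨w, by rw [pow_succ', mul_assoc, hv, ← mul_assoc, hw, mul_assoc], hw'.trans hv'⟩

/-! ### Power series and the operators `b d/db + δ` -/

/-- The operator `b d/db + δ` on `ℂ[[b]]`. -/
def euler (δ : ℂ) (S : PowerSeries ℂ) : PowerSeries ℂ :=
  PowerSeries.X * PowerSeries.derivative (R := ℂ) S + PowerSeries.C δ * S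

theorem coeff_euler (δ : ℂ) (S : PowerSeries ℂ) (n : ℕ) :
    PowerSeries.coeff n (euler δ S) = (n + δ) * PowerSeries.coeff n S := by
  rw [euler, map_add, PowerSeries.coeff_C_mul]
  cases n with
  | zero => simp
  | succ n =>
    rw [PowerSeries.coeff_succ_X_mul, PowerSeries.coeff_derivative]
    push_cast
    ring

theorem constantCoeff_euler (δ : ℂ) (S : PowerSeries ℂ) :
    PowerSeries.constantCoeff (euler δ S) = δ * PowerSeries.constantCoeff S := by
  have := coeff_euler δ S 0
  simpa using this

theorem euler_comm (δ ε : ℂ) (S : PowerSeries ℂ) : euler δ (euler ε S) = euler ε (euler δ S) := by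
  ext n
  simp only [coeff_euler]
  ring

theorem euler_X_mul (δ : ℂ) (S : PowerSeries ℂ) :
    euler δ (PowerSeries.X * S) = PowerSeries.X * euler (δ + 1) S := by
  ext n
  cases n with
  | zero => simp [coeff_euler]
  | succ n =>
    rw [coeff_euler, PowerSeries.coeff_succ_X_mul, PowerSeries.coeff_succ_X_mul, coeff_euler]
    push_cast
    ring

theorem euler_C_mul_X_pow (δ c : ℂ) (n : ℕ) :
    euler δ (PowerSeries.C c * PowerSeries.X ^ n)
      = PowerSeries.C (((n : ℂ) + δ) * c) * PowerSeries.X ^ n := by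
  ext m
  simp only [coeff_euler, PowerSeries.coeff_C_mul, PowerSeries.coeff_X_pow]
  by_cases h : m = n
  · subst h; simp
  · simp [h]

/-- Solving `T' b + δ T = W` up to a resonant term. -/
theorem exists_euler_add_eq (δ : ℂ) (W : PowerSeries ℂ) :
    ∃ T r : PowerSeries ℂ, euler δ T + r = W ∧ euler δ r = 0 ∧
      (δ ≠ 0 → δ * PowerSeries.constantCoeff T = PowerSeries.constantCoeff W) ∧
      (δ = 0 → PowerSeries.constantCoeff r = PowerSeries.constantCoeff W) := by
  classical
  -- The operator multiplies the n-th coefficient by n + δ. In the resonant degree n = -δ, if there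
  -- is one, division by zero puts 0 in T and the coefficient of W goes to r instead.
  refine ⟨PowerSeries.mk fun n => PowerSeries.coeff n W / (n + δ),
    PowerSeries.mk fun n => if (n : ℂ) + δ = 0 then PowerSeries.coeff n W else 0, ?_, ?_, ?_, ?_⟩
  · ext n
    rw [map_add, coeff_euler, PowerSeries.coeff_mk, PowerSeries.coeff_mk]
    by_cases h : (n : ℂ) + δ = 0
    · simp [h]
    · rw [if_neg h, mul_div_cancel₀ _ h, add_zero]
  · ext n
    rw [coeff_euler, PowerSeries.coeff_mk]
    by_cases h : (n : ℂ) + δ = 0 <;> simp [h]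
  · intro h
    rw [← PowerSeries.coeff_zero_eq_constantCoeff_apply, PowerSeries.coeff_mk]
    simp
    field_simp
  · intro h
    rw [← PowerSeries.coeff_zero_eq_constantCoeff_apply, PowerSeries.coeff_mk]
    simp [h]

/-- A solution of `T' b + δ T = 0` is a monomial. -/
theorem eq_monomial_of_euler_eq_zero {δ : ℂ} {S : PowerSeries ℂ} (h : euler δ S = 0) (hS : S ≠ 0) :
    ∃ (n : ℕ) (c : ℂ), c ≠ 0 ∧ δ = -n ∧ S = PowerSeries.C c * PowerSeries.X ^ n := by
  obtain ⟨n, hn⟩ : ∃ n, PowerSeries.coeff n S ≠ 0 := by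
    by_contra! h'
    exact hS (PowerSeries.ext fun n => by simp [h' n])
  have hc : ∀ m : ℕ, ((m : ℂ) + δ) * PowerSeries.coeff m S = 0 := by
    intro m
    rw [← coeff_euler, h, map_zero]
  have hδ : δ = -n := by
    have := (mul_eq_zero.mp (hc n)).resolve_right hn
    linear_combination this
  refine ⟨n, _, hn, hδ, ?_⟩
  ext m
  rw [PowerSeries.coeff_C_mul, PowerSeries.coeff_X_pow]
  by_cases hm : m = n
  · simp [hm]
  · have := hc m
    rw [hδ, mul_eq_zero] at this
    rw [if_neg hm, mul_zero]
    refine this.resolve_left fun h0 => hm ?_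
    have h1 : (m : ℂ) = n := by linear_combination h0
    exact_mod_cast h1

/-! ### The action of `ℂ[[b]]` -/

section Module

variable {E : Type*} [AddCommGroup E] [Module ATilde E]

theorem ps_smul_def (S : PowerSeries ℂ) (x : E) : S • x = ofPS S • x := rfl

theorem X_smul (x : E) : (PowerSeries.X : PowerSeries ℂ) • x = b • x := by
  rw [ps_smul_def, ofPS_X]

theorem X_pow_smul (n : ℕ) (x : E) : (PowerSeries.X ^ n : PowerSeries ℂ) • x = b ^ n • x := by
  rw [ps_smul_def, map_pow, ofPS_X]

theorem mul_ofPS_smul (u : ATilde) (S : PowerSeries ℂ) (x : E) :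
    (u * ofPS S) • x = u • S • x := by
  rw [mul_smul]; rfl

/-- Moving a across S(b) costs b² S'(b); with the change of weight from μ to ν this becomes b times
(b d/db + ν - μ) S. Equations in modules thus become Euler equations in ℂ[[b]]. -/
theorem lin_mul_ofPS (μ ν : ℂ) (S : PowerSeries ℂ) :
    lin μ * ofPS S = ofPS S * lin ν + ofPS (PowerSeries.X * euler (ν - μ) S) := by
  have e : PowerSeries.X * euler (ν - μ) S
      = PowerSeries.X ^ 2 * PowerSeries.derivative (R := ℂ) S
        + (PowerSeries.C ν * PowerSeries.X * S - PowerSeries.C μ * PowerSeries.X * S) := by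
    rw [euler, map_sub]; ring
  rw [e, map_add, map_sub, lin_eq, lin_eq, sub_mul, mul_sub, a_mul_ofPS, ← ofPS_X,
    ← map_mul, ← map_mul, ← map_mul, ← map_mul, mul_comm S]
  abel

/-- The basic commutation rule. -/
theorem lin_smul_smul {ν : ℂ} {y z : E} (h : lin ν • y = z) (μ : ℂ) (S : PowerSeries ℂ) :
    lin μ • S • y = (PowerSeries.X * euler (ν - μ) S) • y + S • z := by
  rw [← mul_ofPS_smul, lin_mul_ofPS μ ν, add_smul, mul_smul, h, add_comm]
  rfl

theorem lin_smul_smul_eigen {ν : ℂ} {y : E} (h : lin ν • y = 0) (μ : ℂ) (S : PowerSeries ℂ) :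
    lin μ • S • y = (PowerSeries.X * euler (ν - μ) S) • y := by
  rw [lin_smul_smul h, smul_zero, add_zero]

/-- The Euler term of b^n has factor n + μ - (μ + n) = 0. This is how denominators b^M are carried
along: they shift all weights by M. -/
theorem lin_smul_X_pow_smul (μ : ℂ) (n : ℕ) (x : E) :
    lin (μ + n) • (PowerSeries.X ^ n : PowerSeries ℂ) • x
      = (PowerSeries.X ^ n : PowerSeries ℂ) • lin μ • x := by
  rw [lin_smul_smul (z := lin μ • x) rfl]
  have := euler_C_mul_X_pow (μ - (μ + n)) 1 n
  simp only [map_one, one_mul] at this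
  rw [this]
  simp

/-- The action on an eigenvector is given by a power series. -/
theorem exists_smul_smul_eigen (μ : ℂ) (u : ATilde) (S : PowerSeries ℂ) :
    ∃ T : PowerSeries ℂ, PowerSeries.constantCoeff T = aug u * PowerSeries.constantCoeff S ∧
      ∃ q : ATilde, u * ofPS S = q * lin μ + ofPS T := by
  obtain ⟨q, T, h⟩ := exists_eq_mul_lin_add μ (u * ofPS S)
  refine ⟨T, ?_, q, h⟩
  have := congrArg aug h
  rw [map_mul, map_add, map_mul, aug_lin, mul_zero, zero_add, aug_ofPS, aug_ofPS] at this
  exact this.symm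

theorem smul_comm_X_pow (n : ℕ) (u : ATilde) : ∃ v : ATilde, aug v = aug u ∧
    ∀ x : E, (PowerSeries.X ^ n : PowerSeries ℂ) • u • x
      = v • (PowerSeries.X ^ n : PowerSeries ℂ) • x := by
  obtain ⟨v, hv, hv'⟩ := exists_b_pow_mul_eq n u
  refine ⟨v, hv', fun x => ?_⟩
  rw [X_pow_smul, X_pow_smul, ← mul_smul, ← mul_smul, hv]

theorem unit_smul_smul {S : PowerSeries ℂ} (hS : PowerSeries.constantCoeff S ≠ 0) (x : E) :
    S • S⁻¹ • x = x := by
  rw [← mul_smul, PowerSeries.mul_inv_cancel _ hS, one_smul]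

theorem unit_inv_smul_smul {S : PowerSeries ℂ} (hS : PowerSeries.constantCoeff S ≠ 0) (x : E) :
    S⁻¹ • S • x = x := by
  rw [← mul_smul, PowerSeries.inv_mul_cancel _ hS, one_smul]

theorem ps_smul_mem {F : Submodule ATilde E} (S : PowerSeries ℂ) {x : E} (h : x ∈ F) : S • x ∈ F :=
  F.smul_mem (ofPS S) h

theorem map_ps_smul {E' : Type*} [AddCommGroup E'] [Module ATilde E'] (f : E →ₗ[ATilde] E')
    (S : PowerSeries ℂ) (x : E) : f (S • x) = S • f x :=
  f.map_smul (ofPS S) x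

theorem span_unit_smul {S : PowerSeries ℂ} (hS : PowerSeries.constantCoeff S ≠ 0) (x : E) :
    Submodule.span ATilde {S • x} = Submodule.span ATilde {x} := by
  apply le_antisymm
  · rw [Submodule.span_singleton_le_iff_mem]
    exact ps_smul_mem S (Submodule.mem_span_singleton_self x)
  · rw [Submodule.span_singleton_le_iff_mem]
    have := ps_smul_mem S⁻¹ (Submodule.mem_span_singleton_self (R := ATilde) (S • x))
    rwa [unit_inv_smul_smul hS] at this

/-! ### Torsion-freeness, independence and spans over ℂ[[b]] -/

variable (E) in
/-- `b` acts injectively. -/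
def TorsionFree : Prop := ∀ x : E, (PowerSeries.X : PowerSeries ℂ) • x = 0 → x = 0

theorem TorsionFree.pow (h : TorsionFree E) (n : ℕ) {x : E}
    (hx : (PowerSeries.X ^ n : PowerSeries ℂ) • x = 0) : x = 0 := by
  induction n with
  | zero => simpa using hx
  | succ n ih => exact ih (h _ (by rw [← mul_smul, ← pow_succ']; exact hx))

theorem exists_eq_X_pow_mul {S : PowerSeries ℂ} (hS : S ≠ 0) :
    ∃ (n : ℕ) (T : PowerSeries ℂ), PowerSeries.constantCoeff T ≠ 0 ∧ S = PowerSeries.X ^ n * T := by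
  refine ⟨S.order.toNat, PowerSeries.divXPowOrder S, ?_, PowerSeries.X_pow_order_mul_divXPowOrder.symm⟩
  exact PowerSeries.constantCoeff_divXPowOrder_eq_zero_iff.not.mpr hS

theorem TorsionFree.smul_eq_zero (h : TorsionFree E) {S : PowerSeries ℂ} (hS : S ≠ 0) {x : E}
    (hx : S • x = 0) : x = 0 := by
  obtain ⟨n, T, hT, rfl⟩ := exists_eq_X_pow_mul hS
  rw [mul_smul] at hx
  have := h.pow n hx
  rw [← unit_inv_smul_smul hT x, this, smul_zero]

theorem TorsionFree.cancel (h : TorsionFree E) (n : ℕ) {x y : E}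
    (hx : (PowerSeries.X ^ n : PowerSeries ℂ) • x = (PowerSeries.X ^ n : PowerSeries ℂ) • y) :
    x = y := by
  rw [← sub_eq_zero, ← smul_sub] at hx
  exact sub_eq_zero.mp (h.pow n hx)

theorem TorsionFree.of_injective {E' : Type*} [AddCommGroup E'] [Module ATilde E']
    (f : E →ₗ[ATilde] E') (hf : Function.Injective f) (h : TorsionFree E') : TorsionFree E := by
  intro x hx
  apply hf
  rw [map_zero]
  apply h
  rw [← map_ps_smul, hx, map_zero]

/-- Linear independence over `ℂ[[b]]` of the first `k` terms of a sequence. -/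
def PSIndep (k : ℕ) (y : ℕ → E) : Prop :=
  ∀ S : ℕ → PowerSeries ℂ, ∑ i ∈ Finset.range k, S i • y i = 0 → ∀ i < k, S i = 0

theorem PSIndep.ext {k : ℕ} {y : ℕ → E} (h : PSIndep k y) {S T : ℕ → PowerSeries ℂ}
    (hST : ∑ i ∈ Finset.range k, S i • y i = ∑ i ∈ Finset.range k, T i • y i) :
    ∀ i < k, S i = T i := by
  intro i hi
  rw [← sub_eq_zero, ← Finset.sum_sub_distrib] at hST
  exact sub_eq_zero.mp (h (fun i => S i - T i) (by simpa only [sub_smul] using hST) i hi)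

/-- The `ℂ[[b]]`-combinations of the first `k` terms of a sequence. -/
def PSSpan (k : ℕ) (y : ℕ → E) (x : E) : Prop :=
  ∃ S : ℕ → PowerSeries ℂ, x = ∑ i ∈ Finset.range k, S i • y i

theorem PSIndep.mono {k m : ℕ} {y : ℕ → E} (h : PSIndep k y) (hm : m ≤ k) : PSIndep m y := by
  intro S hS i hi
  have := h (fun i => if i < m then S i else 0) ?_ i (by omega)
  · simpa [hi] using this
  · rw [← hS]
    symm
    refine (Finset.sum_congr rfl fun j hj => ?_).trans
      (Finset.sum_subset (Finset.range_subset_range.mpr hm) fun j _ hj => ?_)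
    · simp at hj; simp [hj]
    · simp at hj; simp [Nat.not_lt.mpr hj]

theorem PSIndep.ne_zero {k : ℕ} {y : ℕ → E} (h : PSIndep k y) {i : ℕ} (hi : i < k) : y i ≠ 0 := by
  intro h0
  have := h (Pi.single i 1) ?_ i hi
  · simp at this
  · refine Finset.sum_eq_zero fun j _ => ?_
    by_cases hj : j = i
    · subst hj; simp [h0]
    · simp [hj]

/-- Adding a vector with no nonzero multiple in the span. -/
theorem PSIndep.succ {k : ℕ} {y : ℕ → E} (h : PSIndep k y)
    (hy : ∀ S : PowerSeries ℂ, PSSpan k y (S • y k) → S = 0) : PSIndep (k + 1) y := by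
  intro S hS
  rw [Finset.sum_range_succ] at hS
  have hk : S k = 0 := by
    apply hy
    refine ⟨fun i => - S i, ?_⟩
    simp only [neg_smul, Finset.sum_neg_distrib]
    exact eq_neg_of_add_eq_zero_right hS
  rw [hk, zero_smul, add_zero] at hS
  intro i hi
  rcases Nat.lt_succ_iff_lt_or_eq.mp hi with h' | h'
  · exact h S hS i h'
  · rw [h', hk]

theorem PSSpan.smul {k : ℕ} {y : ℕ → E} {x : E} (h : PSSpan k y x) (S : PowerSeries ℂ) :
    PSSpan k y (S • x) := by
  obtain ⟨T, rfl⟩ := h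
  exact ⟨fun i => S * T i, by simp only [Finset.smul_sum, mul_smul]⟩

theorem PSSpan.add {k : ℕ} {y : ℕ → E} {x x' : E} (h : PSSpan k y x) (h' : PSSpan k y x') :
    PSSpan k y (x + x') := by
  obtain ⟨T, rfl⟩ := h
  obtain ⟨T', rfl⟩ := h'
  exact ⟨fun i => T i + T' i, by simp only [add_smul, Finset.sum_add_distrib]⟩

theorem PSSpan.mono {k m : ℕ} {y : ℕ → E} {x : E} (h : PSSpan m y x) (hm : m ≤ k) :
    PSSpan k y x := by
  obtain ⟨T, rfl⟩ := h
  refine ⟨fun i => if i < m then T i else 0, ?_⟩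
  refine (Finset.sum_congr rfl fun j hj => ?_).trans
      (Finset.sum_subset (Finset.range_subset_range.mpr hm) fun j _ hj => ?_)
  · simp at hj; simp [hj]
  · simp at hj; simp [Nat.not_lt.mpr hj]

theorem PSSpan.self {k i : ℕ} (y : ℕ → E) (hi : i < k) : PSSpan k y (y i) := by
  refine ⟨Pi.single i 1, ?_⟩
  rw [Finset.sum_eq_single i]
  · simp
  · intro j _ hj; simp [hj]
  · simp [hi]

theorem PSSpan.zero {k : ℕ} (y : ℕ → E) : PSSpan k y 0 := ⟨0, by simp⟩

theorem PSSpan.sum {k : ℕ} {y : ℕ → E} {ι : Type*} (s : Finset ι) (x : ι → E)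
    (h : ∀ i ∈ s, PSSpan k y (x i)) : PSSpan k y (∑ i ∈ s, x i) := by
  classical
  induction s using Finset.induction_on with
  | empty => exact PSSpan.zero y
  | insert i s hi ih =>
    rw [Finset.sum_insert hi]
    exact (h i (Finset.mem_insert_self _ _)).add
      (ih fun j hj => h j (Finset.mem_insert_of_mem hj))

theorem PSSpan.neg {k : ℕ} {y : ℕ → E} {x : E} (h : PSSpan k y x) : PSSpan k y (-x) := by
  have := h.smul (-1)
  rwa [neg_smul, one_smul] at this

end Module

section Chain

variable {E : Type*} [AddCommGroup E] [Module ATilde E]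

/-! ### Bases adapted to a Jordan-Hölder sequence -/

/-- `f 0, …, f (k - 1)` are independent over `ℂ[[b]]`, `(a - l_0 b) f_0 = 0` and
`(a - l_(i+1) b) f_(i+1) = U_i f_i` with `U_i` invertible. -/
structure IsChain (k : ℕ) (l : ℕ → ℚ) (U : ℕ → PowerSeries ℂ) (f : ℕ → E) : Prop where
  zero : 0 < k → lin (l 0) • f 0 = 0
  succ : ∀ i, i + 1 < k → lin (l (i + 1)) • f (i + 1) = U i • f i
  unit : ∀ i, i + 1 < k → PowerSeries.constantCoeff (U i) ≠ 0
  indep : PSIndep k f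

/-- The augmentation kills Ã (a - μ b), so it is defined on the quotient, where it would send the
left side to 0 and the right side to 1 if S(0) were 0. -/
theorem mkQ_one_generates {μ : ℂ} {S : PowerSeries ℂ} {v : ATilde}
    (h : (v * ofPS S) • (Submodule.Quotient.mk 1 : Cyc (lin μ)) = Submodule.Quotient.mk 1) :
    PowerSeries.constantCoeff S ≠ 0 := by
  intro h0
  rw [← Submodule.Quotient.mk_smul, Submodule.Quotient.eq, smul_eq_mul, mul_one,
    Submodule.mem_span_singleton] at h
  obtain ⟨q, hq⟩ := h
  have := congrArg aug hq
  rw [smul_eq_mul, map_mul, aug_lin, map_sub, map_mul, aug_ofPS, h0, map_one] at this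
  simp at this

theorem ps_smul_mk_one_eq_zero {μ : ℂ} {S : PowerSeries ℂ}
    (h : S • (Submodule.Quotient.mk 1 : Cyc (lin μ)) = 0) : S = 0 := by
  rw [ps_smul_def, ← Submodule.Quotient.mk_smul, Submodule.Quotient.mk_eq_zero, smul_eq_mul,
    mul_one, Submodule.mem_span_singleton] at h
  obtain ⟨q, hq⟩ := h
  exact eq_zero_of_mul_lin_eq μ q S hq

theorem exists_eq_smul_mk_one {μ : ℂ} (x : Cyc (lin μ)) :
    ∃ S : PowerSeries ℂ, x = S • (Submodule.Quotient.mk 1 : Cyc (lin μ)) := by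
  obtain ⟨u, rfl⟩ := Submodule.Quotient.mk_surjective _ x
  obtain ⟨q, S, h⟩ := exists_eq_mul_lin_add μ u
  refine ⟨S, ?_⟩
  rw [ps_smul_def, ← Submodule.Quotient.mk_smul, Submodule.Quotient.eq, smul_eq_mul, mul_one, h,
    add_sub_cancel_right]
  exact Submodule.mem_span_singleton.mpr ⟨q, rfl⟩

/-- One step in a Jordan-Hölder sequence of a monogenic module. -/
theorem exists_generator_of_quotient {F G : Submodule ATilde E} (hFG : F ≤ G) {μ : ℂ}
    (ψ : (G ⧸ F.submoduleOf G) ≃ₗ[ATilde] Cyc (lin μ)) {g : E}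
    (hg : G = Submodule.span ATilde {g}) :
    ∃ (f : E) (S : PowerSeries ℂ), PowerSeries.constantCoeff S ≠ 0 ∧ g = S • f ∧
      F = Submodule.span ATilde {lin μ • f} ∧ (∀ T : PowerSeries ℂ, T • f ∈ F → T = 0) ∧
      ∀ x ∈ G, ∃ T : PowerSeries ℂ, x - T • f ∈ F := by
  let φ : G →ₗ[ATilde] Cyc (lin μ) := ψ.toLinearMap ∘ₗ (F.submoduleOf G).mkQ
  have hφ : ∀ x : G, φ x = 0 ↔ (x : E) ∈ F := by
    intro x
    change ψ ((F.submoduleOf G).mkQ x) = 0 ↔ _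
    rw [LinearEquiv.map_eq_zero_iff, Submodule.mkQ_apply, Submodule.Quotient.mk_eq_zero]
    rfl
  have hsurj : Function.Surjective φ := ψ.surjective.comp (Submodule.mkQ_surjective _)
  have hgG : g ∈ G := hg ▸ Submodule.mem_span_singleton_self g
  obtain ⟨S, hS⟩ := exists_eq_smul_mk_one (φ ⟨g, hgG⟩)
  -- Since g generates G, some v g has image 1 in E_μ. Then S is invertible and S⁻¹ g is a generator
  -- of G whose image is exactly 1.
  have hS0 : PowerSeries.constantCoeff S ≠ 0 := by
    obtain ⟨⟨x, hx⟩, hx1⟩ := hsurj (Submodule.Quotient.mk 1)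
    have hx' := hx
    rw [hg, Submodule.mem_span_singleton] at hx'
    obtain ⟨v, hv⟩ := hx'
    apply mkQ_one_generates (μ := μ) (v := v)
    rw [mul_ofPS_smul, ← hS, ← map_smul, ← hx1]
    congr 1
    exact Subtype.ext hv
  set f : E := S⁻¹ • g with hf
  have hfG : f ∈ G := ps_smul_mem _ hgG
  have hf1 : φ ⟨f, hfG⟩ = Submodule.Quotient.mk 1 := by
    have : (⟨f, hfG⟩ : G) = ofPS S⁻¹ • ⟨g, hgG⟩ := rfl
    rw [this, map_smul, hS]
    exact unit_inv_smul_smul (E := Cyc (lin μ)) hS0 _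
  have hsm : ∀ u : ATilde, φ ⟨u • f, G.smul_mem u hfG⟩ = Submodule.Quotient.mk u := by
    intro u
    have : (⟨u • f, G.smul_mem u hfG⟩ : G) = u • ⟨f, hfG⟩ := rfl
    rw [this, map_smul, hf1, ← Submodule.Quotient.mk_smul, smul_eq_mul, mul_one]
  have hgf : g = S • f := (unit_smul_smul hS0 g).symm
  refine ⟨f, S, hS0, hgf, ?_, ?_, ?_⟩
  · apply le_antisymm
    · intro x hx
      have hx' := hFG hx
      rw [hg, hgf, span_unit_smul hS0, Submodule.mem_span_singleton] at hx'
      obtain ⟨u, rfl⟩ := hx'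
      have h0 := (hφ ⟨u • f, G.smul_mem u hfG⟩).mpr hx
      rw [hsm, Submodule.Quotient.mk_eq_zero, Submodule.mem_span_singleton] at h0
      obtain ⟨q, rfl⟩ := h0
      rw [smul_eq_mul, mul_smul]
      exact Submodule.smul_mem _ _ (Submodule.mem_span_singleton_self _)
    · rw [Submodule.span_singleton_le_iff_mem]
      apply (hφ ⟨lin μ • f, G.smul_mem _ hfG⟩).mp
      rw [hsm, Submodule.Quotient.mk_eq_zero]
      exact Submodule.mem_span_singleton_self _
  · intro T hT
    have h0 := (hφ ⟨ofPS T • f, G.smul_mem _ hfG⟩).mpr hT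
    apply ps_smul_mk_one_eq_zero (μ := μ)
    rw [← hf1, ← map_ps_smul]
    exact h0
  · intro x hx
    obtain ⟨T, hT⟩ := exists_eq_smul_mk_one (φ ⟨x, hx⟩)
    refine ⟨T, (hφ ⟨x - T • f, G.sub_mem hx (ps_smul_mem T hfG)⟩).mp ?_⟩
    have : (⟨x - T • f, G.sub_mem hx (ps_smul_mem T hfG)⟩ : G) = ⟨x, hx⟩ - ofPS T • ⟨f, hfG⟩ := rfl
    rw [this, map_sub, map_smul, hT, hf1]
    exact sub_self _

/-- A monogenic module with a Jordan-Hölder sequence has an adapted basis. -/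
theorem exists_isChain (k : ℕ) (lam : ℕ → ℚ) (F : ℕ → Submodule ATilde E) (hbot : F 0 = ⊥)
    (hmono : ∀ j < k + 1, F j ≤ F (j + 1))
    (hquot : ∀ j < k + 1, Nonempty
      ((F (j + 1) ⧸ (F j).submoduleOf (F (j + 1))) ≃ₗ[ATilde] Cyc (lin (lam (j + 1)))))
    (g : E) (hg : F (k + 1) = Submodule.span ATilde {g}) :
    ∃ (U : ℕ → PowerSeries ℂ) (f : ℕ → E), IsChain (k + 1) (fun i => lam (i + 1)) U f ∧
      (∃ S : PowerSeries ℂ, PowerSeries.constantCoeff S ≠ 0 ∧ g = S • f k) ∧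
      ∀ j ≤ k + 1, ∀ x, x ∈ F j ↔ PSSpan j f x := by
  classical
  induction k generalizing g with
  | zero =>
    obtain ⟨ψ⟩ := hquot 0 (by omega)
    obtain ⟨f, S, hS, hgS, hF, hT, hx⟩ := exists_generator_of_quotient (hmono 0 (by omega)) ψ hg
    have h0 : lin (lam 1) • f = 0 := by
      have : lin (lam 1) • f ∈ F 0 := hF ▸ Submodule.mem_span_singleton_self _
      rwa [hbot, Submodule.mem_bot] at this
    refine ⟨fun _ => 1, fun _ => f, ⟨fun _ => h0, fun i hi => by omega, fun i hi => by omega, ?_⟩,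
      ⟨S, hS, hgS⟩, ?_⟩
    · intro T hT0 i hi
      rw [Finset.sum_range_one] at hT0
      obtain rfl : i = 0 := by omega
      exact hT _ (by rw [hT0]; exact Submodule.zero_mem _)
    · intro j hj x
      rcases Nat.le_one_iff_eq_zero_or_eq_one.mp hj with rfl | rfl
      · rw [hbot, Submodule.mem_bot]
        exact ⟨fun h => ⟨0, by simp [h]⟩, fun ⟨T, hT⟩ => by simpa using hT⟩
      · constructor
        · intro h
          obtain ⟨T, hT⟩ := hx x h
          rw [hbot, Submodule.mem_bot] at hT
          exact ⟨fun _ => T, by simpa using sub_eq_zero.mp hT⟩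
        · rintro ⟨T, rfl⟩
          rw [Finset.sum_range_one]
          refine ps_smul_mem _ ?_
          change f ∈ F (0 + 1)
          rw [hg, hgS, span_unit_smul hS]
          exact Submodule.mem_span_singleton_self _
  | succ k ih =>
    obtain ⟨ψ⟩ := hquot (k + 1) (by omega)
    obtain ⟨fk, S, hS, hgS, hF, hT, hx⟩ :=
      exists_generator_of_quotient (hmono (k + 1) (by omega)) ψ hg
    obtain ⟨U, f, hch, ⟨S', hS', hgS'⟩, hsp⟩ := ih (fun j hj => hmono j (by omega))
      (fun j hj => hquot j (by omega)) _ hF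
    have hfne : ∀ i, i < k + 1 → Function.update f (k + 1) fk i = f i := fun i hi =>
      Function.update_of_ne (by omega) _ _
    have hUne : ∀ i, i < k → Function.update U k S' i = U i := fun i hi =>
      Function.update_of_ne (by omega) _ _
    have hspan : ∀ j ≤ k + 1, ∀ x, PSSpan j (Function.update f (k + 1) fk) x ↔ PSSpan j f x := by
      intro j hj x
      have : ∀ T : ℕ → PowerSeries ℂ, ∑ i ∈ Finset.range j, T i • Function.update f (k + 1) fk i
          = ∑ i ∈ Finset.range j, T i • f i := fun T => Finset.sum_congr rfl fun i hi => by
        rw [hfne i (by have := Finset.mem_range.mp hi; omega)]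
      simp only [PSSpan, this]
    have hfk : fk ∈ F (k + 1 + 1) := by
      rw [hg, hgS, span_unit_smul hS]
      exact Submodule.mem_span_singleton_self _
    refine ⟨Function.update U k S', Function.update f (k + 1) fk, ⟨?_, ?_, ?_, ?_⟩,
      ⟨S, hS, ?_⟩, ?_⟩
    · intro _
      rw [hfne 0 (by omega)]
      exact hch.zero (by omega)
    · intro i hi
      rw [hfne i (by omega)]
      by_cases hik : i = k
      · subst hik
        rw [Function.update_self, Function.update_self]
        exact hgS'
      · rw [hfne (i + 1) (by omega), hUne i (by omega)]
        exact hch.succ i (by omega)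
    · intro i hi
      by_cases hik : i = k
      · subst hik
        rwa [Function.update_self]
      · rw [hUne i (by omega)]
        exact hch.unit i (by omega)
    · apply PSIndep.succ
      · intro T hT0
        refine hch.indep T ?_
        rw [← hT0]
        exact Finset.sum_congr rfl fun i hi => by rw [hfne i (Finset.mem_range.mp hi)]
      · intro T hT0
        rw [Function.update_self] at hT0
        exact hT T ((hsp (k + 1) le_rfl _).mpr ((hspan _ le_rfl _).mp hT0))
    · rw [Function.update_self]; exact hgS
    · intro j hj x
      rcases Nat.lt_or_ge (k + 1) j with h | h
      · obtain rfl : j = k + 1 + 1 := by omega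
        constructor
        · intro hxF
          obtain ⟨T, hT⟩ := hx x hxF
          have h1 := ((hspan _ le_rfl _).mpr ((hsp (k + 1) le_rfl _).mp hT)).mono
            (Nat.le_succ (k + 1))
          have h2 := (PSSpan.self (Function.update f (k + 1) fk) (Nat.lt_succ_self (k + 1))).smul T
          rw [Function.update_self] at h2
          have := h1.add h2
          rwa [sub_add_cancel] at this
        · rintro ⟨T, rfl⟩
          rw [Finset.sum_range_succ, Function.update_self]
          refine Submodule.add_mem _ (hmono (k + 1) (by omega) ?_) (ps_smul_mem _ hfk)
          exact (hsp (k + 1) le_rfl _).mpr ((hspan _ le_rfl _).mp ⟨T, rfl⟩)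
      · exact (hsp j h x).trans (hspan j h x).symm

namespace IsChain

variable {k : ℕ} {l : ℕ → ℚ} {U : ℕ → PowerSeries ℂ} {f : ℕ → E}

theorem lin_smul_sum (h : IsChain k l U f) {n : ℕ} (hn : n < k) (μ : ℂ) (S : ℕ → PowerSeries ℂ) :
    lin μ • ∑ i ∈ Finset.range (n + 1), S i • f i
      = ∑ i ∈ Finset.range n, (PowerSeries.X * euler (l i - μ) (S i) + S (i + 1) * U i) • f i
        + (PowerSeries.X * euler (l n - μ) (S n)) • f n := by
  have h1 : ∀ i, lin μ • S i • f i = (PowerSeries.X * euler (l i - μ) (S i)) • f i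
      + S i • lin (l i) • f i := fun i => lin_smul_smul rfl μ (S i)
  rw [Finset.smul_sum, Finset.sum_congr rfl fun i _ => h1 i, Finset.sum_add_distrib,
    Finset.sum_range_succ' (fun i => S i • lin (l i) • f i), h.zero (by omega), smul_zero,
    add_zero, Finset.sum_range_succ]
  simp only [add_smul, Finset.sum_add_distrib]
  rw [add_right_comm]
  congr 2
  refine Finset.sum_congr rfl fun i hi => ?_
  rw [h.succ i (by have := Finset.mem_range.mp hi; omega), mul_smul]

theorem not_psSpan (h : IsChain k l U f) {m : ℕ} (hm : m < k) : ¬ PSSpan m f (f m) := by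
  rintro ⟨S, hS⟩
  have := h.indep.mono (show m + 1 ≤ k by omega) (fun i => if i < m then S i else -1) ?_ m
    (Nat.lt_succ_self m)
  · simp at this
  · rw [Finset.sum_range_succ, if_neg (lt_irrefl m), neg_smul, one_smul, hS, add_neg_eq_zero]
    exact Finset.sum_congr rfl fun i hi => by rw [if_pos (Finset.mem_range.mp hi)]

/-- The shape of the vectors that are eigenvectors modulo the first `m` basis vectors. -/
theorem eigen_mod (h : IsChain k l U f) {m : ℕ} {μ : ℂ} {x : E} (hx : PSSpan k f x)
    (hxm : ¬ PSSpan m f x) (hl : PSSpan m f (lin μ • x)) :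
    ∃ (j n : ℕ) (c : ℂ) (z : E), m ≤ j ∧ j < k ∧ c ≠ 0 ∧ μ = l j + n ∧ j ≤ m + n ∧
      PSSpan j f z ∧ x = z + (PowerSeries.C c * PowerSeries.X ^ n) • f j := by
  classical
  -- j is the index of the last basis vector that occurs in x.
  obtain ⟨j, hjk, hj, hj'⟩ : ∃ j, j < k ∧ PSSpan (j + 1) f x ∧ ¬ PSSpan j f x := by
    have hex : ∃ j, PSSpan j f x := ⟨k, hx⟩
    have h0 : Nat.find hex ≠ 0 := by
      intro h0
      have := Nat.find_spec hex
      rw [h0] at this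
      exact hxm (this.mono (Nat.zero_le m))
    refine ⟨Nat.find hex - 1, ?_, ?_, ?_⟩
    · have := Nat.find_min' hex hx; omega
    · rw [Nat.sub_add_cancel (by omega)]; exact Nat.find_spec hex
    · exact Nat.find_min hex (by omega)
  have hmj : m ≤ j := by
    by_contra hlt
    exact hxm (hj.mono (by omega))
  obtain ⟨S, hS⟩ := hj
  obtain ⟨T, hT⟩ := hl
  have hSj : S j ≠ 0 := by
    intro h0
    refine hj' ⟨S, ?_⟩
    rw [hS, Finset.sum_range_succ, h0, zero_smul, add_zero]
  have hco := (h.indep.mono (show j + 1 ≤ k by omega)).ext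
    (S := fun i => if i < j then PowerSeries.X * euler (l i - μ) (S i) + S (i + 1) * U i
      else PowerSeries.X * euler (l i - μ) (S i))
    (T := fun i => if i < m then T i else 0) (by
      rw [Finset.sum_range_succ, if_neg (lt_irrefl j)]
      rw [hS, h.lin_smul_sum hjk] at hT
      have e1 : ∑ i ∈ Finset.range (j + 1), (if i < m then T i else 0) • f i
          = ∑ i ∈ Finset.range m, T i • f i := by
        symm
        refine (Finset.sum_congr rfl fun i hi => ?_).trans
          (Finset.sum_subset (Finset.range_subset_range.mpr (by omega)) fun i _ hi => ?_)
        · simp at hi; simp [hi]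
        · simp at hi; simp [Nat.not_lt.mpr hi]
      rw [e1, ← hT]
      congr 1
      exact Finset.sum_congr rfl fun i hi => by rw [if_pos (Finset.mem_range.mp hi)])
  have htop : euler (l j - μ) (S j) = 0 := by
    have := hco j (Nat.lt_succ_self j)
    simp only [lt_irrefl, if_false, Nat.not_lt.mpr hmj] at this
    exact (mul_eq_zero.mp this).resolve_left PowerSeries.X_ne_zero
  -- For m ≤ i < j the coefficient of f_i in (a - μ b) x vanishes: b (b d/db + l_i - μ) S_i +
  -- S_{i+1} U_i = 0. As U_i is invertible, S_{i+1} is divisible by one more power of b than S_i. At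
  -- i = j this gives n ≥ j - m, that is l_j + j ≤ μ + m.
  have hdvd : ∀ d, m + d ≤ j → PowerSeries.X ^ d ∣ S (m + d) := by
    intro d
    induction d with
    | zero => intro _; simp
    | succ d ih =>
      intro hd
      have h1 := hco (m + d) (by omega)
      simp only [show m + d < j by omega, if_true, show ¬ (m + d < m) by omega, if_false] at h1
      obtain ⟨W, hW⟩ := ih (by omega)
      have h2 : PowerSeries.X ^ (d + 1) ∣ S (m + d + 1) * U (m + d) := by
        have e : S (m + d + 1) * U (m + d) = - (PowerSeries.X * euler (l (m + d) - μ) (S (m + d))) := by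
          linear_combination h1
        rw [e, dvd_neg, pow_succ']
        apply mul_dvd_mul_left
        rw [PowerSeries.X_pow_dvd_iff]
        intro i hi
        rw [coeff_euler, hW, PowerSeries.coeff_X_pow_mul', if_neg (by omega), mul_zero]
      have hu : IsUnit (U (m + d)) := by
        rw [PowerSeries.isUnit_iff_constantCoeff, isUnit_iff_ne_zero]
        exact h.unit (m + d) (by omega)
      exact hu.dvd_mul_right.mp h2
  obtain ⟨n, c, hc, hn, hSn⟩ := eq_monomial_of_euler_eq_zero htop hSj
  refine ⟨j, n, c, ∑ i ∈ Finset.range j, S i • f i, hmj, hjk, hc, by linear_combination -hn, ?_,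
    ⟨S, rfl⟩, ?_⟩
  · have := hdvd (j - m) (by omega)
    rw [show m + (j - m) = j by omega, hSn, PowerSeries.X_pow_dvd_iff] at this
    by_contra hlt
    have := this n (by omega)
    simp [hc] at this
  · rw [hS, Finset.sum_range_succ, hSn]

theorem lin_smul_psSpan (h : IsChain k l U f) {m : ℕ} (hm : m < k) :
    PSSpan m f (lin (l m) • f m) := by
  cases m with
  | zero => rw [h.zero hm]; exact PSSpan.zero f
  | succ m => rw [h.succ m hm]; exact (PSSpan.self f (Nat.lt_succ_self m)).smul _

/-- Invertibility of the U_i lets one recover f_{m-1}, f_{m-2}, … from f_m by applying the operators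
a - l_i b. Conversely, successive right divisions reduce the action of Ã on f_m to power series. -/
theorem psSpan_iff_mem_span (h : IsChain k l U f) {m : ℕ} (hm : m < k) (x : E) :
    PSSpan (m + 1) f x ↔ x ∈ Submodule.span ATilde {f m} := by
  constructor
  · rintro ⟨S, rfl⟩
    have hmem : ∀ d ≤ m, f (m - d) ∈ Submodule.span ATilde {f m} := by
      intro d
      induction d with
      | zero => intro _; exact Submodule.mem_span_singleton_self _
      | succ d ih =>
        intro hd
        have h1 := h.succ (m - (d + 1)) (by omega)
        rw [show m - (d + 1) + 1 = m - d by omega] at h1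
        have h2 := Submodule.smul_mem _ (lin (l (m - d))) (ih (by omega))
        rw [h1] at h2
        have h3 := ps_smul_mem (U (m - (d + 1)))⁻¹ h2
        rwa [unit_inv_smul_smul (h.unit _ (by omega))] at h3
    refine Submodule.sum_mem _ fun i hi => ps_smul_mem _ ?_
    have := hmem (m - i) (by omega)
    rwa [show m - (m - i) = i by have := Finset.mem_range.mp hi; omega] at this
  · intro hx
    obtain ⟨u, rfl⟩ := Submodule.mem_span_singleton.mp hx
    clear hx
    induction m generalizing u with
    | zero =>
      obtain ⟨q, S, rfl⟩ := exists_eq_mul_lin_add (l 0) u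
      rw [add_smul, mul_smul, h.zero hm, smul_zero, zero_add (ofPS S • f 0)]
      exact (PSSpan.self f (Nat.lt_succ_self 0)).smul S
    | succ m ih =>
      obtain ⟨q, S, rfl⟩ := exists_eq_mul_lin_add (l (m + 1)) u
      rw [add_smul, mul_smul, h.succ m hm, ← mul_ofPS_smul]
      exact ((ih (by omega) _).mono (by omega)).add
        ((PSSpan.self f (Nat.lt_succ_self (m + 1))).smul S)

end IsChain

/-- Two adapted bases, one of them with strictly increasing `l_i + i`, span the same submodules. -/
theorem IsChain.unique {k : ℕ} {l l' : ℕ → ℚ} {U U' : ℕ → PowerSeries ℂ} {f f' : ℕ → E}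
    (h : IsChain k l U f) (h' : IsChain k l' U' f')
    (hspan : ∀ x, PSSpan k f x ↔ PSSpan k f' x)
    (hl : ∀ i j, i < j → j < k → l i + i < l j + j)
    (hl' : ∀ i j, i ≤ j → j < k → l' i + i ≤ l' j + j) (m : ℕ) (hm : m ≤ k) :
    (∀ i < m, l i = l' i) ∧ ∀ x, PSSpan m f x ↔ PSSpan m f' x := by
  induction m with
  | zero =>
    exact ⟨fun i hi => by omega, fun x => by simp [PSSpan]⟩
  | succ m ih =>
    obtain ⟨ih1, ih2⟩ := ih (by omega)
    have hlw : ∀ i j, i ≤ j → j < k → l i + i ≤ l j + j := by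
      intro i j hij hj
      rcases hij.lt_or_eq with h1 | h1
      · exact (hl i j h1 hj).le
      · rw [h1]
    -- Modulo the common span of the first m vectors, f'_m and f_m are eigenvectors. Applied in both
    -- bases, `eigen_mod` gives l_m + m ≤ l'_m + m and the reverse; equality and strictness in the
    -- first basis then force j = m and n = 0, so f'_m is a nonzero multiple of f_m modulo the
    -- earlier vectors.
    obtain ⟨j, n, c, z, hmj, hjk, hc, hμ, hjn, hz, hx⟩ := h.eigen_mod (m := m) (μ := l' m)
      (x := f' m) ((hspan _).mpr (PSSpan.self f' (by omega)))
      (fun h1 => h'.not_psSpan (by omega) ((ih2 _).mp h1))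
      ((ih2 _).mpr (h'.lin_smul_psSpan (by omega)))
    obtain ⟨j', n', -, -, hmj', hjk', -, hμ', hjn', -, -⟩ := h'.eigen_mod (m := m) (μ := l m)
      (x := f m) ((hspan _).mp (PSSpan.self f (by omega)))
      (fun h1 => h.not_psSpan (by omega) ((ih2 _).mpr h1))
      ((ih2 _).mp (h.lin_smul_psSpan (by omega)))
    have e1 : l' m = l j + n := by exact_mod_cast hμ
    have e2 : l m = l' j' + n' := by exact_mod_cast hμ'
    have q1 : (j : ℚ) ≤ m + n := by exact_mod_cast hjn
    have q2 : (j' : ℚ) ≤ m + n' := by exact_mod_cast hjn'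
    have i1 := hlw m j hmj hjk
    have i2 := hl' m j' hmj' hjk'
    obtain rfl : m = j := by
      by_contra hne
      have := hl m j (by omega) hjk
      linarith
    have hn : n = 0 := by
      have : (n : ℚ) = 0 := by
        have : (0 : ℚ) ≤ n := by positivity
        linarith
      exact_mod_cast this
    subst hn
    have hlm : l m = l' m := by rw [e1]; simp
    refine ⟨fun i hi => ?_, fun x => ?_⟩
    · rcases Nat.lt_succ_iff_lt_or_eq.mp hi with h1 | h1
      · exact ih1 i h1
      · rw [h1, hlm]
    · rw [pow_zero, mul_one] at hx
      have hx' : f m = PowerSeries.C c⁻¹ • f' m + -(PowerSeries.C c⁻¹ • z) := by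
        rw [hx, smul_add, ← mul_smul, ← map_mul, inv_mul_cancel₀ hc, map_one, one_smul]
        abel
      constructor
      · rintro ⟨S, rfl⟩
        rw [Finset.sum_range_succ, hx']
        exact ((((ih2 _).mp ⟨S, rfl⟩).mono (Nat.le_succ m))).add
          ((((PSSpan.self f' (Nat.lt_succ_self m)).smul _).add
            ((((ih2 _).mp hz).smul _).neg.mono (Nat.le_succ m))).smul _)
      · rintro ⟨S, rfl⟩
        rw [Finset.sum_range_succ, hx]
        exact ((((ih2 _).mpr ⟨S, rfl⟩).mono (Nat.le_succ m))).add
          (((hz.mono (Nat.le_succ m)).add ((PSSpan.self f (Nat.lt_succ_self m)).smul _)).smul _)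

end Chain

/-! ### Semi-simplicity -/

section Semisimple

/-- In degree 0 the equation says R_0² = 0; in degree n > 0 every product R_i R_j with i + j = n
contains an earlier coefficient, so n R_n = 0. -/
theorem eq_zero_of_euler_zero_add_sq {R : PowerSeries ℂ} (h : euler 0 R + R ^ 2 = 0) : R = 0 := by
  have key : ∀ n, PowerSeries.coeff n R = 0 := by
    intro n
    induction n using Nat.strong_induction_on with
    | _ n ih =>
      have h1 := congrArg (PowerSeries.coeff n) h
      rw [map_add, coeff_euler, sq, PowerSeries.coeff_mul, map_zero, add_zero] at h1
      rcases Nat.eq_zero_or_pos n with rfl | hn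
      · simpa using h1
      · rw [Finset.sum_eq_zero, add_zero, mul_eq_zero] at h1
        · exact h1.resolve_left (by exact_mod_cast hn.ne')
        · rintro ⟨i, j⟩ hij
          rw [Finset.HasAntidiagonal.mem_antidiagonal] at hij
          rcases Nat.lt_or_ge i n with hi | hi
          · rw [ih i hi, zero_mul]
          · rw [ih j (by simp only at hij; omega), mul_zero]
  exact PowerSeries.ext fun n => by rw [key n, map_zero]

theorem powerSeries_dvd_total (S T : PowerSeries ℂ) : (∃ Q, T = Q * S) ∨ ∃ Q, S = Q * T := by
  by_cases hS : S = 0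
  · exact Or.inr ⟨0, by rw [hS, zero_mul]⟩
  by_cases hT : T = 0
  · exact Or.inl ⟨0, by rw [hT, zero_mul]⟩
  obtain ⟨n, u, hu, rfl⟩ := exists_eq_X_pow_mul hS
  obtain ⟨m, v, hv, rfl⟩ := exists_eq_X_pow_mul hT
  rcases le_total n m with h | h
  · refine Or.inl ⟨PowerSeries.X ^ (m - n) * v * u⁻¹, ?_⟩
    have e : (PowerSeries.X ^ m : PowerSeries ℂ) = PowerSeries.X ^ (m - n) * PowerSeries.X ^ n := by
      rw [← pow_add, Nat.sub_add_cancel h]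
    rw [e]
    linear_combination -PowerSeries.X ^ (m - n) * PowerSeries.X ^ n * v
      * PowerSeries.mul_inv_cancel u hu
  · refine Or.inr ⟨PowerSeries.X ^ (n - m) * u * v⁻¹, ?_⟩
    have e : (PowerSeries.X ^ n : PowerSeries ℂ) = PowerSeries.X ^ (n - m) * PowerSeries.X ^ m := by
      rw [← pow_add, Nat.sub_add_cancel h]
    rw [e]
    linear_combination -PowerSeries.X ^ (n - m) * PowerSeries.X ^ m * u
      * PowerSeries.mul_inv_cancel v hv

/-- `b⁻¹ a` has no nontrivial Jordan block. -/
def NoLog (E : Type*) [AddCommGroup E] [Module ATilde E] : Prop :=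
  ∀ (μ : ℂ) (x : E), lin (μ + 1) • lin μ • x = 0 → lin μ • x = 0

theorem NoLog.of_injective {E E' : Type*} [AddCommGroup E] [Module ATilde E] [AddCommGroup E']
    [Module ATilde E'] (f : E →ₗ[ATilde] E') (hf : Function.Injective f) (h : NoLog E') :
    NoLog E := by
  intro μ x hx
  apply hf
  rw [map_zero, map_smul]
  apply h
  rw [← map_smul, ← map_smul, hx, map_zero]

theorem torsionFree_of_isABModule {E : Type*} [AddCommGroup E] [Module ATilde E]
    (h : IsABModule E) : TorsionFree E := by
  obtain ⟨hfree, -⟩ := h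
  intro x hx
  have := hfree
  exact (smul_eq_zero.mp hx).resolve_left PowerSeries.X_ne_zero

/-- In rank one, x and (a - μ b) x are comparable for divisibility over ℂ[[b]], and in either case
the relation forces the second to vanish. -/
theorem noLog_of_rank_one {E : Type*} [AddCommGroup E] [Module ATilde E] (h : IsABModule E)
    (h1 : abRank E = 1) : NoLog E := by
  have htf := torsionFree_of_isABModule h
  obtain ⟨hfree, hfin⟩ := h
  let B := Module.finBasisOfFinrankEq (PowerSeries ℂ) E h1
  have hB : ∀ x : E, ∃ S : PowerSeries ℂ, x = S • B 0 := fun x => by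
    refine ⟨B.repr x 0, ?_⟩
    have := (B.sum_repr x).symm
    simpa using this
  intro μ x hx
  obtain ⟨S, hS⟩ := hB x
  obtain ⟨T, hT⟩ := hB (lin μ • x)
  -- If (a - μ b) x = Q x with x ≠ 0, then b (b Q' - Q) + Q² = 0; writing Q = b R gives b R' + R² =
  -- 0, so R = 0. If x = Q (a - μ b) x, applying a - μ b shows that (a - μ b) x is killed by a
  -- series with constant term -1.
  rcases powerSeries_dvd_total S T with ⟨Q, hQ⟩ | ⟨Q, hQ⟩
  · have hy : lin μ • x = Q • x := by rw [hT, hQ, mul_smul, ← hS]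
    rw [hy, lin_smul_smul hy, ← mul_smul, ← add_smul] at hx
    by_cases hx0 : x = 0
    · rw [hx0, smul_zero]
    have h0 : PowerSeries.X * euler (μ - (μ + 1)) Q + Q * Q = 0 := by
      by_contra hne
      exact hx0 (htf.smul_eq_zero hne hx)
    have hQ0 : PowerSeries.constantCoeff Q = 0 := by
      have := congrArg PowerSeries.constantCoeff h0
      simpa using this
    obtain ⟨R, rfl⟩ := PowerSeries.X_dvd_iff.mpr hQ0
    have e : euler 0 R + R ^ 2 = 0 := by
      rw [euler_X_mul, show μ - (μ + 1) + 1 = 0 by ring] at h0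
      have h2 : (PowerSeries.X * PowerSeries.X) * (euler 0 R + R ^ 2) = 0 := by
        linear_combination h0
      exact (mul_eq_zero.mp h2).resolve_left (mul_ne_zero PowerSeries.X_ne_zero
        PowerSeries.X_ne_zero)
    rw [hy, eq_zero_of_euler_zero_add_sq e, mul_zero, zero_smul]
  · have hxy : x = Q • lin μ • x := by rw [hT, ← mul_smul, ← hQ, ← hS]
    have h2 := lin_smul_smul_eigen hx μ Q
    rw [← hxy] at h2
    have h3 : (PowerSeries.X * euler (μ + 1 - μ) Q - 1) • lin μ • x = 0 := by
      rw [sub_smul, one_smul, ← h2, sub_self]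
    refine htf.smul_eq_zero ?_ h3
    intro h0
    have := congrArg PowerSeries.constantCoeff h0
    simp at this

theorem IsSemisimple.noLog {E : Type*} [AddCommGroup E] [Module ATilde E] (h : IsSemisimple E) :
    NoLog E := by
  obtain ⟨n, M, _, _, hM, f, hf⟩ := h
  refine NoLog.of_injective f hf ?_
  intro μ x hx
  funext i
  exact noLog_of_rank_one (hM i).1.1 (hM i).2 μ (x i) (congrFun hx i)

end Semisimple

/-! ### Diagonalisation up to one Jordan block -/

section NormalForm

variable {E : Type*} [AddCommGroup E] [Module ATilde E]

theorem PSIndep.eq_zero_of_smul {k : ℕ} {y : ℕ → E} (h : PSIndep (k + 1) y) {S : PowerSeries ℂ}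
    (hS : PSSpan k y (S • y k)) : S = 0 := by
  obtain ⟨T, hT⟩ := hS
  have := h (fun i => if i < k then T i else -S) ?_ k (Nat.lt_succ_self k)
  · simpa using this
  · rw [Finset.sum_range_succ, if_neg (lt_irrefl k), neg_smul, hT, add_neg_eq_zero]
    exact Finset.sum_congr rfl fun i hi => by rw [if_pos (Finset.mem_range.mp hi)]

theorem sum_update {k : ℕ} {y : ℕ → E} {S : ℕ → PowerSeries ℂ} (z : E) (T : PowerSeries ℂ) :
    ∑ i ∈ Finset.range (k + 1), Function.update S k T i • Function.update y k z i
      = ∑ i ∈ Finset.range k, S i • y i + T • z := by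
  rw [Finset.sum_range_succ, Function.update_self, Function.update_self]
  congr 1
  refine Finset.sum_congr rfl fun i hi => ?_
  have := Finset.mem_range.mp hi
  rw [Function.update_of_ne (by omega), Function.update_of_ne (by omega)]

theorem PSIndep.update {k : ℕ} {y : ℕ → E} (h : PSIndep k y) (z : E)
    (hz : ∀ S : PowerSeries ℂ, PSSpan k y (S • z) → S = 0) :
    PSIndep (k + 1) (Function.update y k z) := by
  have hsum : ∀ S : ℕ → PowerSeries ℂ, ∑ i ∈ Finset.range k, S i • Function.update y k z i
      = ∑ i ∈ Finset.range k, S i • y i := fun S => Finset.sum_congr rfl fun i hi => by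
    have := Finset.mem_range.mp hi
    rw [Function.update_of_ne (by omega)]
  apply PSIndep.succ
  · intro S hS
    rw [hsum] at hS
    exact h S hS
  · intro S hS
    rw [Function.update_self] at hS
    simp only [PSSpan, hsum] at hS
    exact hz S hS

/-- Modifying a vector so that its image by `a - ν b` is a sum of resonant terms. -/
theorem exists_log_vector {n : ℕ} {y : ℕ → E} {ε : ℕ → ℂ} {W : ℕ → PowerSeries ℂ} {ν : ℂ} {x : E}
    (hy : ∀ i < n, lin (ε i) • y i = 0)
    (hx : lin ν • x = ∑ i ∈ Finset.range n, (PowerSeries.X * W i) • y i) :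
    ∃ T r : ℕ → PowerSeries ℂ,
      lin ν • (x - ∑ i ∈ Finset.range n, T i • y i)
        = ∑ i ∈ Finset.range n, (PowerSeries.X * r i) • y i ∧
      lin (ν + 1) • lin ν • (x - ∑ i ∈ Finset.range n, T i • y i) = 0 ∧
      (∀ i, euler (ε i - ν) (r i) = 0) ∧
      (∀ i, ε i ≠ ν → (ε i - ν) * PowerSeries.constantCoeff (T i)
        = PowerSeries.constantCoeff (W i)) ∧
      ∀ i, ε i = ν → PowerSeries.constantCoeff (r i) = PowerSeries.constantCoeff (W i) := by
  choose T r h1 h2 h3 h4 using fun i => exists_euler_add_eq (ε i - ν) (W i)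
  have hlin : lin ν • (x - ∑ i ∈ Finset.range n, T i • y i)
        = ∑ i ∈ Finset.range n, (PowerSeries.X * r i) • y i := by
    rw [smul_sub, hx, Finset.smul_sum, ← Finset.sum_sub_distrib]
    refine Finset.sum_congr rfl fun i hi => ?_
    rw [lin_smul_smul_eigen (hy i (Finset.mem_range.mp hi)), ← sub_smul, ← h1 i]
    congr 1
    ring
  refine ⟨T, r, hlin, ?_, h2, fun i hi => h3 i (sub_ne_zero.mpr hi),
    fun i hi => h4 i (sub_eq_zero.mpr hi)⟩
  rw [hlin, Finset.smul_sum]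
  refine Finset.sum_eq_zero fun i hi => ?_
  rw [lin_smul_smul_eigen (hy i (Finset.mem_range.mp hi)), euler_X_mul,
    show ε i - (ν + 1) + 1 = ε i - ν by ring, h2 i, mul_zero, mul_zero, zero_smul]

theorem IsChain.prefix {k m : ℕ} {l : ℕ → ℚ} {U : ℕ → PowerSeries ℂ} {f : ℕ → E}
    (h : IsChain k l U f) (hm : m ≤ k) : IsChain m l U f :=
  ⟨fun h0 => h.zero (by omega), fun i hi => h.succ i (by omega), fun i hi => h.unit i (by omega),
    h.indep.mono hm⟩

/-- `b^M g = ∑ R_i y_i` with `R_i` invertible and `y_i` independent eigenvectors. -/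
structure IsDiagonalForm (k : ℕ) (e : ℕ → ℚ) (M : ℕ) (y : ℕ → E) (R : ℕ → PowerSeries ℂ) (g : E) :
    Prop where
  indep : PSIndep k y
  eigen : ∀ i < k, lin ((e i + M : ℚ) : ℂ) • y i = 0
  eq : (PowerSeries.X ^ M : PowerSeries ℂ) • g = ∑ i ∈ Finset.range k, R i • y i
  unit : ∀ i < k, PowerSeries.constantCoeff (R i) ≠ 0

/-- The extension step shared by the semi-simple case and the general one. -/
theorem IsChain.exists_extension {k : ℕ} {l : ℕ → ℚ} {U : ℕ → PowerSeries ℂ} {f : ℕ → E}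
    (h : IsChain (k + 2) l U f) {M : ℕ} {y : ℕ → E} {R : ℕ → PowerSeries ℂ}
    (hd : IsDiagonalForm (k + 1) (fun i => l i + i - k) M y R (f k))
    (hy : ∀ i < k + 1, PSSpan (i + 1) f (y i)) :
    ∃ (z : E) (T r : ℕ → PowerSeries ℂ),
      (PowerSeries.X ^ (M + 1) : PowerSeries ℂ) • f (k + 1)
        = ∑ i ∈ Finset.range (k + 1), T i • y i + z ∧
      PSSpan (k + 2) f z ∧
      PSIndep (k + 2) (Function.update y (k + 1) z) ∧
      lin ((l (k + 1) + (M + 1 : ℕ) : ℚ) : ℂ) • z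
        = ∑ i ∈ Finset.range (k + 1), (PowerSeries.X * r i) • y i ∧
      lin ((l (k + 1) + (M + 1 : ℕ) : ℚ) + 1 : ℂ) • lin ((l (k + 1) + (M + 1 : ℕ) : ℚ) : ℂ) • z = 0 ∧
      (∀ i, euler (((l i + i - (l (k + 1) + (k + 1 : ℕ)) : ℚ)) : ℂ) (r i) = 0) ∧
      (∀ i < k + 1, l i + i ≠ l (k + 1) + (k + 1 : ℕ) → PowerSeries.constantCoeff (T i) ≠ 0) ∧
      (∀ i < k + 1, l i + i = l (k + 1) + (k + 1 : ℕ) → r i ≠ 0) := by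
  -- The image of b^(M+1) f_{k+1} is b^(M+1) U_k f_k, where f_k needs only the denominator b^M; the
  -- spare factor b is the one required by the Euler equations of `exists_log_vector`. This is why M
  -- grows by one at each step.
  have hx : lin ((l (k + 1) + (M + 1 : ℕ) : ℚ) : ℂ) • (PowerSeries.X ^ (M + 1) : PowerSeries ℂ) • f (k + 1)
      = ∑ i ∈ Finset.range (k + 1), (PowerSeries.X * (U k * R i)) • y i := by
    have e := lin_smul_X_pow_smul (l (k + 1) : ℂ) (M + 1) (f (k + 1))
    rw [h.succ k (by omega), ← mul_smul] at e
    have e2 : (PowerSeries.X ^ (M + 1) * U k : PowerSeries ℂ)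
        = (PowerSeries.X * U k) * PowerSeries.X ^ M := by ring
    rw [e2, mul_smul, hd.eq, Finset.smul_sum] at e
    push_cast at e ⊢
    rw [e]
    exact Finset.sum_congr rfl fun i _ => by rw [← mul_smul, mul_assoc]
  obtain ⟨T, r, h1, h2, h3, h4, h5⟩ := exists_log_vector hd.eigen hx
  have hδ : ∀ i : ℕ, (((l i + i - k + M : ℚ)) : ℂ) - ((l (k + 1) + (M + 1 : ℕ) : ℚ) : ℂ)
      = ((l i + i - (l (k + 1) + (k + 1 : ℕ)) : ℚ) : ℂ) := by
    intro i; push_cast; ring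
  have hW : ∀ i < k + 1, PowerSeries.constantCoeff (U k * R i) ≠ 0 := fun i hi => by
    rw [map_mul]
    exact mul_ne_zero (h.unit k (by omega)) (hd.unit i hi)
  have hsum : PSSpan (k + 1) f (∑ i ∈ Finset.range (k + 1), T i • y i) :=
    PSSpan.sum _ _ fun i hi => by
      have := Finset.mem_range.mp hi
      exact ((hy i this).mono (by omega)).smul _
  refine ⟨(PowerSeries.X ^ (M + 1) : PowerSeries ℂ) • f (k + 1)
    - ∑ i ∈ Finset.range (k + 1), T i • y i, T, r, by abel, ?_, ?_, h1, h2, ?_, ?_, ?_⟩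
  · rw [sub_eq_add_neg]
    exact ((PSSpan.self f (Nat.lt_succ_self (k + 1))).smul _).add (hsum.neg.mono (by omega))
  · refine hd.indep.update _ fun S hS => ?_
    have h6 : PSSpan (k + 1) f ((S * PowerSeries.X ^ (M + 1)) • f (k + 1)) := by
      obtain ⟨V, hV⟩ := hS
      rw [smul_sub, sub_eq_iff_eq_add, ← mul_smul] at hV
      rw [hV]
      refine PSSpan.add (PSSpan.sum _ _ fun i hi => ?_) (hsum.smul S)
      have := Finset.mem_range.mp hi
      exact ((hy i this).mono (by omega)).smul _
    exact (mul_eq_zero.mp (h.indep.eq_zero_of_smul h6)).resolve_right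
      (pow_ne_zero _ PowerSeries.X_ne_zero)
  · intro i
    rw [← hδ]; exact h3 i
  · intro i hi hne h0
    have h6 := h4 i (fun h7 => hne ?_)
    · rw [h0, mul_zero] at h6
      exact hW i hi h6.symm
    · rw [← sub_eq_zero, hδ] at h7
      have : l i + i - (l (k + 1) + (k + 1 : ℕ)) = 0 := by exact_mod_cast h7
      linarith
  · intro i hi heq h0
    have h6 := h5 i ?_
    · rw [h0, map_zero] at h6
      exact hW i hi h6.symm
    · rw [← sub_eq_zero, hδ, heq]
      simp

/-- At each extension the corrected vector z satisfies the Jordan block relation, so hypothesis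
`hss` makes it an eigenvector and all resonant terms vanish. The principal order then becomes
strict, which keeps every leading coefficient invertible. -/
theorem IsChain.exists_isDiagonalForm {k : ℕ} {l : ℕ → ℚ} {U : ℕ → PowerSeries ℂ} {f : ℕ → E}
    (h : IsChain (k + 1) l U f) (hl : ∀ i j, i ≤ j → j < k + 1 → l i + i ≤ l j + j)
    (hss : ∀ (μ : ℂ) (x : E), PSSpan (k + 1) f x → lin (μ + 1) • lin μ • x = 0 → lin μ • x = 0) :
    ∃ M y R, IsDiagonalForm (k + 1) (fun i => l i + i - k) M y R (f k) ∧
      (∀ i < k + 1, PSSpan (i + 1) f (y i)) ∧ ∀ i j, i < j → j < k + 1 → l i + i < l j + j := by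
  induction k with
  | zero =>
    refine ⟨0, f, fun _ => 1, ⟨h.indep, ?_, ?_, ?_⟩, ?_, ?_⟩
    · intro i hi
      obtain rfl : i = 0 := by omega
      simpa using h.zero (by omega)
    · simp
    · simp
    · intro i hi
      exact PSSpan.self f (Nat.lt_succ_self i)
    · intro i j hij hj
      omega
  | succ k ih =>
    obtain ⟨M, y, R, hd, hy, hlt⟩ := ih (h.prefix (by omega))
      (fun i j hij hj => hl i j hij (by omega)) (fun μ x hx => hss μ x (hx.mono (by omega)))
    obtain ⟨z, T, r, h1, h2, h3, h4, h5, h6, h7, h8⟩ := h.exists_extension hd hy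
    have h9 := hss _ z h2 h5
    rw [h4] at h9
    have hr : ∀ i < k + 1, r i = 0 := fun i hi =>
      (mul_eq_zero.mp (hd.indep _ h9 i hi)).resolve_left PowerSeries.X_ne_zero
    -- Equal values would put the resonance in degree 0, where the obstruction is the nonzero
    -- constant term of U_k R_i.
    have hne : ∀ i < k + 1, l i + i ≠ l (k + 1) + (k + 1 : ℕ) := fun i hi heq =>
      h8 i hi heq (hr i hi)
    refine ⟨M + 1, Function.update y (k + 1) z, Function.update T (k + 1) 1, ⟨h3, ?_, ?_, ?_⟩,
      ?_, ?_⟩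
    · intro i hi
      rcases Nat.lt_succ_iff_lt_or_eq.mp hi with h' | rfl
      · rw [Function.update_of_ne (by omega), ← hd.eigen i h']
        congr 3
        push_cast
        ring
      · rw [Function.update_self, ← h9, ← h4]
        congr 3
        push_cast
        ring
    · rw [sum_update, h1, one_smul]
    · intro i hi
      rcases Nat.lt_succ_iff_lt_or_eq.mp hi with h' | rfl
      · rw [Function.update_of_ne (by omega)]
        exact h7 i h' (hne i h')
      · simp
    · intro i hi
      rcases Nat.lt_succ_iff_lt_or_eq.mp hi with h' | rfl
      · rw [Function.update_of_ne (by omega)]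
        exact hy i h'
      · rw [Function.update_self]
        exact h2
    · intro i j hij hj
      rcases Nat.lt_succ_iff_lt_or_eq.mp hj with h' | rfl
      · exact hlt i j hij h'
      · exact lt_of_le_of_ne (hl i (k + 1) (by omega) (by omega)) (hne i hij)

/-- The form of a generator of a module that is semi-simple up to one Jordan block of size two:
`b^M g = ∑ R_i y_i` with `y_i` eigenvectors, except that the last one is mapped to a multiple of the
first one. -/
structure IsNormalForm (n : ℕ) (e : ℕ → ℚ) (p : ℕ) (c : ℂ) (M : ℕ) (y : ℕ → E)
    (R : ℕ → PowerSeries ℂ) (g : E) : Prop where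
  strict : ∀ i j, i < j → j < n + 2 → e i < e j
  exponent : (p : ℚ) = e (n + 1) - e 0
  indep : PSIndep (n + 2) y
  eigen : ∀ i < n + 1, lin ((e i + M : ℚ) : ℂ) • y i = 0
  log : lin ((e (n + 1) + M : ℚ) : ℂ) • y (n + 1)
    = (PowerSeries.C c * PowerSeries.X ^ (p + 1)) • y 0
  eq : (PowerSeries.X ^ M : PowerSeries ℂ) • g = ∑ i ∈ Finset.range (n + 2), R i • y i
  unit : ∀ i < n + 2, PowerSeries.constantCoeff (R i) ≠ 0

/-- The chain without its last vector is diagonalised, and the last extension may keep a resonant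
term along y_0 only; this is the Jordan block. For n = 0 nothing else forbids a resonance in degree
0, so `hl0` excludes it. The hypothesis `hint` makes p an integer even when c = 0. -/
theorem IsChain.exists_isNormalForm {n : ℕ} {l : ℕ → ℚ} {U : ℕ → PowerSeries ℂ} {f : ℕ → E}
    (h : IsChain (n + 2) l U f) (hl : ∀ i j, i ≤ j → j < n + 2 → l i + i ≤ l j + j)
    (hl0 : n = 0 → l 0 < l 1 + 1)
    (hss : ∀ (μ : ℂ) (x : E), PSSpan (n + 1) f x → lin (μ + 1) • lin μ • x = 0 → lin μ • x = 0)
    (hss' : ∀ (μ : ℂ) (x : E), lin (μ + 1) • lin μ • x = 0 → PSSpan 1 f (lin μ • x))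
    (l₀ : ℚ) (hint : ∀ (μ : ℚ) (x : E), x ≠ 0 → lin (μ : ℂ) • x = 0 → ∃ z : ℤ, μ = l₀ + z) :
    (∀ i < n + 2, ∃ z : ℤ, l i = l₀ + z) ∧
    ∃ p c M y R, IsNormalForm n (fun i => l i + i - (n + 1 : ℕ)) p c M y R (f (n + 1)) := by
  obtain ⟨M, y, R, hd, hy, hlt⟩ := (h.prefix (by omega)).exists_isDiagonalForm
    (fun i j hij hj => hl i j hij (by omega)) hss
  obtain ⟨z, T, r, h1, h2, h3, h4, h5, h6, h7, h8⟩ := h.exists_extension hd hy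
  -- The image of z lies on the line of f_0, of which y_0 is a nonzero multiple S_0 f_0.
  -- Multiplication by S_0 gives two expressions in the independent y_i, one of them involving y_0
  -- alone.
  have hr : ∀ i, 1 ≤ i → i < n + 1 → r i = 0 := by
    have h9 := hss' _ z h5
    rw [h4] at h9
    obtain ⟨V, hV⟩ := h9
    obtain ⟨S, hS⟩ := hy 0 (by omega)
    rw [Finset.sum_range_one] at hV hS
    have hS0 : S 0 ≠ 0 := by
      intro h0
      rw [h0, zero_smul] at hS
      exact hd.indep.ne_zero (Nat.succ_pos n) hS
    have h10 : ∑ i ∈ Finset.range (n + 1), (S 0 * (PowerSeries.X * r i)) • y i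
        = ∑ i ∈ Finset.range (n + 1), (if i = 0 then V 0 else 0) • y i := by
      have : ∑ i ∈ Finset.range (n + 1), (if i = 0 then V 0 else 0) • y i = V 0 • y 0 := by
        rw [Finset.sum_eq_single 0]
        · simp
        · intro i _ hi; simp [hi]
        · simp
      rw [this, hS, smul_comm (V 0), ← hV, Finset.smul_sum]
      exact Finset.sum_congr rfl fun i _ => mul_smul _ _ _
    intro i hi hin
    have h11 := hd.indep.ext h10 i hin
    rw [if_neg (by omega)] at h11
    exact (mul_eq_zero.mp ((mul_eq_zero.mp h11).resolve_left hS0)).resolve_left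
      PowerSeries.X_ne_zero
  have hlast : ∀ i < n + 1, l i + i < l (n + 1) + (n + 1 : ℕ) := by
    intro i hi
    rcases Nat.eq_zero_or_pos n with rfl | hn
    · obtain rfl : i = 0 := by omega
      simpa using hl0 rfl
    · have h9 : l n + n < l (n + 1) + (n + 1 : ℕ) :=
        lt_of_le_of_ne (hl n (n + 1) (by omega) (by omega))
          fun heq => h8 n (by omega) heq (hr n (by omega) (by omega))
      rcases Nat.lt_succ_iff_lt_or_eq.mp hi with h' | h'
      · exact (hlt i n h' (by omega)).trans h9
      · rw [h']; exact h9
  have h4' : lin ((l (n + 1) + (M + 1 : ℕ) : ℚ) : ℂ) • z = (PowerSeries.X * r 0) • y 0 := by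
    rw [h4, Finset.sum_eq_single 0]
    · intro i hi hi0
      rw [hr i (by omega) (Finset.mem_range.mp hi), mul_zero, zero_smul]
    · simp
  have hz : z ≠ 0 := by
    have := h3.ne_zero (Nat.lt_succ_self (n + 1))
    rwa [Function.update_self] at this
  have hint1 : ∀ i < n + 1, ∃ w : ℤ, l i = l₀ + w := by
    intro i hi
    obtain ⟨w, hw⟩ := hint _ _ (hd.indep.ne_zero hi) (hd.eigen i hi)
    refine ⟨w - M - i + n, ?_⟩
    push_cast
    linarith
  -- If r_0 ≠ 0 it is a monomial, and its degree is p. If r_0 = 0, then z is an eigenvector,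
  -- integrality comes from its weight, and c = 0.
  have hint2 : (∃ w : ℤ, l (n + 1) = l₀ + w) ∧ ∃ (p : ℕ) (c : ℂ),
      (p : ℚ) = l (n + 1) + (n + 1 : ℕ) - l 0 ∧ r 0 = PowerSeries.C c * PowerSeries.X ^ p := by
    obtain ⟨w0, hw0⟩ := hint1 0 (by omega)
    by_cases hr0 : r 0 = 0
    · rw [hr0, mul_zero, zero_smul] at h4'
      obtain ⟨w, hw⟩ := hint _ _ hz h4'
      have hw' : l (n + 1) = l₀ + (w - M - 1 : ℤ) := by
        push_cast at hw ⊢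
        linarith
      refine ⟨⟨_, hw'⟩, (w - M - 1 + n + 1 - w0).toNat, 0, ?_, by simp [hr0]⟩
      have hpos : (0 : ℤ) ≤ w - M - 1 + n + 1 - w0 := by
        have := hlast 0 (by omega)
        rw [hw', hw0] at this
        push_cast at this
        have h10 : ((w0 : ℤ) : ℚ) < ((w - M - 1 + n + 1 : ℤ) : ℚ) := by
          push_cast; linarith
        have := Int.cast_lt.mp h10
        omega
      have h10 : (((w - M - 1 + n + 1 - w0).toNat : ℤ) : ℚ) = ((w - M - 1 + n + 1 - w0 : ℤ) : ℚ) := by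
        rw [Int.toNat_of_nonneg hpos]
      rw [Int.cast_natCast] at h10
      rw [h10, hw', hw0]
      push_cast
      ring
    · obtain ⟨p, c, -, hp, hr0'⟩ := eq_monomial_of_euler_eq_zero (h6 0) hr0
      have hp' : l 0 + (0 : ℕ) - (l (n + 1) + (n + 1 : ℕ)) = -(p : ℚ) := by exact_mod_cast hp
      refine ⟨⟨w0 + p - (n + 1), ?_⟩, p, c, ?_, hr0'⟩
      · push_cast at hp' ⊢
        linarith
      · push_cast at hp' ⊢
        linarith
  obtain ⟨hint3, p, c, hp, hr0⟩ := hint2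
  refine ⟨?_, p, c, M + 1, Function.update y (n + 1) z, Function.update T (n + 1) 1,
    ⟨?_, ?_, h3, ?_, ?_, ?_, ?_⟩⟩
  · intro i hi
    rcases Nat.lt_succ_iff_lt_or_eq.mp hi with h' | rfl
    · exact hint1 i h'
    · exact hint3
  · intro i j hij hj
    have : l i + i < l j + j := by
      rcases Nat.lt_succ_iff_lt_or_eq.mp hj with h' | rfl
      · exact hlt i j hij h'
      · exact hlast i hij
    linarith
  · rw [hp]; push_cast; ring
  · intro i hi
    rw [Function.update_of_ne (by omega), ← hd.eigen i hi]
    congr 3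
    push_cast
    ring
  · rw [Function.update_self, Function.update_of_ne (by omega)]
    rw [show (PowerSeries.C c * PowerSeries.X ^ (p + 1) : PowerSeries ℂ) = PowerSeries.X * r 0 by
      rw [hr0]; ring, ← h4']
    congr 3
    push_cast
    ring
  · rw [sum_update, h1, one_smul]
  · intro i hi
    rcases Nat.lt_succ_iff_lt_or_eq.mp hi with h' | rfl
    · rw [Function.update_of_ne (by omega)]
      exact h7 i h' (hlast i h').ne
    · simp

end NormalForm

section Forms

variable {E : Type*} [AddCommGroup E] [Module ATilde E]

/-! ### Adapted bases from normal forms -/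

theorem IsChain.snoc {k : ℕ} {l : ℕ → ℚ} {U : ℕ → PowerSeries ℂ} {f : ℕ → E}
    (h : IsChain (k + 1) l U f) {z : E} {S : PowerSeries ℂ} (hS : PowerSeries.constantCoeff S ≠ 0)
    (hz : lin (l (k + 1)) • z = S • f k)
    (hi : ∀ T : PowerSeries ℂ, PSSpan (k + 1) f (T • z) → T = 0) :
    IsChain (k + 2) l (Function.update U k S) (Function.update f (k + 1) z) := by
  refine ⟨fun _ => ?_, fun i hi => ?_, fun i hi => ?_, h.indep.update z hi⟩
  · rw [Function.update_of_ne (by omega)]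
    exact h.zero (by omega)
  · rw [Function.update_of_ne (show i ≠ k + 1 by omega)]
    rcases Nat.lt_succ_iff_lt_or_eq.mp (show i < k + 1 by omega) with h' | rfl
    · rw [Function.update_of_ne (by omega), Function.update_of_ne (by omega)]
      exact h.succ i (by omega)
    · rw [Function.update_self, Function.update_self, hz]
  · rcases Nat.lt_succ_iff_lt_or_eq.mp (show i < k + 1 by omega) with h' | rfl
    · rw [Function.update_of_ne (by omega)]
      exact h.unit i (by omega)
    · rwa [Function.update_self]

/-- `g` generates a module with an adapted basis which is triangular with respect to `y`. -/
def HasTriangularChain (k : ℕ) (e : ℕ → ℚ) (M : ℕ) (y : ℕ → E) (g : E) : Prop :=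
  ∃ (U : ℕ → PowerSeries ℂ) (f : ℕ → E), IsChain (k + 1) (fun i => e i + k - i) U f ∧
    (∃ S : PowerSeries ℂ, PowerSeries.constantCoeff S ≠ 0 ∧ g = S • f k) ∧
    ∀ i < k + 1, PSSpan (i + 1) y ((PowerSeries.X ^ M : PowerSeries ℂ) • f i)

/-- A chain for (a - e_{k+1} b) z is completed by z, which is independent of it because y_{k+1}
occurs in b^M z with coefficient 1. The weights match: (e_i + 1) + k - i = e_i + (k + 1) - i. -/
theorem HasTriangularChain.snoc {k : ℕ} {e : ℕ → ℚ} {M : ℕ} {y : ℕ → E} {z g : E}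
    {S : PowerSeries ℂ} (hS : PowerSeries.constantCoeff S ≠ 0) (hg : g = S • z)
    (h : HasTriangularChain k (fun i => e i + 1) M (fun i => (PowerSeries.X : PowerSeries ℂ) • y i)
      (lin (e (k + 1)) • z))
    (hy : PSIndep (k + 2) y) {V : ℕ → PowerSeries ℂ}
    (hz : (PowerSeries.X ^ M : PowerSeries ℂ) • z
      = ∑ i ∈ Finset.range (k + 1), V i • y i + y (k + 1)) :
    HasTriangularChain (k + 1) e M y g := by
  obtain ⟨U, f, hch, ⟨T, hT, hgT⟩, htri⟩ := h
  have hl : (fun i => (fun i => e i + 1) i + (k : ℚ) - (i : ℚ))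
      = fun i : ℕ => e i + ((k + 1 : ℕ) : ℚ) - i := by
    funext i
    push_cast
    ring
  rw [hl] at hch
  have htri' : ∀ i < k + 1, PSSpan (i + 1) y ((PowerSeries.X ^ M : PowerSeries ℂ) • f i) := by
    intro i hi
    obtain ⟨W, hW⟩ := htri i hi
    exact ⟨fun j => W j * PowerSeries.X, by simp only [mul_smul]; exact hW⟩
  refine ⟨_, _, hch.snoc hT (by simpa using hgT) ?_, ⟨S, hS, ?_⟩, ?_⟩
  · intro W hW
    apply hy.eq_zero_of_smul
    have h1 : PSSpan (k + 1) y ((PowerSeries.X ^ M : PowerSeries ℂ) • W • z) := by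
      obtain ⟨Q, hQ⟩ := hW
      rw [hQ, Finset.smul_sum]
      refine PSSpan.sum _ _ fun i hi => ?_
      rw [smul_comm]
      have := Finset.mem_range.mp hi
      exact ((htri' i this).smul _).mono (by omega)
    rw [smul_comm, hz, smul_add] at h1
    have h2 := h1.add ((PSSpan.smul ⟨V, rfl⟩ W : PSSpan (k + 1) y _).neg)
    rwa [add_neg_cancel_comm] at h2
  · rw [Function.update_self, hg]
  · intro i hi
    rcases Nat.lt_succ_iff_lt_or_eq.mp hi with h' | rfl
    · rw [Function.update_of_ne (by omega)]
      exact htri' i h'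
    · rw [Function.update_self, hz]
      exact (PSSpan.mono ⟨V, rfl⟩ (Nat.le_succ _)).add (PSSpan.self y (Nat.lt_succ_self _))

theorem PSIndep.X_smul {k : ℕ} {y : ℕ → E} (h : PSIndep k y) :
    PSIndep k fun i => (PowerSeries.X : PowerSeries ℂ) • y i := by
  intro S hS i hi
  have := h (fun i => S i * PowerSeries.X) (by simpa only [mul_smul] using hS) i hi
  exact (mul_eq_zero.mp this).resolve_right PowerSeries.X_ne_zero

theorem lin_smul_X_smul_eigen {μ : ℂ} {y : E} (h : lin μ • y = 0) :
    lin (μ + 1) • (PowerSeries.X : PowerSeries ℂ) • y = 0 := by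
  have := lin_smul_X_pow_smul μ 1 y
  rwa [h, smul_zero, pow_one, Nat.cast_one] at this

/-- Once g is normalised to have coefficient 1 on y_{k+1}, the operator a - e_{k+1} b removes this
vector. It multiplies the other leading coefficients by e_i - e_{k+1} ≠ 0, leaving a diagonal form
on the b y_i with one vector fewer. -/
theorem IsDiagonalForm.hasTriangularChain {k : ℕ} {e : ℕ → ℚ} {M : ℕ} {y : ℕ → E}
    {R : ℕ → PowerSeries ℂ} {g : E} (htf : TorsionFree E) (h : IsDiagonalForm (k + 1) e M y R g)
    (he : ∀ i j, i < j → j < k + 1 → e i < e j) : HasTriangularChain k e M y g := by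
  induction k generalizing e y R g with
  | zero =>
    have hu := h.unit 0 (by omega)
    have hz : (PowerSeries.X ^ M : PowerSeries ℂ) • (R 0)⁻¹ • g = y 0 := by
      rw [smul_comm, h.eq, Finset.sum_range_one, unit_inv_smul_smul hu]
    refine ⟨fun _ => 1, fun _ => (R 0)⁻¹ • g, ⟨fun _ => ?_, fun i hi => by omega,
      fun i hi => by omega, ?_⟩, ⟨R 0, hu, (unit_smul_smul hu g).symm⟩, ?_⟩
    · apply htf.pow M
      rw [← lin_smul_X_pow_smul, hz, ← h.eigen 0 (by omega)]
      push_cast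
      congr 2
      simp
    · intro S hS i hi
      obtain rfl : i = 0 := by omega
      refine h.indep S ?_ 0 hi
      rw [Finset.sum_range_one] at hS ⊢
      rw [← hz, smul_comm, hS, smul_zero]
    · intro i hi
      obtain rfl : i = 0 := by omega
      rw [hz]
      exact PSSpan.self y (by omega)
  | succ k ih =>
    have hu := h.unit (k + 1) (by omega)
    set z := (R (k + 1))⁻¹ • g with hz
    have hV : (PowerSeries.X ^ M : PowerSeries ℂ) • z
        = ∑ i ∈ Finset.range (k + 1), ((R (k + 1))⁻¹ * R i) • y i + y (k + 1) := by
      rw [hz, smul_comm, h.eq, Finset.sum_range_succ, smul_add, unit_inv_smul_smul hu,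
        Finset.smul_sum]
      simp only [mul_smul]
    refine HasTriangularChain.snoc hu (unit_smul_smul hu g).symm ?_ h.indep hV
    refine ih (R := fun i => euler ((e i : ℂ) - e (k + 1)) ((R (k + 1))⁻¹ * R i))
      ⟨(h.indep.mono (by omega)).X_smul, ?_, ?_, ?_⟩ ?_
    · intro i hi
      have := lin_smul_X_smul_eigen (h.eigen i (by omega))
      rw [← this]
      congr 3
      push_cast
      ring
    · rw [← lin_smul_X_pow_smul, hV, smul_add, Finset.smul_sum]
      have h1 := h.eigen (k + 1) (by omega)
      push_cast at h1
      rw [h1, add_zero]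
      refine Finset.sum_congr rfl fun i hi => ?_
      have := Finset.mem_range.mp hi
      rw [lin_smul_smul_eigen (h.eigen i (by omega)), mul_comm PowerSeries.X, mul_smul]
      congr 2
      push_cast
      ring
    · intro i hi
      rw [constantCoeff_euler, map_mul, PowerSeries.constantCoeff_inv]
      refine mul_ne_zero (sub_ne_zero.mpr ?_) (mul_ne_zero (inv_ne_zero hu) (h.unit i (by omega)))
      exact_mod_cast (he i (k + 1) (by omega) (by omega)).ne
    · intro i j hij hj
      have := he i j hij (by omega)
      simpa using this

/-! ### The action of Ã on a generator in normal form -/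

namespace IsNormalForm

variable {n : ℕ} {e : ℕ → ℚ} {p : ℕ} {c : ℂ} {M : ℕ} {y : ℕ → E} {R : ℕ → PowerSeries ℂ} {g : E}

theorem exponent_pos (h : IsNormalForm n e p c M y R g) : 0 < p := by
  have h1 := h.exponent
  have h2 := h.strict 0 (n + 1) (by omega) (by omega)
  have : (0 : ℚ) < p := by linarith
  exact_mod_cast this

theorem lin_smul_sum (h : IsNormalForm n e p c M y R g) (μ : ℂ) (S : ℕ → PowerSeries ℂ) :
    lin (μ + M) • ∑ i ∈ Finset.range (n + 2), S i • y i
      = ∑ i ∈ Finset.range (n + 2), (PowerSeries.X * (euler (e i - μ) (S i)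
        + if i = 0 then S (n + 1) * (PowerSeries.C c * PowerSeries.X ^ p) else 0)) • y i := by
  have h1 : ∀ i < n + 1, lin (μ + M) • S i • y i
      = (PowerSeries.X * euler (e i - μ) (S i)) • y i := by
    intro i hi
    rw [lin_smul_smul_eigen (h.eigen i hi)]
    congr 3
    push_cast
    ring
  have h2 : lin (μ + M) • S (n + 1) • y (n + 1)
      = (PowerSeries.X * euler (e (n + 1) - μ) (S (n + 1))) • y (n + 1)
        + (PowerSeries.X * (S (n + 1) * (PowerSeries.C c * PowerSeries.X ^ p))) • y 0 := by
    rw [lin_smul_smul h.log, ← mul_smul]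
    congr 2
    · congr 2
      push_cast
      ring
    · ring
  have h3 : ∑ i ∈ Finset.range (n + 2), (PowerSeries.X * (if i = 0 then
      S (n + 1) * (PowerSeries.C c * PowerSeries.X ^ p) else 0)) • y i
      = (PowerSeries.X * (S (n + 1) * (PowerSeries.C c * PowerSeries.X ^ p))) • y 0 := by
    rw [Finset.sum_eq_single 0]
    · simp
    · intro i _ hi; simp [hi]
    · simp
  simp only [mul_add, add_smul, Finset.sum_add_distrib]
  rw [h3, Finset.smul_sum, Finset.sum_range_succ, h2,
    Finset.sum_congr rfl fun i hi => h1 i (Finset.mem_range.mp hi),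
    Finset.sum_range_succ _ (n + 1)]
  abel

theorem X_pow_smul_lin (h : IsNormalForm n e p c M y R g) (μ : ℂ) :
    (PowerSeries.X ^ M : PowerSeries ℂ) • lin μ • g
      = ∑ i ∈ Finset.range (n + 2), (PowerSeries.X * (euler (e i - μ) (R i)
        + if i = 0 then R (n + 1) * (PowerSeries.C c * PowerSeries.X ^ p) else 0)) • y i := by
  rw [← lin_smul_X_pow_smul, h.eq, h.lin_smul_sum]

theorem smul_unit (h : IsNormalForm n e p c M y R g) {S : PowerSeries ℂ}
    (hS : PowerSeries.constantCoeff S ≠ 0) :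
    IsNormalForm n e p c M y (fun i => S * R i) (S • g) := by
  refine ⟨h.strict, h.exponent, h.indep, h.eigen, h.log, ?_, ?_⟩
  · rw [smul_comm, h.eq, Finset.smul_sum]
    simp only [mul_smul]
  · intro i hi
    rw [map_mul]
    exact mul_ne_zero hS (h.unit i hi)

/-- The same first step as in the diagonal case. The Jordan block contributes only c b^(p+1) y_0
with p > 0, which leaves the leading coefficients alone; what remains is diagonal. -/
theorem hasTriangularChain (htf : TorsionFree E) (h : IsNormalForm n e p c M y R g) :
    HasTriangularChain (n + 1) e M y g := by
  have hu := h.unit (n + 1) (by omega)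
  have hu' : PowerSeries.constantCoeff (R (n + 1))⁻¹ ≠ 0 := by
    rw [PowerSeries.constantCoeff_inv]; exact inv_ne_zero hu
  have h' := h.smul_unit hu'
  have e1 : (R (n + 1))⁻¹ * R (n + 1) = 1 := PowerSeries.inv_mul_cancel _ hu
  have hV := h'.eq
  rw [Finset.sum_range_succ, e1, one_smul] at hV
  refine HasTriangularChain.snoc hu (unit_smul_smul hu g).symm ?_ h.indep hV
  refine IsDiagonalForm.hasTriangularChain (R := fun i => euler ((e i : ℂ) - e (n + 1))
    ((R (n + 1))⁻¹ * R i) + if i = 0 then PowerSeries.C c * PowerSeries.X ^ p else 0) htf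
      ⟨(h.indep.mono (by omega)).X_smul, ?_, ?_, ?_⟩ ?_
  · intro i hi
    have := lin_smul_X_smul_eigen (h.eigen i (by omega))
    rw [← this]
    congr 3
    push_cast
    ring
  · rw [h'.X_pow_smul_lin, Finset.sum_range_succ, if_neg (by omega), e1, sub_self]
    have e2 : euler 0 1 = 0 := by simp [euler]
    rw [e2, add_zero, mul_zero, zero_smul, add_zero]
    refine Finset.sum_congr rfl fun i _ => ?_
    rw [one_mul, mul_comm PowerSeries.X, mul_smul]
  · intro i hi
    have hp := h.exponent_pos
    have e2 : PowerSeries.constantCoeff (if i = 0 then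
        (PowerSeries.C c * PowerSeries.X ^ p : PowerSeries ℂ) else 0) = 0 := by
      split_ifs <;> simp [hp.ne']
    rw [map_add, e2, add_zero, constantCoeff_euler]
    refine mul_ne_zero (sub_ne_zero.mpr ?_) (h'.unit i (by omega))
    exact_mod_cast (h.strict i (n + 1) (by omega) (by omega)).ne
  · intro i j hij hj
    have := h.strict i j hij (by omega)
    simpa using this

/-- The action of `Ã` on a generator in normal form. -/
theorem exists_smul_eq (h : IsNormalForm n e p c M y R g) (u : ATilde) :
    ∃ T : ℕ → PowerSeries ℂ,
      (PowerSeries.X ^ M : PowerSeries ℂ) • u • g = ∑ i ∈ Finset.range (n + 2), T i • y i ∧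
      ∀ i, PowerSeries.constantCoeff (T i) = aug u * PowerSeries.constantCoeff (R i) := by
  obtain ⟨v, hv, hv'⟩ := smul_comm_X_pow (E := E) M u
  choose T hT q hq using fun i => exists_smul_smul_eigen ((e i + M : ℚ) : ℂ) v (R i)
  obtain ⟨W, hW, w, hw⟩ := exists_smul_smul_eigen ((e 0 + M : ℚ) : ℂ) (q (n + 1))
    (PowerSeries.C c * PowerSeries.X ^ (p + 1))
  have h1 : ∀ i < n + 1, v • R i • y i = T i • y i := by
    intro i hi
    rw [← mul_ofPS_smul, hq, add_smul, mul_smul, h.eigen i hi, smul_zero, zero_add]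
    rfl
  have h2 : v • R (n + 1) • y (n + 1) = T (n + 1) • y (n + 1) + W • y 0 := by
    rw [← mul_ofPS_smul, hq, add_smul, mul_smul, h.log, ← mul_ofPS_smul, hw, add_smul, mul_smul,
      h.eigen 0 (by omega), smul_zero, zero_add, add_comm]
    rfl
  refine ⟨fun i => T i + if i = 0 then W else 0, ?_, ?_⟩
  · have h3 : ∑ i ∈ Finset.range (n + 2), (if i = 0 then W else 0) • y i = W • y 0 := by
      rw [Finset.sum_eq_single 0]
      · simp
      · intro i _ hi; simp [hi]
      · simp
    rw [hv', h.eq]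
    simp only [add_smul, Finset.sum_add_distrib]
    rw [h3, Finset.smul_sum, Finset.sum_range_succ, h2,
      Finset.sum_congr rfl fun i hi => h1 i (Finset.mem_range.mp hi),
      Finset.sum_range_succ _ (n + 1), add_assoc]
  · intro i
    have hW0 : PowerSeries.constantCoeff W = 0 := by rw [hW]; simp
    rw [map_add, hT, hv]
    split_ifs <;> simp [hW0]

/-- A change of generator keeps the vectors y_i and multiplies all leading coefficients by aug u,
which is nonzero because some v u fixes g. Ratios of leading coefficients are thus invariants of the
module. -/
theorem of_span_eq (h : IsNormalForm n e p c M y R g) {u : ATilde}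
    (hu : g ∈ Submodule.span ATilde {u • g}) :
    ∃ T : ℕ → PowerSeries ℂ, IsNormalForm n e p c M y T (u • g) ∧ ∃ s : ℂ, s ≠ 0 ∧
      ∀ i, PowerSeries.constantCoeff (T i) = s * PowerSeries.constantCoeff (R i) := by
  obtain ⟨v, hv⟩ := Submodule.mem_span_singleton.mp hu
  obtain ⟨T, hT, hT'⟩ := h.exists_smul_eq u
  obtain ⟨W, hW, hW'⟩ := h.exists_smul_eq (v * u)
  have hs : aug u ≠ 0 := by
    intro h0
    rw [mul_smul, hv, h.eq] at hW
    have h1 := h.indep.ext hW 0 (by omega)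
    have h2 := hW' 0
    rw [map_mul, h0, mul_zero, zero_mul, ← h1] at h2
    exact h.unit 0 (by omega) h2
  refine ⟨T, ⟨h.strict, h.exponent, h.indep, h.eigen, h.log, hT, fun i hi => ?_⟩, aug u, hs, hT'⟩
  rw [hT']
  exact mul_ne_zero hs (h.unit i hi)

end IsNormalForm

/-! ### Removing an eigenvector from a normal form -/

theorem euler_injective_of_pos {δ : ℚ} (hδ : 0 < δ) {S : PowerSeries ℂ}
    (h : euler (δ : ℂ) S = 0) : S = 0 := by
  by_contra hS
  obtain ⟨n, c, -, hn, -⟩ := eq_monomial_of_euler_eq_zero h hS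
  have : δ = -(n : ℚ) := by exact_mod_cast hn
  have h1 : (0 : ℚ) ≤ n := by positivity
  linarith

theorem eq_C_of_euler_zero {S : PowerSeries ℂ} (h : euler 0 S = 0) :
    S = PowerSeries.C (PowerSeries.constantCoeff S) := by
  by_cases hS : S = 0
  · rw [hS]; simp
  obtain ⟨n, c, -, hn, hSn⟩ := eq_monomial_of_euler_eq_zero h hS
  have : n = 0 := by
    have : (n : ℂ) = 0 := by linear_combination hn
    exact_mod_cast this
  subst this
  rw [hSn]
  simp

/-- Removing the last but one eigenvector. -/
theorem IsNormalForm.reduce {n : ℕ} {e : ℕ → ℚ} {p : ℕ} {c : ℂ} {M : ℕ} {y : ℕ → E}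
    {R : ℕ → PowerSeries ℂ} {g : E} (h : IsNormalForm (n + 1) e p c M y R g)
    (hs : PSSpan (n + 1) y ((PowerSeries.X ^ M : PowerSeries ℂ) •
      lin (e (n + 1) + 1) • lin (e (n + 2)) • g)) :
    ∃ c' y' R', IsNormalForm n (fun i => if i < n + 1 then e i + 1 else e (n + 2) + 1) p c' M y' R'
        (lin (e (n + 1)) • g) ∧
      ∀ γ : ℂ, c * PowerSeries.constantCoeff (R (n + 2)) = γ * PowerSeries.constantCoeff (R 0) →
        c' * PowerSeries.constantCoeff (R' (n + 1))
          = γ * (((e (n + 2) - e (n + 1)) / (e 0 - e (n + 1)) : ℚ) : ℂ)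
            * PowerSeries.constantCoeff (R' 0) := by
  set δ : ℚ := e (n + 2) - e (n + 1) with hδ
  have hδ0 : 0 < δ := sub_pos.mpr (h.strict (n + 1) (n + 2) (by omega) (by omega))
  have hp := h.exponent_pos
  -- the two top coefficients
  have htop : ∀ i, n + 1 ≤ i → i < n + 3 →
      euler (e i - e (n + 1)) (euler (e i - e (n + 2)) (R i)) = 0 := by
    obtain ⟨V, hV⟩ := hs
    rw [← lin_smul_X_pow_smul, h.X_pow_smul_lin, h.lin_smul_sum] at hV
    have hV' : ∑ i ∈ Finset.range (n + 1), V i • y i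
        = ∑ i ∈ Finset.range (n + 1 + 2), (if i < n + 1 then V i else 0) • y i := by
      refine (Finset.sum_congr rfl fun j hj => ?_).trans
        (Finset.sum_subset (Finset.range_subset_range.mpr (by omega)) fun j _ hj => ?_)
      · simp at hj; simp [hj]
      · simp at hj; simp [Nat.not_lt.mpr hj]
    rw [hV'] at hV
    intro i hi hi'
    have h1 := h.indep.ext hV i hi'
    rw [if_neg (by omega), if_neg (by omega), if_neg (by omega), add_zero, add_zero,
      euler_X_mul, show (e i : ℂ) - (e (n + 1) + 1) + 1 = e i - e (n + 1) by ring] at h1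
    exact (mul_eq_zero.mp ((mul_eq_zero.mp h1).resolve_left PowerSeries.X_ne_zero)).resolve_left
      PowerSeries.X_ne_zero
  have hR2 : R (n + 2) = PowerSeries.C (PowerSeries.constantCoeff (R (n + 2))) := by
    have h1 := htop (n + 2) (by omega) (by omega)
    rw [sub_self] at h1
    apply eq_C_of_euler_zero
    apply euler_injective_of_pos hδ0
    rw [hδ]
    push_cast
    exact h1
  have hR1 : euler ((e (n + 1) : ℂ) - e (n + 2)) (euler 0 (R (n + 1))) = 0 := by
    have h1 := htop (n + 1) (by omega) (by omega)
    rwa [sub_self, euler_comm] at h1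
  set r := PowerSeries.constantCoeff (R (n + 2)) with hr
  have hr0 : r ≠ 0 := h.unit (n + 2) (by omega)
  -- These are the top two terms of b^M (a - e_{n+1} b) g. The one along y_{n+1} is either 0 or
  -- resonant for the weight of y_{n+2}, so that z as a whole is again a vector with a Jordan block
  -- over y_0. This absorbs y_{n+1}.
  set z : E := (PowerSeries.X * PowerSeries.C ((δ : ℂ) * r)) • y (n + 2)
    + (PowerSeries.X * euler 0 (R (n + 1))) • y (n + 1) with hz
  have hzlog : lin ((e (n + 2) + 1 + M : ℚ) : ℂ) • z
      = (PowerSeries.C ((δ : ℂ) * r * c) * PowerSeries.X ^ (p + 1)) •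
        (PowerSeries.X : PowerSeries ℂ) • y 0 := by
    rw [hz, smul_add, lin_smul_smul h.log, lin_smul_smul_eigen (h.eigen (n + 1) (by omega)),
      euler_X_mul, euler_X_mul]
    have e1 : ((e (n + 1 + 1) + M : ℚ) : ℂ) - ((e (n + 2) + 1 + M : ℚ) : ℂ) + 1 = 0 := by
      push_cast; ring
    have e2 : ((e (n + 1) + M : ℚ) : ℂ) - ((e (n + 2) + 1 + M : ℚ) : ℂ) + 1
        = (e (n + 1) : ℂ) - e (n + 2) := by
      push_cast; ring
    have e3 : euler 0 (PowerSeries.C ((δ : ℂ) * r)) = 0 := by simp [euler]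
    rw [e1, e2, e3, hR1, mul_zero, mul_zero, zero_smul, zero_smul, zero_add, add_zero, ← mul_smul,
      ← mul_smul, map_mul (PowerSeries.C) ((δ : ℂ) * r) c]
    congr 1
    ring
  have hδr : (δ : ℂ) * r ≠ 0 := mul_ne_zero (by exact_mod_cast hδ0.ne') hr0
  have hC : (PowerSeries.C ((δ : ℂ) * r) : PowerSeries ℂ) ≠ 0 := by
    intro h0
    have := congrArg PowerSeries.constantCoeff h0
    simp only [PowerSeries.constantCoeff_C, map_zero] at this
    exact hδr this
  set V : ℕ → PowerSeries ℂ := fun i => euler (e i - e (n + 1)) (R i)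
    + if i = 0 then R (n + 2) * (PowerSeries.C c * PowerSeries.X ^ p) else 0 with hVdef
  refine ⟨(δ : ℂ) * r * c, Function.update (fun i => (PowerSeries.X : PowerSeries ℂ) • y i) (n + 1) z,
    Function.update V (n + 1) 1, ⟨?_, ?_, ?_, ?_, ?_, ?_, ?_⟩, ?_⟩
  · intro i j hij hj
    rw [if_pos (show i < n + 1 by omega)]
    split_ifs with h1
    · have := h.strict i j hij (by omega)
      linarith
    · have := h.strict i (n + 2) (by omega) (by omega)
      linarith
  · rw [if_neg (lt_irrefl _), if_pos (Nat.succ_pos n), h.exponent]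
    ring
  · refine (h.indep.mono (show n + 1 ≤ n + 3 by omega)).X_smul.update z fun S hS => ?_
    obtain ⟨W, hW⟩ := hS
    have h1 := h.indep (fun i => if i < n + 1 then W i * PowerSeries.X else if i = n + 1 then
      -(S * (PowerSeries.X * euler 0 (R (n + 1)))) else
        -(S * (PowerSeries.X * PowerSeries.C ((δ : ℂ) * r)))) ?_ (n + 2) (by omega)
    · simp only [show ¬ (n + 2 < n + 1) by omega, if_false, show ¬ (n + 2 = n + 1) by omega,
        neg_eq_zero] at h1
      exact (mul_eq_zero.mp h1).resolve_right (mul_ne_zero PowerSeries.X_ne_zero hC)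
    · rw [Finset.sum_range_succ, Finset.sum_range_succ]
      have h2 : ∑ i ∈ Finset.range (n + 1), (if i < n + 1 then W i * PowerSeries.X else
          if i = n + 1 then -(S * (PowerSeries.X * euler 0 (R (n + 1)))) else
          -(S * (PowerSeries.X * PowerSeries.C ((δ : ℂ) * r)))) • y i
          = ∑ i ∈ Finset.range (n + 1), W i • (PowerSeries.X : PowerSeries ℂ) • y i :=
        Finset.sum_congr rfl fun i hi => by rw [if_pos (Finset.mem_range.mp hi), mul_smul]
      rw [h2, ← hW, hz, smul_add, ← mul_smul, ← mul_smul]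
      simp only [lt_irrefl, if_false, if_true, show ¬ (n + 1 + 1 < n + 1) by omega,
        show ¬ (n + 1 + 1 = n + 1) by omega, neg_smul]
      abel
  · intro i hi
    rw [Function.update_of_ne (by omega), if_pos hi]
    have := lin_smul_X_smul_eigen (h.eigen i (by omega))
    rw [← this]
    congr 3
    push_cast
    ring
  · rw [Function.update_self, Function.update_of_ne (by omega), if_neg (by omega), hzlog]
  · rw [sum_update, h.X_pow_smul_lin, Finset.sum_range_succ, Finset.sum_range_succ, one_smul, hz,
      if_neg (by omega), if_neg (by omega), sub_self, add_zero, add_zero, hR2]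
    have e1 : euler ((e (n + 1 + 1) : ℂ) - e (n + 1)) (PowerSeries.C r)
        = PowerSeries.C ((δ : ℂ) * r) := by
      rw [hδ]; simp [euler]
    rw [e1, add_assoc, add_comm ((PowerSeries.X * euler 0 (R (n + 1))) • y (n + 1))]
    congr 1
    refine Finset.sum_congr rfl fun i _ => ?_
    rw [← mul_smul, mul_comm PowerSeries.X, hVdef]
    simp only [hR2]
  · intro i hi
    rcases Nat.lt_succ_iff_lt_or_eq.mp hi with h' | rfl
    · rw [Function.update_of_ne (by omega), hVdef]
      have e2 : PowerSeries.constantCoeff (if i = 0 then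
          R (n + 2) * (PowerSeries.C c * PowerSeries.X ^ p) else 0) = 0 := by
        split_ifs <;> simp [hp.ne']
      simp only
      rw [map_add, e2, add_zero, constantCoeff_euler]
      refine mul_ne_zero (sub_ne_zero.mpr ?_) (h.unit i (by omega))
      exact_mod_cast (h.strict i (n + 1) (by omega) (by omega)).ne
    · simp
  -- Here c' = δ r c, the new top coefficient is 1, and the new R_0(0) is (e_0 - e_{n+1}) R_0(0);
  -- the quotient gives the factor.
  · intro γ hγ
    have hne : (e 0 : ℂ) - e (n + 1) ≠ 0 := by
      rw [sub_ne_zero]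
      exact_mod_cast (h.strict 0 (n + 1) (by omega) (by omega)).ne
    rw [Function.update_self, Function.update_of_ne (by omega), hVdef]
    simp only [if_true, map_add, map_mul, map_pow, PowerSeries.constantCoeff_X, map_one]
    rw [constantCoeff_euler, zero_pow hp.ne', mul_zero, mul_zero, add_zero]
    push_cast
    field_simp
    linear_combination hγ

end Forms

/-! ### The invariant `α` in terms of a normal form -/

theorem coeff_add_mul_monomial (V : PowerSeries ℂ) (ξ : ℂ) (m q : ℕ) :
    PowerSeries.coeff (q + m) (V * (PowerSeries.C ξ * PowerSeries.X ^ m))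
      = ξ * PowerSeries.coeff q V := by
  rw [← mul_assoc, PowerSeries.coeff_mul_X_pow, mul_comm V, PowerSeries.coeff_C_mul]

/-- S and Z are the coefficients of a generator on the logarithmic vector and on the eigenvector.
The series x₁ and x₀ are, up to a factor b, those of (1 + α b^q)⁻¹ (a - ν' b) applied to it, on
which the last factor acts by zero. Comparison in degrees 0 and p determines α. -/
theorem rank_two_coefficients {S Z x₁ x₀ : PowerSeries ℂ} {ν ν' ε α c : ℂ} {p q : ℕ}
    (h1 : euler (ν - ν') S = (1 + PowerSeries.C α * PowerSeries.X ^ q) * x₁)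
    (h2 : euler (ε - ν') Z + S * (PowerSeries.C c * PowerSeries.X ^ p)
      = (1 + PowerSeries.C α * PowerSeries.X ^ q) * x₀)
    (h3 : euler (ν - ν' + q) x₁ = 0)
    (h4 : euler (ε - ν' + q) x₀ + x₁ * (PowerSeries.C c * PowerSeries.X ^ p) = 0)
    (hα : α ≠ 0) (hq : q = 0 → α = 1) (hp : 0 < p) (hν : ν = ε + p)
    (hS : PowerSeries.constantCoeff S ≠ 0) (hZ : PowerSeries.constantCoeff Z ≠ 0) :
    ν' = ν ∧ q = p ∧
      c * PowerSeries.constantCoeff S = -(α * p) * PowerSeries.constantCoeff Z := by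
  -- A nonzero x₁ would be a monomial ξ b^m with q + m + ν - ν' = 0. In degree q + m the left side
  -- of `h1` then vanishes, while the right side is ξ times the coefficient of b^q in 1 + α b^q:
  -- this is α for q ≥ 1, and 2 for q = 0.
  have hx₁ : x₁ = 0 := by
    by_contra hx
    obtain ⟨m, ξ, hξ, hm, rfl⟩ := eq_monomial_of_euler_eq_zero h3 hx
    have h5 := congrArg (PowerSeries.coeff (q + m)) h1
    rw [coeff_euler, coeff_add_mul_monomial] at h5
    have h6 : ((q + m : ℕ) : ℂ) + (ν - ν') = 0 := by push_cast; linear_combination hm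
    rw [h6, zero_mul] at h5
    have h7 : PowerSeries.coeff q (1 + PowerSeries.C α * PowerSeries.X ^ q : PowerSeries ℂ) ≠ 0 := by
      rcases Nat.eq_zero_or_pos q with h0 | h0
      · subst h0
        rw [hq rfl]
        simp
      · rw [map_add, PowerSeries.coeff_one, if_neg h0.ne', PowerSeries.coeff_C_mul,
          PowerSeries.coeff_X_pow, if_pos rfl]
        simpa using hα
    exact mul_ne_zero hξ h7 h5.symm
  subst hx₁
  rw [mul_zero] at h1
  rw [zero_mul, add_zero] at h4
  have hS0 : S ≠ 0 := by
    rintro rfl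
    simp at hS
  obtain ⟨m, s, -, hm, rfl⟩ := eq_monomial_of_euler_eq_zero h1 hS0
  have hm0 : m = 0 := by
    by_contra hne
    apply hS
    simp [hne]
  subst hm0
  have hν' : ν' = ν := by
    rw [Nat.cast_zero, neg_zero] at hm
    linear_combination -hm
  have hεν : ε - ν' = -p := by rw [hν', hν]; ring
  have hp0 : (p : ℂ) ≠ 0 := by exact_mod_cast hp.ne'
  have h5 := congrArg PowerSeries.constantCoeff h2
  rw [map_add, constantCoeff_euler, hεν] at h5
  simp only [map_mul, map_pow, PowerSeries.constantCoeff_X, zero_pow hp.ne', mul_zero, add_zero,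
    map_add, map_one, PowerSeries.constantCoeff_C] at h5
  have hx₀0 : PowerSeries.constantCoeff x₀ ≠ 0 := by
    intro h0
    rw [h0, mul_zero] at h5
    exact mul_ne_zero (neg_ne_zero.mpr hp0) hZ h5
  have hx₀ : x₀ ≠ 0 := by
    rintro rfl
    simp at hx₀0
  obtain ⟨m, ξ, -, hm', rfl⟩ := eq_monomial_of_euler_eq_zero h4 hx₀
  have hm0 : m = 0 := by
    by_contra hne
    apply hx₀0
    simp [hne]
  subst hm0
  have hqp : q = p := by
    rw [hεν, Nat.cast_zero, neg_zero] at hm'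
    have : (q : ℂ) = p := by linear_combination hm'
    exact_mod_cast this
  subst hqp
  refine ⟨hν', rfl, ?_⟩
  have h6 := congrArg (PowerSeries.coeff (q + 0)) h2
  rw [coeff_add_mul_monomial, map_add, coeff_euler, hεν, map_add, PowerSeries.coeff_one,
    if_neg hp.ne', PowerSeries.coeff_C_mul, PowerSeries.coeff_X_pow, if_pos rfl, pow_zero, mul_one,
    ← mul_assoc, ← map_mul, add_zero, PowerSeries.coeff_C_mul, PowerSeries.coeff_X_pow,
    if_pos rfl] at h6
  simp only [zero_pow hp.ne', pow_zero, mul_zero, add_zero, one_mul, mul_one,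
    PowerSeries.constantCoeff_C] at h5 ⊢
  linear_combination h6 - α * h5

/-- For q = 0 and α = 1 the series is the constant 2. So the convention α = 1 when λ_2 = λ_1 - 1
fits the general shape, and both cases can be treated together. -/
theorem rankTwoElt_one (μ ν : ℂ) :
    rankTwoElt μ (1 + PowerSeries.C 1 * PowerSeries.X ^ 0) ν = (2 : ℂ)⁻¹ • (lin μ * lin ν) := by
  have e : (1 + PowerSeries.C 1 * PowerSeries.X ^ 0 : PowerSeries ℂ)⁻¹ = PowerSeries.C (2 : ℂ)⁻¹ := by
    rw [PowerSeries.inv_eq_iff_mul_eq_one (by simp), map_one, pow_zero, mul_one, mul_add,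
      mul_one, ← map_add]
    norm_num
  rw [rankTwoElt, e, mul_assoc, ← smul_eq, mul_smul_comm]

theorem exists_generator_of_isAlphaInvariant_two {E : Type*} [AddCommGroup E] [Module ATilde E]
    {α : ℂ} (h : IsAlphaInvariant 2 E α) : ∃ (l₁ : ℚ) (q : ℕ) (x : E), (q = 0 → α = 1) ∧
      Submodule.span ATilde {x} = ⊤ ∧
      rankTwoElt l₁ (1 + PowerSeries.C α * PowerSeries.X ^ q) (l₁ + q - 1) • x = 0 := by
  have key : ∀ P : ATilde, Nonempty (E ≃ₗ[ATilde] Cyc P) →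
      ∃ x : E, Submodule.span ATilde {x} = ⊤ ∧ P • x = 0 := by
    rintro P ⟨ψ⟩
    refine ⟨ψ.symm (Submodule.Quotient.mk 1), ?_, ?_⟩
    · rw [eq_top_iff]
      intro z _
      obtain ⟨u, hu⟩ := Submodule.Quotient.mk_surjective _ (ψ z)
      rw [Submodule.mem_span_singleton]
      refine ⟨u, ?_⟩
      rw [← map_smul, ← Submodule.Quotient.mk_smul, smul_eq_mul, mul_one, hu, ψ.symm_apply_apply]
    · rw [← map_smul, ← Submodule.Quotient.mk_smul, smul_eq_mul, mul_one,
        (Submodule.Quotient.mk_eq_zero _).mpr (Submodule.mem_span_singleton_self P), map_zero]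
  obtain ⟨l₁, ⟨q, hq, hψ⟩ | ⟨hψ, rfl⟩⟩ := h
  · obtain ⟨x, hx, hx'⟩ := key _ hψ
    exact ⟨l₁, q, x, fun h0 => by omega, hx, hx'⟩
  · obtain ⟨x, hx, hx'⟩ := key _ hψ
    refine ⟨l₁, 0, x, fun _ => rfl, hx, ?_⟩
    rw [rankTwoElt_one, smul_eq, mul_smul, Nat.cast_zero, add_zero, hx', smul_zero]

section Alpha

variable {A : Type*} [AddCommGroup A] [Module ATilde A]

theorem IsNormalForm.alpha_two {e : ℕ → ℚ} {p : ℕ} {c : ℂ} {M : ℕ} {y : ℕ → A}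
    {R : ℕ → PowerSeries ℂ} {x : A} (h : IsNormalForm 0 e p c M y R x) {l₁ : ℚ} {q : ℕ} {α : ℂ}
    (hα : α ≠ 0) (hq : q = 0 → α = 1)
    (hx : rankTwoElt l₁ (1 + PowerSeries.C α * PowerSeries.X ^ q) (l₁ + q - 1) • x = 0) :
    l₁ + q - 1 = e 1 ∧ q = p ∧ c * PowerSeries.constantCoeff (R 1)
      = -(α * p) * PowerSeries.constantCoeff (R 0) := by
  set V : PowerSeries ℂ := 1 + PowerSeries.C α * PowerSeries.X ^ q with hV
  have hV0 : PowerSeries.constantCoeff V ≠ 0 := by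
    rcases Nat.eq_zero_or_pos q with h0 | h0
    · subst h0
      rw [hV, hq rfl]
      simp
    · simp [hV, h0.ne']
  set ν' : ℂ := l₁ + q - 1 with hν'
  set B : ℕ → PowerSeries ℂ := fun i => euler (e i - ν') (R i)
        + if i = 0 then R 1 * (PowerSeries.C c * PowerSeries.X ^ p) else 0 with hB
  have h1 : (PowerSeries.X ^ M : PowerSeries ℂ) • V⁻¹ • lin ν' • x
      = ∑ i ∈ Finset.range 2, (PowerSeries.X * (V⁻¹ * B i)) • y i := by
    rw [smul_comm, h.X_pow_smul_lin, Finset.smul_sum]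
    refine Finset.sum_congr rfl fun i _ => ?_
    rw [← mul_smul, mul_left_comm]
  have h2 : lin (l₁ + M) • (PowerSeries.X ^ M : PowerSeries ℂ) • V⁻¹ • lin ν' • x = 0 := by
    rw [lin_smul_X_pow_smul]
    rw [rankTwoElt, mul_smul, mul_smul] at hx
    change (PowerSeries.X ^ M : PowerSeries ℂ) • lin (l₁ : ℂ) • ofPS V⁻¹ • lin ν' • x = 0
    rw [hx, smul_zero]
  rw [h1, h.lin_smul_sum] at h2
  have h3 : ∀ i < 2, euler (e i - l₁ + 1) (V⁻¹ * B i)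
      + (if i = 0 then (V⁻¹ * B 1) * (PowerSeries.C c * PowerSeries.X ^ p) else 0) = 0 := by
    intro i hi
    have h4 := (mul_eq_zero.mp (h.indep _ h2 i hi)).resolve_left PowerSeries.X_ne_zero
    rw [euler_X_mul] at h4
    have h5 : PowerSeries.X * (euler (e i - l₁ + 1) (V⁻¹ * B i)
      + (if i = 0 then (V⁻¹ * B 1) * (PowerSeries.C c * PowerSeries.X ^ p) else 0)) = 0 := by
      refine Eq.trans ?_ h4
      rw [mul_add]
      congr 1
      split_ifs <;> ring
    exact (mul_eq_zero.mp h5).resolve_left PowerSeries.X_ne_zero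
  have hVB : ∀ i, V * (V⁻¹ * B i) = B i := fun i => by
    rw [← mul_assoc, PowerSeries.mul_inv_cancel _ hV0, one_mul]
  obtain ⟨r1, r2, r3⟩ := rank_two_coefficients (S := R 1) (Z := R 0) (x₁ := V⁻¹ * B 1)
    (x₀ := V⁻¹ * B 0) (ν := e 1) (ν' := ν') (ε := e 0) (α := α) (c := c) (p := p) (q := q)
    (by rw [← hV, hVB]; simp [hB]) (by rw [← hV, hVB]; simp [hB])
    (by
      have := h3 1 (by omega)
      rw [if_neg (by omega), add_zero] at this
      rw [← this, hν']
      congr 1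
      ring)
    (by
      have := h3 0 (by omega)
      rw [if_pos rfl] at this
      rw [← this, hν']
      congr 2
      ring) hα hq h.exponent_pos
    (by
      have := h.exponent
      have h5 : e 1 = e 0 + p := by rw [this]; ring
      rw [h5]; push_cast; rfl) (h.unit 1 (by omega)) (h.unit 0 (by omega))
  refine ⟨?_, r2, r3⟩
  rw [hν'] at r1
  exact_mod_cast r1

theorem IsChain.map {E : Type*} [AddCommGroup E] [Module ATilde E] {k : ℕ} {l : ℕ → ℚ}
    {U : ℕ → PowerSeries ℂ} {f : ℕ → E} (h : IsChain k l U f) (ι : E →ₗ[ATilde] A)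
    (hι : Function.Injective ι) : IsChain k l U fun i => ι (f i) := by
  refine ⟨fun h0 => ?_, fun i hi => ?_, h.unit, fun S hS => ?_⟩
  · rw [← map_smul, h.zero h0, map_zero]
  · rw [← map_smul, h.succ i hi, map_ps_smul]
  · refine h.indep S (hι ?_)
    rw [map_zero, map_sum, ← hS]
    exact Finset.sum_congr rfl fun i _ => map_ps_smul ι _ _

theorem PSSpan.map {E : Type*} [AddCommGroup E] [Module ATilde E] {k : ℕ} {f : ℕ → E} {x : E}
    (h : PSSpan k f x) (ι : E →ₗ[ATilde] A) : PSSpan k (fun i => ι (f i)) (ι x) := by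
  obtain ⟨S, rfl⟩ := h
  exact ⟨S, by rw [map_sum]; exact Finset.sum_congr rfl fun i _ => map_ps_smul ι _ _⟩

theorem IsPrincipalJH.monotone {E : Type*} [AddCommGroup E] [Module ATilde E] {k : ℕ} {lam : ℕ → ℚ}
    {F : ℕ → Submodule ATilde E} (h : IsPrincipalJH k lam F) (i j : ℕ) (hij : i ≤ j) (hj : j < k) :
    lam (i + 1) + i ≤ lam (j + 1) + j := by
  induction j, hij using Nat.le_induction with
  | base => exact le_rfl
  | succ j hij ih =>
    have h1 := ih (by omega)
    have h2 := h.principal (j + 1) (by omega) hj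
    push_cast at h2 ⊢
    linarith

theorem IsPrincipalJH.exists_isChain {E : Type*} [AddCommGroup E] [Module ATilde E] {k : ℕ}
    {lam : ℕ → ℚ} {F : ℕ → Submodule ATilde E} (h : IsPrincipalJH (k + 1) lam F) {g : E}
    (hg : Submodule.span ATilde {g} = ⊤) :
    ∃ (U : ℕ → PowerSeries ℂ) (f : ℕ → E), IsChain (k + 1) (fun i => lam (i + 1)) U f ∧
      (∃ S : PowerSeries ℂ, PowerSeries.constantCoeff S ≠ 0 ∧ g = S • f k) ∧
      ∀ j ≤ k + 1, ∀ x, x ∈ F j ↔ PSSpan j f x :=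
  ABTheory.exists_isChain k lam F h.bot h.mono h.quot g (h.top.trans hg.symm)

/-- A principal Jordan-Hölder sequence is determined by a normal form. -/
theorem IsNormalForm.principalJH_unique (htf : TorsionFree A) {E : Type*} [AddCommGroup E]
    [Module ATilde E] {ι : E →ₗ[ATilde] A} (hι : Function.Injective ι) {n : ℕ} {e : ℕ → ℚ} {p : ℕ}
    {c : ℂ} {M : ℕ} {y : ℕ → A} {R : ℕ → PowerSeries ℂ} {g : E}
    (h : IsNormalForm n e p c M y R (ι g)) (hg : Submodule.span ATilde {g} = ⊤) {lam : ℕ → ℚ}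
    {F : ℕ → Submodule ATilde E} (hF : IsPrincipalJH (n + 2) lam F) :
    (∀ i < n + 2, lam (i + 1) = e i + (n + 1 : ℕ) - i) ∧
      ∀ m ≤ n + 2, ∀ x ∈ F m, PSSpan m y ((PowerSeries.X ^ M : PowerSeries ℂ) • ι x) := by
  obtain ⟨U, f, hch, ⟨S, hS, hgS⟩, htri⟩ := h.hasTriangularChain htf
  obtain ⟨U', f', hch', ⟨S', hS', hgS'⟩, hsp'⟩ := hF.exists_isChain hg
  have hch'' := hch'.map ι hι
  have hspan : ∀ x, PSSpan (n + 2) f x ↔ PSSpan (n + 2) (fun i => ι (f' i)) x := by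
    intro x
    rw [hch.psSpan_iff_mem_span (by omega), hch''.psSpan_iff_mem_span (by omega),
      ← span_unit_smul hS, ← hgS, hgS', map_ps_smul, span_unit_smul hS']
  have huniq := hch.unique hch'' hspan
    (fun i j hij hj => by have := h.strict i j hij hj; linarith)
    (fun i j hij hj => hF.monotone i j hij hj)
  refine ⟨fun i hi => ((huniq (n + 2) le_rfl).1 i hi).symm, fun m hm x hx => ?_⟩
  obtain ⟨T, hT⟩ := ((huniq m hm).2 _).mpr (((hsp' m hm x).mp hx).map ι)
  rw [hT, Finset.smul_sum]
  refine PSSpan.sum _ _ fun i hi => ?_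
  have := Finset.mem_range.mp hi
  rw [smul_comm]
  exact ((htri i (by omega)).smul _).mono (by omega)

theorem span_mk_eq_top {E : Type*} [AddCommGroup E] [Module ATilde E] (x : E) :
    Submodule.span ATilde {(⟨x, Submodule.mem_span_singleton_self x⟩ : Submodule.span ATilde {x})}
      = ⊤ := by
  rw [eq_top_iff]
  rintro ⟨z, hz⟩ _
  obtain ⟨u, rfl⟩ := Submodule.mem_span_singleton.mp hz
  exact Submodule.mem_span_singleton.mpr ⟨u, rfl⟩

universe u v

/-- Induction along the recursive definition of α. The normal form is kept in a fixed ambient module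
A, because the vectors y_i need not lie in the submodules produced by the recursion. Rank two gives
-α p, and each reduction contributes one factor. -/
theorem IsNormalForm.alpha_eq {A : Type v} [AddCommGroup A] [Module ATilde A] (htf : TorsionFree A)
    (n : ℕ) (E : Type u) [AddCommGroup E] [Module ATilde E] (ι : E →ₗ[ATilde] A)
    (hι : Function.Injective ι) {e : ℕ → ℚ} {p : ℕ} {c : ℂ} {M : ℕ} {y : ℕ → A}
    {R : ℕ → PowerSeries ℂ} {g : E} (h : IsNormalForm n e p c M y R (ι g))
    (hg : Submodule.span ATilde {g} = ⊤) {α : ℂ} (hα0 : α ≠ 0) (hα : IsAlphaInvariant (n + 2) E α)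
    (γ : ℂ) (hγ : c * PowerSeries.constantCoeff (R (n + 1)) = γ * PowerSeries.constantCoeff (R 0)) :
    γ * ∏ j ∈ Finset.Icc 1 n, (((e (n + 1) - e j) / (e 0 - e j) : ℚ) : ℂ) = -(α * p) := by
  induction n generalizing E e c y R g γ with
  | zero =>
    obtain ⟨l₁, q, x, hq, hx, hx'⟩ := exists_generator_of_isAlphaInvariant_two hα
    obtain ⟨u, rfl⟩ : ∃ u : ATilde, u • g = x :=
      Submodule.mem_span_singleton.mp (hg ▸ Submodule.mem_top)
    have hmem : ι g ∈ Submodule.span ATilde {u • ι g} := by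
      obtain ⟨v, hv⟩ := Submodule.mem_span_singleton.mp
        (show g ∈ Submodule.span ATilde {u • g} from hx ▸ Submodule.mem_top)
      rw [← map_smul]
      exact Submodule.mem_span_singleton.mpr ⟨v, by rw [← map_smul, hv]⟩
    obtain ⟨T, hT, s, hs, hsT⟩ := h.of_span_eq hmem
    obtain ⟨-, -, r3⟩ := hT.alpha_two hα0 hq (by rw [← map_smul, ← map_smul, hx', map_zero])
    rw [hsT, hsT] at r3
    have h0 : s * PowerSeries.constantCoeff (R 0) ≠ 0 := mul_ne_zero hs (h.unit 0 (by omega))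
    rw [Finset.Icc_eq_empty (by omega), Finset.prod_empty, mul_one]
    apply mul_right_cancel₀ h0
    linear_combination r3 - s * hγ
  | succ n ih =>
    obtain ⟨lam, F, x, hF, hx, hxF, hG⟩ := hα
    obtain ⟨u, rfl⟩ : ∃ u : ATilde, u • g = x :=
      Submodule.mem_span_singleton.mp (hg ▸ Submodule.mem_top)
    have hmem : ι g ∈ Submodule.span ATilde {u • ι g} := by
      obtain ⟨v, hv⟩ := Submodule.mem_span_singleton.mp
        (show g ∈ Submodule.span ATilde {u • g} from hx ▸ Submodule.mem_top)
      rw [← map_smul]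
      exact Submodule.mem_span_singleton.mpr ⟨v, by rw [← map_smul, hv]⟩
    obtain ⟨T, hT, s, hs, hsT⟩ := h.of_span_eq hmem
    rw [← map_smul] at hT
    obtain ⟨hlam, hspan⟩ := hT.principalJH_unique htf hι hx hF
    have e1 : lam (n + 2) = e (n + 1) + 1 := by
      have := hlam (n + 1) (by omega)
      rw [this]; push_cast; ring
    have e2 : lam (n + 3) = e (n + 2) := by
      have := hlam (n + 2) (by omega)
      rw [this]; push_cast; ring
    -- With k = n + 3 one has λ_{k-1} = e_{k-2} + 1, so the operator in the definition of α is
    -- exactly the one that removes y_{k-2}.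
    have e3 : ((lam (n + 2) : ℚ) : ℂ) - 1 = (e (n + 1) : ℂ) := by rw [e1]; push_cast; ring
    have hs1 := hspan (n + 1) (by omega) _ hxF
    rw [map_smul, mul_smul, e1, e2, Rat.cast_add, Rat.cast_one] at hs1
    obtain ⟨c', y', R', hNF, hrel⟩ := hT.reduce hs1
    rw [e3] at hG
    have h2 := hrel γ (by
      rw [hsT, hsT]
      linear_combination s * hγ)
    have h3 := ih (Submodule.span ATilde {lin (e (n + 1) : ℂ) • u • g})
      (ι ∘ₗ (Submodule.span ATilde {lin (e (n + 1) : ℂ) • u • g}).subtype)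
      (hι.comp Subtype.val_injective)
      (g := ⟨lin (e (n + 1) : ℂ) • u • g, Submodule.mem_span_singleton_self _⟩)
      (by
        change IsNormalForm _ _ _ _ _ _ _ (ι (lin (e (n + 1) : ℂ) • u • g))
        rw [map_smul]
        exact hNF) (span_mk_eq_top _) hG _ h2
    -- The factor j = n + 1 is the one produced by this reduction. In the others all exponents are
    -- shifted by 1, which cancels in the differences.
    rw [← h3, ← Finset.insert_Icc_right_eq_Icc_add_one (by omega), Finset.prod_insert (by simp),
      ← mul_assoc]
    congr 1
    refine Finset.prod_congr rfl fun j hj => ?_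
    have := Finset.mem_Icc.mp hj
    rw [if_neg (by omega), if_pos (by omega), if_pos (by omega)]
    congr 2
    · ring
    · ring

end Alpha

/-! ### Asymptotic expansions -/

section Xi

theorem IsRep.act_a {W : Type*} [AddCommGroup W] [Module ℂ W] (α β : Module.End ℂ (ℕ → W))
    (x : ℕ → W) : act α β a x = α x := by
  funext n
  unfold act
  rw [Finset.sum_eq_single 0]
  · simp [a]
  · intro ν _ hν
    simp [a, Pi.single_eq_of_ne hν]
  · simp

theorem IsRep.act_b {W : Type*} [AddCommGroup W] [Module ℂ W] {α β : Module.End ℂ (ℕ → W)}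
    (h : IsRep α β) (x : ℕ → W) : act α β b x = β x := by
  funext n
  cases n with
  | zero =>
    rw [h.filt_b 0 x (by simp) 0 (by omega)]
    simp [act, b]
  | succ n =>
    unfold act
    rw [Finset.sum_eq_single 1]
    · simp [b]
    · intro ν _ hν
      simp [b, Pi.single_eq_of_ne hν]
    · simp

namespace XiOne

variable {l : Set.Ioc (0 : ℚ) 1} {N : ℕ}

theorem C_smul (c : ℂ) (x : XiOne l N) : (PowerSeries.C c : PowerSeries ℂ) • x = c • x := by
  rw [ps_smul_def, ← algebraMap_eq, Algebra.algebraMap_eq_smul_one]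
  exact (IsRep.smul_act (xiA N) (xiB l N) (Pi.single 0 1) c x).trans
    (congrArg (c • ·) (IsRep.act_one (xiA N) (xiB l N) x))

theorem a_smul (x : XiOne l N) : a • x = (xiA N x : ℕ → Fin (N + 1) → ℂ) :=
  IsRep.act_a _ _ _

theorem b_smul (x : XiOne l N) : b • x = (xiB l N x : ℕ → Fin (N + 1) → ℂ) :=
  (isRep_xi l.2.1 N).act_b x

theorem exponent_ne_zero (l : Set.Ioc (0 : ℚ) 1) (n : ℕ) : (n : ℂ) + ((l : ℚ) : ℂ) ≠ 0 := by
  have h1 := l.2.1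
  have : (n : ℚ) + l ≠ 0 := by positivity
  exact_mod_cast this

theorem logPrim_apply_logDer (n : ℕ) (q : Fin (N + 1) → ℂ) :
    logPrim N ((n : ℂ) + ((l : ℚ) : ℂ)) (((n : ℂ) + ((l : ℚ) : ℂ)) • q + logDer N q) = q := by
  have := LinearMap.congr_fun (logPrim_right N (exponent_ne_zero l n)) q
  simpa using this

theorem logDer_apply_logPrim (n : ℕ) (q : Fin (N + 1) → ℂ) :
    ((n : ℂ) + ((l : ℚ) : ℂ)) • logPrim N ((n : ℂ) + ((l : ℚ) : ℂ)) q
      + logDer N (logPrim N ((n : ℂ) + ((l : ℚ) : ℂ)) q) = q := by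
  have := LinearMap.congr_fun (logPrim_left N (exponent_ne_zero l n)) q
  simpa using this

theorem torsionFree : TorsionFree (XiOne l N) := by
  intro x hx
  rw [X_smul, b_smul] at hx
  funext n
  have h1 : logPrim N ((n : ℂ) + ((l : ℚ) : ℂ)) (x n) = 0 := congrFun hx (n + 1)
  have h2 := logDer_apply_logPrim (l := l) n (x n)
  rw [h1, smul_zero, map_zero, add_zero] at h2
  exact h2.symm

theorem exists_a_smul_eq (x : XiOne l N) : ∃ y : XiOne l N, a • x = b • y := by
  -- This is the derivative of s x with respect to s.
  let y : XiOne l N := fun n => ((n : ℂ) + ((l : ℚ) : ℂ)) • x n + logDer N (x n)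
  refine ⟨y, ?_⟩
  rw [a_smul, b_smul y]
  funext n
  cases n with
  | zero => rfl
  | succ n => exact (logPrim_apply_logDer n (x n)).symm

theorem eigen_apply {μ : ℂ} {x : XiOne l N} (h : lin μ • x = 0) (n : ℕ) :
    logDer N (x n) = (μ - (n + ((l : ℚ) : ℂ))) • x n := by
  rw [lin_eq, sub_smul, mul_smul, sub_eq_zero] at h
  change a • x = PowerSeries.C μ • b • x at h
  rw [C_smul, a_smul, b_smul] at h
  have h1 : x n = μ • logPrim N ((n : ℂ) + ((l : ℚ) : ℂ)) (x n) := congrFun h (n + 1)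
  have h2 := logDer_apply_logPrim (l := l) n (μ • x n)
  rw [map_smul, ← h1] at h2
  rw [sub_smul, ← h2]
  abel

/-- By `eigen_apply`, x_n is an eigenvector of the nilpotent derivation d/d(log s), with eigenvalue
μ - n - l. -/
theorem eigen_apply_eq_zero {μ : ℂ} {x : XiOne l N} (h : lin μ • x = 0) {n : ℕ}
    (hμ : μ ≠ n + ((l : ℚ) : ℂ)) : x n = 0 := by
  have h1 := eigen_apply h n
  have h2 : ∀ m : ℕ, (logDer N ^ m) (x n) = (μ - (n + ((l : ℚ) : ℂ))) ^ m • x n := by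
    intro m
    induction m with
    | zero => simp
    | succ m ih =>
      rw [pow_succ', Module.End.mul_apply, ih, map_smul, h1, smul_smul, pow_succ]
  have h3 := h2 (N + 1)
  rw [logDer_pow, LinearMap.zero_apply] at h3
  exact (smul_eq_zero.mp h3.symm).resolve_left (pow_ne_zero _ (sub_ne_zero.mpr hμ))

theorem eigen_apply_apply {μ : ℂ} {x : XiOne l N} (h : lin μ • x = 0) (n : ℕ) (j : Fin (N + 1))
    (hj : j ≠ 0) : x n j = 0 := by
  by_cases hμ : μ = n + ((l : ℚ) : ℂ)
  · have h1 := eigen_apply h n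
    rw [hμ, sub_self, zero_smul] at h1
    obtain ⟨i, hi⟩ : ∃ i : ℕ, (j : ℕ) = i + 1 := ⟨j - 1, by
      have : (j : ℕ) ≠ 0 := fun h0 => hj (Fin.ext h0)
      omega⟩
    have hiN : i + 1 < N + 1 := hi ▸ j.2
    have h2 := congrFun h1 ⟨i, by omega⟩
    simp only [logDer, LinearMap.coe_mk, AddHom.coe_mk, Pi.zero_apply] at h2
    rw [dif_pos hiN] at h2
    have h3 : j = ⟨i + 1, hiN⟩ := Fin.ext hi
    rw [h3]
    refine (mul_eq_zero.mp h2).resolve_left ?_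
    exact_mod_cast Nat.succ_ne_zero i
  · rw [eigen_apply_eq_zero h hμ]
    rfl

end XiOne

namespace Xi

variable {L : Finset (Set.Ioc (0 : ℚ) 1)} {N : ℕ}

theorem torsionFree : TorsionFree (Xi L N) := by
  intro x hx
  funext l
  exact XiOne.torsionFree (x l) (congrFun hx l)

theorem exists_a_smul_eq (x : Xi L N) : ∃ y : Xi L N, a • x = b • y := by
  choose y hy using fun l => XiOne.exists_a_smul_eq (x l)
  exact ⟨y, funext hy⟩

theorem eigen_ne_zero {μ : ℚ} {x : Xi L N} (h : lin (μ : ℂ) • x = 0) {l : L} {n : ℕ}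
    (hx : x l n ≠ 0) : μ = n + ((l : Set.Ioc (0 : ℚ) 1) : ℚ) := by
  by_contra hne
  refine hx (XiOne.eigen_apply_eq_zero (congrFun h l) fun h0 => hne ?_)
  exact_mod_cast h0

theorem eigen_pos {μ : ℚ} {x : Xi L N} (h : lin (μ : ℂ) • x = 0) (hx : x ≠ 0) : 0 < μ := by
  obtain ⟨l, hl⟩ := Function.ne_iff.mp hx
  obtain ⟨n, hn⟩ := Function.ne_iff.mp hl
  rw [eigen_ne_zero h hn]
  have := (l : Set.Ioc (0 : ℚ) 1).2.1
  positivity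

end Xi

/-- The eigenspaces of `b⁻¹ a` have dimension at most one. -/
def SimpleEigen (E : Type*) [AddCommGroup E] [Module ATilde E] : Prop :=
  ∀ (μ : ℚ) (x z : E), x ≠ 0 → lin (μ : ℂ) • x = 0 → lin (μ : ℂ) • z = 0 →
    ∃ c : ℂ, z = (PowerSeries.C c : PowerSeries ℂ) • x

/-- Since l lies in ]0,1], the weight μ = n + l determines both n and l; and in this degree an
eigenvector has no logarithm. So it is a multiple of s^(μ-1). -/
theorem Xi.simpleEigen {L : Finset (Set.Ioc (0 : ℚ) 1)} {N : ℕ} : SimpleEigen (Xi L N) := by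
  intro μ x z hx0 hx hz
  obtain ⟨l, hl⟩ := Function.ne_iff.mp hx0
  obtain ⟨n, hn⟩ := Function.ne_iff.mp hl
  have hμ := eigen_ne_zero hx hn
  obtain ⟨j, hj⟩ := Function.ne_iff.mp hn
  have hj0 : j = 0 := by
    by_contra hne
    exact hj (XiOne.eigen_apply_apply (congrFun hx l) n j hne)
  subst hj0
  have hj' : x l n 0 ≠ 0 := hj
  refine ⟨z l n 0 / x l n 0, ?_⟩
  have key : ∀ (w : Xi L N), lin (μ : ℂ) • w = 0 → ∀ (l' : L) (n' : ℕ) (j' : Fin (N + 1)),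
      (l' ≠ l ∨ n' ≠ n ∨ j' ≠ 0) → w l' n' j' = 0 := by
    intro w hw l' n' j' hne
    by_contra h0
    have hwn : w l' n' ≠ 0 := fun h1 => h0 (by rw [h1]; rfl)
    have hμ' := eigen_ne_zero hw hwn
    have b1 := (l : Set.Ioc (0 : ℚ) 1).2
    have b2 := (l' : Set.Ioc (0 : ℚ) 1).2
    rw [hμ] at hμ'
    have hnn : n' = n := by
      have q1 : (n : ℚ) < n' + 1 := by linarith [b1.1, b2.2]
      have q2 : (n' : ℚ) < n + 1 := by linarith [b2.1, b1.2]
      have q1' : n < n' + 1 := by exact_mod_cast q1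
      have q2' : n' < n + 1 := by exact_mod_cast q2
      omega
    subst hnn
    have hll : l' = l := by
      apply Subtype.ext
      apply Subtype.ext
      linarith
    subst hll
    have hj0 : j' ≠ 0 := by tauto
    exact h0 (XiOne.eigen_apply_apply (congrFun hw l') n' j' hj0)
  funext l' n' j'
  change z l' n' j' = (PowerSeries.C (z l n 0 / x l n 0) • x l' : XiOne l' N) n' j'
  rw [XiOne.C_smul]
  change z l' n' j' = (z l n 0 / x l n 0) * x l' n' j'
  by_cases h : l' ≠ l ∨ n' ≠ n ∨ j' ≠ 0
  · rw [key z hz l' n' j' h, key x hx l' n' j' h, mul_zero]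
  · push Not at h
    obtain ⟨rfl, rfl, rfl⟩ := h
    rw [div_mul_cancel₀ _ hj']

theorem SimpleEigen.of_injective {E E' : Type*} [AddCommGroup E] [Module ATilde E]
    [AddCommGroup E'] [Module ATilde E'] (f : E →ₗ[ATilde] E') (hf : Function.Injective f)
    (h : SimpleEigen E') : SimpleEigen E := by
  intro μ x z hx0 hx hz
  obtain ⟨c, hc⟩ := h μ (f x) (f z) (fun h0 => hx0 (hf (by rw [h0, map_zero])))
    (by rw [← map_smul, hx, map_zero]) (by rw [← map_smul, hz, map_zero])
  exact ⟨c, hf (by rw [hc, map_ps_smul])⟩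

theorem IsTheme.exists_injective {E : Type*} [AddCommGroup E] [Module ATilde E] (h : IsTheme E) :
    ∃ (L : Finset (Set.Ioc (0 : ℚ) 1)) (N : ℕ) (f : E →ₗ[ATilde] Xi L N), Function.Injective f := by
  obtain ⟨L, N, φ, ⟨ψ⟩⟩ := h
  exact ⟨L, N, (Submodule.span ATilde {φ}).subtype ∘ₗ ψ.toLinearMap,
    Subtype.val_injective.comp ψ.injective⟩

theorem IsTheme.torsionFree {E : Type*} [AddCommGroup E] [Module ATilde E] (h : IsTheme E) :
    TorsionFree E := by
  obtain ⟨L, N, f, hf⟩ := h.exists_injective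
  exact TorsionFree.of_injective f hf Xi.torsionFree

theorem IsTheme.simpleEigen {E : Type*} [AddCommGroup E] [Module ATilde E] (h : IsTheme E) :
    SimpleEigen E := by
  obtain ⟨L, N, f, hf⟩ := h.exists_injective
  exact SimpleEigen.of_injective f hf Xi.simpleEigen

end Xi

/-! ### Modules of rank two -/

section RankTwo

variable {T : Type*} [AddCommGroup T] [Module ATilde T]

theorem exists_mul_rankTwoElt_add (μ ν : ℂ) {V : PowerSeries ℂ}
    (hV : PowerSeries.constantCoeff V ≠ 0) (u : ATilde) :
    ∃ (q : ATilde) (S S' : PowerSeries ℂ),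
      u = q * rankTwoElt μ V ν + (ofPS S' * lin ν + ofPS S) := by
  obtain ⟨q, S, rfl⟩ := exists_eq_mul_lin_add ν u
  obtain ⟨q', S', h⟩ := exists_eq_mul_lin_add μ (q * ofPS V)
  refine ⟨q', S, S' * V⁻¹, ?_⟩
  have e : q = q * ofPS V * ofPS V⁻¹ := by
    rw [mul_assoc, ← map_mul, PowerSeries.mul_inv_cancel _ hV, map_one, mul_one]
  conv_lhs => rw [e, h]
  rw [rankTwoElt, map_mul, add_mul, add_mul, ← add_assoc]
  simp only [mul_assoc]

theorem span_pair_eq_top {μ ν : ℂ} {V : PowerSeries ℂ} (hV : PowerSeries.constantCoeff V ≠ 0)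
    {z : T} (hz : Submodule.span ATilde {z} = ⊤) (hPz : rankTwoElt μ V ν • z = 0) :
    ⊤ ≤ Submodule.span (PowerSeries ℂ) (Set.range ![z, lin ν • z]) := by
  intro t _
  obtain ⟨u, rfl⟩ := Submodule.mem_span_singleton.mp (hz ▸ (Submodule.mem_top (x := t)))
  obtain ⟨q, S, S', rfl⟩ := exists_mul_rankTwoElt_add μ ν hV u
  rw [add_smul, mul_smul, hPz, smul_zero, zero_add, add_smul, mul_smul]
  refine Submodule.add_mem _ ?_ ?_
  · exact Submodule.smul_mem _ S' (Submodule.subset_span ⟨1, rfl⟩)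
  · exact Submodule.smul_mem _ S (Submodule.subset_span ⟨0, rfl⟩)

/-- Two right divisions show that z and (a - ν b) z span T over ℂ[[b]]. When the rank is 2 they are
a basis, so the annihilator of z is no larger than the left ideal of the given element. -/
theorem nonempty_equiv_cyc_rankTwoElt {μ ν : ℂ} {V : PowerSeries ℂ}
    (hV : PowerSeries.constantCoeff V ≠ 0) {z : T} (hz : Submodule.span ATilde {z} = ⊤)
    (hPz : rankTwoElt μ V ν • z = 0) (hrank : abRank T = 2) :
    Nonempty (T ≃ₗ[ATilde] Cyc (rankTwoElt μ V ν)) := by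
  have hli : LinearIndependent (PowerSeries ℂ) ![z, lin ν • z] :=
    linearIndependent_of_top_le_span_of_card_eq_finrank (span_pair_eq_top hV hz hPz)
      (by rw [Fintype.card_fin]; exact hrank.symm)
  let φ : Cyc (rankTwoElt μ V ν) →ₗ[ATilde] T :=
    Submodule.liftQ _ (LinearMap.toSpanSingleton ATilde T z) (by
      rw [Submodule.span_singleton_le_iff_mem, LinearMap.mem_ker,
        LinearMap.toSpanSingleton_apply, hPz])
  have hφ : ∀ u : ATilde, φ (Submodule.Quotient.mk u) = u • z := fun u => rfl
  refine ⟨(LinearEquiv.ofBijective φ ⟨?_, ?_⟩).symm⟩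
  · rw [injective_iff_map_eq_zero]
    intro x hx
    obtain ⟨u, rfl⟩ := Submodule.Quotient.mk_surjective _ x
    obtain ⟨q, S, S', rfl⟩ := exists_mul_rankTwoElt_add μ ν hV u
    rw [hφ, add_smul, mul_smul, hPz, smul_zero, zero_add, add_smul, mul_smul] at hx
    have h1 := LinearIndependent.pair_iff.mp hli S S' (by rw [add_comm]; exact hx)
    rw [h1.1, h1.2, map_zero, zero_mul, add_zero, add_zero, Submodule.Quotient.mk_eq_zero]
    exact Submodule.mem_span_singleton.mpr ⟨q, rfl⟩
  · intro t
    obtain ⟨u, rfl⟩ := Submodule.mem_span_singleton.mp (hz ▸ (Submodule.mem_top (x := t)))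
    exact ⟨Submodule.Quotient.mk u, rfl⟩

/-- If b^M f_0 = S z and b^M f_1 = S' z, then S' b^M f_0 = S b^M f_1, a nontrivial relation. -/
theorem not_rank_two_of_dependent (htf : TorsionFree T) (M : ℕ) (z : T)
    (h : ∀ t : T, ∃ S : PowerSeries ℂ, (PowerSeries.X ^ M : PowerSeries ℂ) • t = S • z)
    (hrank : abRank T = 2) : False := by
  obtain ⟨f, hf⟩ := exists_linearIndependent_of_le_finrank (R := PowerSeries ℂ) (M := T) (n := 2)
    (le_of_eq hrank.symm)
  have hf' : LinearIndependent (PowerSeries ℂ) ![f 0, f 1] := by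
    convert hf using 1
    funext i
    fin_cases i <;> rfl
  rw [LinearIndependent.pair_iff] at hf'
  obtain ⟨S, hS⟩ := h (f 0)
  obtain ⟨S', hS'⟩ := h (f 1)
  have h1 := hf' (S' * PowerSeries.X ^ M) (-(S * PowerSeries.X ^ M)) (by
    rw [neg_smul, mul_smul, mul_smul, hS, hS', smul_comm, add_neg_cancel])
  have h2 := (mul_eq_zero.mp (neg_eq_zero.mp h1.2)).resolve_right
    (pow_ne_zero _ PowerSeries.X_ne_zero)
  rw [h2, zero_smul] at hS
  have h3 := hf' 1 0 (by rw [htf.pow M hS, smul_zero, zero_smul, add_zero])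
  exact one_ne_zero h3.1

/-- Normalisation of the generator in rank two. -/
theorem exists_generator_rankTwoElt (htf : TorsionFree T) {ε ν : ℚ} {p : ℕ} {c γ : ℂ} {M : ℕ}
    {y₀ y₁ g : T} {S Q : PowerSeries ℂ} (hp : 0 < p) (hν : (p : ℚ) = ν - ε)
    (h0 : lin ((ε + M : ℚ) : ℂ) • y₀ = 0)
    (h1 : lin ((ν + M : ℚ) : ℂ) • y₁ = (PowerSeries.C c * PowerSeries.X ^ (p + 1)) • y₀)
    (hg : (PowerSeries.X ^ M : PowerSeries ℂ) • g = S • y₁ + Q • y₀)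
    (hS : PowerSeries.constantCoeff S ≠ 0) (hQ : PowerSeries.constantCoeff Q ≠ 0)
    (hγ : c * PowerSeries.constantCoeff S = γ * PowerSeries.constantCoeff Q) :
    ∃ z : T, Submodule.span ATilde {z} = Submodule.span ATilde {g} ∧
      (PowerSeries.X ^ M : PowerSeries ℂ) • z = y₁ + (PowerSeries.C
        (PowerSeries.constantCoeff Q / PowerSeries.constantCoeff S) : PowerSeries ℂ) • y₀ ∧
      rankTwoElt ((ε + 1 : ℚ) : ℂ)
        (1 + PowerSeries.C (-γ / p) * PowerSeries.X ^ p) (ν : ℂ) • z = 0 := by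
  set r : ℂ := PowerSeries.constantCoeff Q / PowerSeries.constantCoeff S with hr
  have hr0 : r ≠ 0 := div_ne_zero hQ hS
  have hcr : c = γ * r := by
    rw [hr]
    field_simp
    exact hγ
  have hp0 : (p : ℂ) ≠ 0 := by exact_mod_cast hp.ne'
  have hS' : PowerSeries.constantCoeff S⁻¹ ≠ 0 := by
    rw [PowerSeries.constantCoeff_inv]; exact inv_ne_zero hS
  have hεν : (ε : ℂ) - ν = -p := by
    have : (p : ℂ) = ((ν - ε : ℚ) : ℂ) := by rw [← hν]; simp
    rw [this]; push_cast; ring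
  -- the images by `a - ν b`
  have himg : ∀ (x : T) (K : PowerSeries ℂ), (PowerSeries.X ^ M : PowerSeries ℂ) • x = y₁ + K • y₀ →
      (PowerSeries.X ^ M : PowerSeries ℂ) • lin (ν : ℂ) • x
        = (PowerSeries.X * (euler (-p) K + PowerSeries.C c * PowerSeries.X ^ p)) • y₀ := by
    intro x K hx
    have h2 := h1
    rw [Rat.cast_add, Rat.cast_natCast] at h2
    rw [← lin_smul_X_pow_smul, hx, smul_add, h2, lin_smul_smul_eigen h0, ← add_smul]
    congr 1
    have : ((ε + M : ℚ) : ℂ) - (ν + M) = -p := by push_cast; linear_combination hεν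
    rw [this]
    ring
  set g₁ : T := S⁻¹ • g with hg₁
  set Q₁ : PowerSeries ℂ := S⁻¹ * Q with hQ₁
  have hg₁M : (PowerSeries.X ^ M : PowerSeries ℂ) • g₁ = y₁ + Q₁ • y₀ := by
    rw [hg₁, smul_comm, hg, smul_add, unit_inv_smul_smul hS, ← mul_smul]
  have hQ₁r : PowerSeries.constantCoeff Q₁ = r := by
    rw [hQ₁, map_mul, PowerSeries.constantCoeff_inv, hr, div_eq_inv_mul]
  set W : PowerSeries ℂ := euler (-p) Q₁ + PowerSeries.C c * PowerSeries.X ^ p with hW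
  have hW0 : PowerSeries.constantCoeff W ≠ 0 := by
    rw [hW, map_add, constantCoeff_euler, hQ₁r]
    simp [hp.ne', hr0]
  obtain ⟨Q₂, hQ₂⟩ : PowerSeries.X ∣ Q₁ - PowerSeries.C r := by
    rw [PowerSeries.X_dvd_iff, map_sub, hQ₁r, PowerSeries.constantCoeff_C, sub_self]
  set w : T := lin (ν : ℂ) • g₁ with hw
  have hwM : (PowerSeries.X ^ M : PowerSeries ℂ) • w = (PowerSeries.X * W) • y₀ :=
    himg g₁ Q₁ hg₁M
  -- The subtracted term becomes b Q₂ y₀ = (Q₁ - r) y₀ after multiplication by b^M, so only the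
  -- constant r remains. This uses W(0) = -p r ≠ 0. Then (a - ν b) z becomes b (-p r + c b^p) y₀,
  -- and c = γ r gives the factor 1 - (γ/p) b^p.
  set z : T := g₁ - (Q₂ * W⁻¹) • w with hz
  have hzM : (PowerSeries.X ^ M : PowerSeries ℂ) • z = y₁ + (PowerSeries.C r : PowerSeries ℂ) • y₀ := by
    rw [hz, smul_sub, hg₁M, smul_comm, hwM, ← mul_smul, add_sub_assoc, ← sub_smul]
    congr 2
    linear_combination hQ₂ - PowerSeries.X * Q₂ * PowerSeries.inv_mul_cancel W hW0
  set V : PowerSeries ℂ := 1 + PowerSeries.C (-γ / p) * PowerSeries.X ^ p with hV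
  have hV0 : PowerSeries.constantCoeff V ≠ 0 := by
    simp [hV, hp.ne']
  have hzν : (PowerSeries.X ^ M : PowerSeries ℂ) • lin (ν : ℂ) • z
      = (V * (PowerSeries.X * PowerSeries.C (-(p * r)))) • y₀ := by
    rw [himg z _ hzM]
    congr 1
    have e1 : euler (-(p : ℂ)) (PowerSeries.C r) = PowerSeries.C (-(p * r)) := by
      have := euler_C_mul_X_pow (-(p : ℂ)) r 0
      simpa using this
    have e2 : (PowerSeries.C c : PowerSeries ℂ)
        = PowerSeries.C (-γ / p) * PowerSeries.C (-(p * r)) := by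
      rw [← map_mul, hcr]
      congr 1
      field_simp
    rw [e1, e2, hV]
    ring
  have hzw : lin (ν : ℂ) • z = (V * PowerSeries.C (-(p * r)) * W⁻¹) • w := by
    apply htf.cancel M
    rw [hzν, smul_comm, hwM, ← mul_smul]
    congr 1
    linear_combination -V * PowerSeries.C (-((p : ℂ) * r)) * PowerSeries.X
      * PowerSeries.inv_mul_cancel W hW0
  refine ⟨z, ?_, hzM, ?_⟩
  · rw [← span_unit_smul hS' g, ← hg₁]
    apply le_antisymm
    · rw [Submodule.span_singleton_le_iff_mem]
      have hself := Submodule.mem_span_singleton_self (R := ATilde) g₁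
      exact Submodule.sub_mem _ hself (ps_smul_mem _ (Submodule.smul_mem _ _ hself))
    · rw [Submodule.span_singleton_le_iff_mem]
      have hself := Submodule.mem_span_singleton_self (R := ATilde) z
      have hwz : w ∈ Submodule.span ATilde {z} := by
        have hu : PowerSeries.constantCoeff (V * PowerSeries.C (-((p : ℂ) * r)) * W⁻¹) ≠ 0 := by
          rw [map_mul, map_mul, PowerSeries.constantCoeff_inv, PowerSeries.constantCoeff_C]
          exact mul_ne_zero (mul_ne_zero hV0 (neg_ne_zero.mpr (mul_ne_zero hp0 hr0)))
            (inv_ne_zero hW0)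
        have h3 := ps_smul_mem (V * PowerSeries.C (-((p : ℂ) * r)) * W⁻¹)⁻¹
          (Submodule.smul_mem _ (lin (ν : ℂ)) hself)
        rwa [hzw, unit_inv_smul_smul hu] at h3
      have h4 := Submodule.add_mem _ hself (ps_smul_mem (Q₂ * W⁻¹) hwz)
      rwa [hz, sub_add_cancel] at h4
  · rw [rankTwoElt, mul_smul, mul_smul]
    apply htf.pow M
    rw [← lin_smul_X_pow_smul]
    change lin (((ε + 1 : ℚ) : ℂ) + M) • (PowerSeries.X ^ M : PowerSeries ℂ) • V⁻¹ • lin (ν : ℂ) • z = 0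
    rw [smul_comm _ V⁻¹, hzν, mul_smul V, unit_inv_smul_smul hV0, lin_smul_smul_eigen h0,
      euler_X_mul]
    have e1 : ((ε + M : ℚ) : ℂ) - (((ε + 1 : ℚ) : ℂ) + M) + 1 = 0 := by push_cast; ring
    have e2 : euler 0 (PowerSeries.C (-((p : ℂ) * r))) = 0 := by simp [euler]
    rw [e1, e2, mul_zero, mul_zero, zero_smul]

theorem SimpleEigen.exists_monomial (hse : SimpleEigen T) (htf : TorsionFree T) {μ ν : ℚ} {d : ℕ}
    (hν : ν = μ + d) {x z : T} (hx0 : x ≠ 0) (hx : lin (μ : ℂ) • x = 0) (hz : lin (ν : ℂ) • z = 0) :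
    ∃ c : ℂ, z = (PowerSeries.C c * PowerSeries.X ^ d : PowerSeries ℂ) • x := by
  have h1 := lin_smul_X_pow_smul (μ : ℂ) d x
  rw [hx, smul_zero] at h1
  obtain ⟨c, hc⟩ := hse ν ((PowerSeries.X ^ d : PowerSeries ℂ) • x) z
    (fun h0 => hx0 (htf.pow d h0)) (by rw [hν]; push_cast; exact h1) hz
  exact ⟨c, by rw [hc, mul_smul]⟩

/-- The image of a normal form in a module of rank two with one-dimensional eigenspaces. -/
theorem IsNormalForm.exists_generator_quotient {E : Type*} [AddCommGroup E] [Module ATilde E]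
    {n : ℕ} {e : ℕ → ℚ} {p : ℕ} {c : ℂ} {M : ℕ} {y : ℕ → E} {R : ℕ → PowerSeries ℂ} {g : E}
    (h : IsNormalForm n e p c M y R g) (hg : Submodule.span ATilde {g} = ⊤)
    (hint : ∀ i < n + 2, ∃ d : ℕ, e i = e 0 + d) {γ : ℂ}
    (hγ : c * PowerSeries.constantCoeff (R (n + 1)) = γ * PowerSeries.constantCoeff (R 0))
    (π : E →ₗ[ATilde] T) (hπ : Function.Surjective π) (htf : TorsionFree T) (hse : SimpleEigen T)
    (hrank : abRank T = 2) :
    ∃ z : T, Submodule.span ATilde {z} = ⊤ ∧ rankTwoElt ((e 0 + 1 : ℚ) : ℂ)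
        (1 + PowerSeries.C (-γ / p) * PowerSeries.X ^ p) (e (n + 1) : ℂ) • z = 0 := by
  classical
  have hmap : (PowerSeries.X ^ M : PowerSeries ℂ) • π g
      = ∑ i ∈ Finset.range (n + 2), R i • π (y i) := by
    rw [← map_ps_smul, h.eq, map_sum]
    exact Finset.sum_congr rfl fun i _ => map_ps_smul π _ _
  have hgen : Submodule.span ATilde {π g} = ⊤ := by
    rw [eq_top_iff]
    intro t _
    obtain ⟨x, rfl⟩ := hπ t
    obtain ⟨u, rfl⟩ := Submodule.mem_span_singleton.mp (hg ▸ (Submodule.mem_top (x := x)))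
    exact Submodule.mem_span_singleton.mpr ⟨u, (map_smul _ _ _).symm⟩
  have heig : ∀ i < n + 1, lin ((e i + M : ℚ) : ℂ) • π (y i) = 0 := fun i hi => by
    rw [← map_smul, h.eigen i hi, map_zero]
  have hlog : lin ((e (n + 1) + M : ℚ) : ℂ) • π (y (n + 1))
      = (PowerSeries.C c * PowerSeries.X ^ (p + 1)) • π (y 0) := by
    rw [← map_smul, h.log, map_ps_smul]
  choose! d hd using hint
  have hdlt : ∀ i j, i < j → j < n + 2 → d i < d j := by
    intro i j hij hj
    have := h.strict i j hij hj
    rw [hd i (by omega), hd j hj] at this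
    have h1 : (d i : ℚ) < d j := by linarith
    exact_mod_cast h1
  -- If it vanished, the Jordan block would disappear and every π(y_i) would be an eigenvector.
  -- Simple eigenspaces make all of them multiples of the first nonzero one, whose weight is least,
  -- against rank two.
  have hy0 : π (y 0) ≠ 0 := by
    intro h0
    have heig' : ∀ i < n + 2, lin ((e i + M : ℚ) : ℂ) • π (y i) = 0 := by
      intro i hi
      rcases Nat.lt_succ_iff_lt_or_eq.mp hi with h' | rfl
      · exact heig i h'
      · rw [hlog, h0, smul_zero]
    obtain ⟨z, μ, hz, hyz⟩ : ∃ (z : T) (μ : ℂ), lin μ • z = 0 ∧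
        ∀ i < n + 2, ∃ S : PowerSeries ℂ, π (y i) = S • z := by
      by_cases hex : ∃ i, i < n + 2 ∧ π (y i) ≠ 0
      · have hi0 := Nat.find_spec hex
        refine ⟨π (y (Nat.find hex)), _, heig' _ hi0.1, fun i hi => ?_⟩
        rcases Nat.lt_or_ge i (Nat.find hex) with h1 | h1
        · have := Nat.find_min hex h1
          push Not at this
          exact ⟨0, by rw [this hi, zero_smul]⟩
        · have hle : d (Nat.find hex) ≤ d i := by
            rcases h1.lt_or_eq with h2 | h2
            · exact (hdlt _ _ h2 hi).le
            · rw [h2]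
          obtain ⟨c', hc'⟩ := hse.exists_monomial htf (d := d i - d (Nat.find hex))
            (μ := e (Nat.find hex) + M) (ν := e i + M) (by
              rw [hd i hi, hd _ hi0.1, Nat.cast_sub hle]; ring) hi0.2 (heig' _ hi0.1) (heig' i hi)
          exact ⟨_, hc'⟩
      · push Not at hex
        exact ⟨0, 0, by simp, fun i hi => ⟨0, by rw [hex i hi, zero_smul]⟩⟩
    choose! S hS using hyz
    refine not_rank_two_of_dependent htf M z (fun t => ?_) hrank
    obtain ⟨u, rfl⟩ := Submodule.mem_span_singleton.mp (hgen ▸ (Submodule.mem_top (x := t)))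
    obtain ⟨v, -, hv⟩ := smul_comm_X_pow (E := T) M u
    have h1 : (PowerSeries.X ^ M : PowerSeries ℂ) • π g
        = (∑ i ∈ Finset.range (n + 2), R i * S i) • z := by
      rw [hmap, Finset.sum_smul]
      exact Finset.sum_congr rfl fun i hi => by
        rw [hS i (Finset.mem_range.mp hi), mul_smul]
    obtain ⟨W, -, q, hq⟩ := exists_smul_smul_eigen μ v (∑ i ∈ Finset.range (n + 2), R i * S i)
    refine ⟨W, ?_⟩
    rw [hv, h1, ← mul_ofPS_smul, hq, add_smul, mul_smul, hz, smul_zero, zero_add]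
    rfl
  have hmon : ∀ i < n + 1, ∃ c' : ℂ, π (y i)
      = (PowerSeries.C c' * PowerSeries.X ^ d i : PowerSeries ℂ) • π (y 0) := fun i hi =>
    hse.exists_monomial htf (by rw [hd i (by omega)]; ring) hy0 (heig 0 (by omega)) (heig i hi)
  choose! c' hc' using hmon
  -- The contributions of y_1, …, y_n carry the powers b^(d_i) with d_i > d_0 ≥ 0, so the constant
  -- term of Q is that of R_0 and γ is unchanged.
  set Q : PowerSeries ℂ := ∑ i ∈ Finset.range n,
    R (i + 1) * (PowerSeries.C (c' (i + 1)) * PowerSeries.X ^ d (i + 1)) + R 0 with hQ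
  have hQ0 : PowerSeries.constantCoeff Q = PowerSeries.constantCoeff (R 0) := by
    rw [hQ, map_add, map_sum, Finset.sum_eq_zero, zero_add]
    intro i hi
    have h1 := hdlt 0 (i + 1) (by omega) (by have := Finset.mem_range.mp hi; omega)
    rw [map_mul, map_mul, map_pow, PowerSeries.constantCoeff_X, zero_pow (by omega), mul_zero,
      mul_zero]
  have hgQ : (PowerSeries.X ^ M : PowerSeries ℂ) • π g = R (n + 1) • π (y (n + 1)) + Q • π (y 0) := by
    rw [hmap, Finset.sum_range_succ, Finset.sum_range_succ', add_comm, hQ, add_smul,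
      Finset.sum_smul]
    congr 2
    refine Finset.sum_congr rfl fun i hi => ?_
    rw [hc' (i + 1) (by have := Finset.mem_range.mp hi; omega), ← mul_smul]
  obtain ⟨z, hz, -, hz'⟩ := exists_generator_rankTwoElt htf h.exponent_pos h.exponent
    (heig 0 (by omega)) hlog hgQ (h.unit (n + 1) (by omega)) (by rw [hQ0]; exact h.unit 0 (by omega))
    (by rw [hQ0]; exact hγ)
  exact ⟨z, hz.trans hgen, hz'⟩

end RankTwo

/-! ### Frescos and the Bernstein polynomial -/

section Fresco

/-- Contraction of the second factor by a linear form. -/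
def Xi.contract {L : Finset (Set.Ioc (0 : ℚ) 1)} {N : ℕ} {V : Type} [AddCommGroup V] [Module ℂ V]
    (ξ : V →ₗ[ℂ] ℂ) : Xi L N ⊗[ℂ] V →ₗ[ATilde] Xi L N where
  toFun w := TensorProduct.rid ℂ (Xi L N) (ξ.lTensor (Xi L N) w)
  map_add' x y := by rw [map_add, map_add]
  map_smul' u x := by
    induction x using TensorProduct.induction_on with
    | zero => simp
    | tmul x v =>
      rw [TensorProduct.smul_tmul', LinearMap.lTensor_tmul, LinearMap.lTensor_tmul,
        TensorProduct.rid_tmul, TensorProduct.rid_tmul, RingHom.id_apply, smul_comm]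
    | add x y hx hy => rw [smul_add, map_add, map_add, hx, hy, map_add, map_add, smul_add]

theorem Xi.contract_tmul {L : Finset (Set.Ioc (0 : ℚ) 1)} {N : ℕ} {V : Type} [AddCommGroup V]
    [Module ℂ V] (ξ : V →ₗ[ℂ] ℂ) (x : Xi L N) (v : V) : Xi.contract ξ (x ⊗ₜ v) = ξ v • x := by
  change TensorProduct.rid ℂ (Xi L N) (ξ.lTensor (Xi L N) (x ⊗ₜ v)) = _
  rw [LinearMap.lTensor_tmul, TensorProduct.rid_tmul]

theorem Xi.sum_contract_tmul {L : Finset (Set.Ioc (0 : ℚ) 1)} {N : ℕ} {V : Type} [AddCommGroup V]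
    [Module ℂ V] {m : ℕ} (B : Module.Basis (Fin m) ℂ V) (w : Xi L N ⊗[ℂ] V) :
    w = ∑ i, Xi.contract (B.coord i) w ⊗ₜ[ℂ] B i := by
  induction w using TensorProduct.induction_on with
  | zero => simp
  | tmul x v =>
    simp only [Xi.contract_tmul, TensorProduct.smul_tmul, ← TensorProduct.tmul_sum]
    rw [show ∑ i, B.coord i v • B i = v from B.sum_repr v]
  | add x y hx hy =>
    simp only [map_add, TensorProduct.add_tmul, Finset.sum_add_distrib]
    rw [← hx, ← hy]

variable {E : Type*} [AddCommGroup E] [Module ATilde E]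

theorem IsFresco.exists_injective (h : IsFresco E) :
    ∃ (L : Finset (Set.Ioc (0 : ℚ) 1)) (N m : ℕ) (f : E →ₗ[ATilde] (Fin m → Xi L N)),
      Function.Injective f := by
  obtain ⟨L, N, V, _, _, _, φ, ⟨ψ⟩⟩ := h
  let B := Module.finBasis ℂ V
  let f : Xi L N ⊗[ℂ] V →ₗ[ATilde] (Fin (Module.finrank ℂ V) → Xi L N) :=
    LinearMap.pi fun i => Xi.contract (B.coord i)
  have hf : Function.Injective f := by
    rw [injective_iff_map_eq_zero]
    intro w hw
    rw [Xi.sum_contract_tmul B w]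
    refine Finset.sum_eq_zero fun i _ => ?_
    rw [show Xi.contract (B.coord i) w = 0 from congrFun hw i, TensorProduct.zero_tmul]
  exact ⟨L, N, _, f ∘ₗ (Submodule.span ATilde {φ}).subtype ∘ₗ ψ.toLinearMap,
    hf.comp (Subtype.val_injective.comp ψ.injective)⟩

theorem IsFresco.torsionFree (h : IsFresco E) : TorsionFree E := by
  obtain ⟨L, N, m, f, hf⟩ := h.exists_injective
  exact TorsionFree.of_injective f hf fun x hx => funext fun i =>
    Xi.torsionFree (x i) (congrFun hx i)

theorem IsFresco.exists_generator (h : IsFresco E) :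
    ∃ g : E, Submodule.span ATilde {g} = ⊤ := by
  obtain ⟨L, N, V, _, _, _, φ, ⟨ψ⟩⟩ := h
  refine ⟨ψ.symm ⟨φ, Submodule.mem_span_singleton_self φ⟩, ?_⟩
  rw [eq_top_iff]
  intro z _
  obtain ⟨u, hu⟩ := Submodule.mem_span_singleton.mp (span_mk_eq_top φ ▸ Submodule.mem_top (x := ψ z))
  exact Submodule.mem_span_singleton.mpr ⟨u, by rw [← map_smul, hu, ψ.symm_apply_apply]⟩

theorem exists_lin_smul_eq {W : Type*} [AddCommGroup W] [Module ATilde W]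
    (hpole : ∀ x : W, ∃ y : W, a • x = b • y) (μ : ℂ) (x : W) :
    ∃ y : W, lin μ • x = (PowerSeries.X : PowerSeries ℂ) • y := by
  obtain ⟨y, hy⟩ := hpole x
  refine ⟨y - (PowerSeries.C μ : PowerSeries ℂ) • x, ?_⟩
  rw [lin_eq, sub_smul, hy, smul_sub, X_smul, mul_smul]
  change _ - (PowerSeries.C μ : PowerSeries ℂ) • b • x = _
  rw [← X_smul x, smul_comm]

/-- With a simple pole, every a - μ b maps W into b W. So each step down the chain gains one power
of b; for i = 0 this bounds the weight of f_0 from below. -/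
theorem IsChain.exists_eq_X_pow_smul {W : Type*} [AddCommGroup W] [Module ATilde W]
    (hpole : ∀ x : W, ∃ y : W, a • x = b • y) {m : ℕ} {l : ℕ → ℚ} {U : ℕ → PowerSeries ℂ}
    {f : ℕ → W} (h : IsChain (m + 1) l U f) (j i : ℕ) (hij : i + j = m) :
    ∃ w : W, f i = (PowerSeries.X ^ j : PowerSeries ℂ) • w := by
  induction j generalizing i with
  | zero => exact ⟨f i, by simp⟩
  | succ j ih =>
    obtain ⟨w, hw⟩ := ih (i + 1) (by omega)
    have h1 := h.succ i (by omega)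
    have h2 := lin_smul_X_pow_smul ((l (i + 1) : ℂ) - j) j w
    obtain ⟨y, hy⟩ := exists_lin_smul_eq hpole ((l (i + 1) : ℂ) - j) w
    rw [sub_add_cancel, ← hw, h1, hy, ← mul_smul, ← pow_succ] at h2
    refine ⟨(U i)⁻¹ • y, ?_⟩
    rw [smul_comm, ← h2, unit_inv_smul_smul (h.unit i (by omega))]

/-- The last exponent of a fresco is positive. -/
theorem IsFresco.chain_pos (hE : IsFresco E) {m : ℕ} {l : ℕ → ℚ} {U : ℕ → PowerSeries ℂ}
    {f : ℕ → E} (h : IsChain (m + 1) l U f) : 0 < l 0 - m := by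
  obtain ⟨L, N, r, ι, hι⟩ := hE.exists_injective
  have hch := h.map ι hι
  have hpole : ∀ x : Fin r → Xi L N, ∃ y : Fin r → Xi L N, a • x = b • y := by
    intro x
    choose y hy using fun i => Xi.exists_a_smul_eq (x i)
    exact ⟨y, funext hy⟩
  have htf : TorsionFree (Fin r → Xi L N) := fun x hx => funext fun i =>
    Xi.torsionFree (x i) (congrFun hx i)
  obtain ⟨w, hw⟩ := hch.exists_eq_X_pow_smul hpole m 0 (zero_add m)
  have hw0 : w ≠ 0 := by
    rintro rfl
    rw [smul_zero] at hw
    exact hch.indep.ne_zero (Nat.succ_pos m) hw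
  have h1 := hch.zero (Nat.succ_pos m)
  have h2 := lin_smul_X_pow_smul ((l 0 : ℂ) - m) m w
  rw [sub_add_cancel, ← hw, h1] at h2
  have h3 := htf.pow m h2.symm
  obtain ⟨i, hi⟩ := Function.ne_iff.mp hw0
  refine Xi.eigen_pos (x := w i) ?_ hi
  have := congrFun h3 i
  push_cast
  exact this

/-- A vector divisible by all powers of b has all its coordinates in a basis equal to zero, so the
powers of b dividing x are bounded. -/
theorem exists_eq_X_pow_smul_not_mem {M : Type*} [AddCommGroup M] [Module ATilde M]
    (hM : IsABModule M) {x : M} (hx : x ≠ 0) :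
    ∃ (n : ℕ) (w : M), x = (PowerSeries.X ^ n : PowerSeries ℂ) • w ∧ ¬ ∃ y : M, w = b • y := by
  classical
  obtain ⟨hfree, hfin⟩ := hM
  have hex : ∃ n : ℕ, ¬ ∃ w : M, x = (PowerSeries.X ^ n : PowerSeries ℂ) • w := by
    by_contra hall
    push Not at hall
    apply hx
    let B := Module.Free.chooseBasis (PowerSeries ℂ) M
    apply B.repr.injective
    ext i : 1
    rw [map_zero, Finsupp.zero_apply]
    refine PowerSeries.ext fun n => ?_
    obtain ⟨w, hw⟩ := hall (n + 1)
    rw [hw, map_smul, Finsupp.smul_apply, smul_eq_mul, PowerSeries.coeff_X_pow_mul', if_neg (by omega),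
      map_zero]
  have h1 := Nat.find_spec hex
  obtain ⟨n, hn⟩ : ∃ n, Nat.find hex = n + 1 := by
    refine Nat.exists_eq_succ_of_ne_zero fun h0 => ?_
    rw [h0] at h1
    exact h1 ⟨x, by simp⟩
  have h2 := Nat.find_min hex (m := n) (by omega)
  push Not at h2
  obtain ⟨w, hw⟩ := h2
  refine ⟨n, w, hw, ?_⟩
  rintro ⟨y, hy⟩
  rw [hn] at h1
  exact h1 ⟨y, by rw [hw, hy, ← X_smul, ← mul_smul, ← pow_succ]⟩

theorem cModule_smul {M : Type*} [AddCommGroup M] [Module ATilde M] (c : ℂ) (x : M) :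
    letI := cModule M
    c • x = (PowerSeries.C c : PowerSeries ℂ) • x :=
  congrArg (· • x) (algebraMap_eq c)

theorem finiteDimensional_quotient_bImage {M : Type*} [AddCommGroup M] [Module ATilde M]
    (hM : IsABModule M) :
    letI := cModule M
    FiniteDimensional ℂ (M ⧸ bImage M) := by
  let := cModule M
  obtain ⟨hfree, hfin⟩ := hM
  let B := Module.finBasis (PowerSeries ℂ) M
  refine Module.Finite.of_surjective
    (Fintype.linearCombination ℂ fun i => (bImage M).mkQ (B i)) fun t => ?_
  obtain ⟨x, rfl⟩ := (bImage M).mkQ_surjective t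
  refine ⟨fun i => PowerSeries.constantCoeff (B.repr x i), ?_⟩
  rw [Fintype.linearCombination_apply]
  simp only [← map_smul, ← map_sum]
  rw [← sub_eq_zero, ← map_sub, Submodule.mkQ_apply, Submodule.Quotient.mk_eq_zero]
  choose S hS using fun i => PowerSeries.X_dvd_iff.mpr
    (show PowerSeries.constantCoeff (PowerSeries.C (PowerSeries.constantCoeff (B.repr x i))
      - B.repr x i) = 0 by simp)
  refine ⟨∑ i, S i • B i, ?_⟩
  rw [← X_smul, Finset.smul_sum]
  refine (congrArg (_ - ·) (B.sum_repr x).symm).trans ?_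
  rw [← Finset.sum_sub_distrib]
  refine Finset.sum_congr rfl fun i _ => ?_
  rw [← mul_smul, ← hS, sub_smul, cModule_smul]

/-- In the saturation, dividing x by the largest possible power b^n gives a vector of weight μ - n
outside b M. Its class is an eigenvector of -b⁻¹a with eigenvalue -(μ - n), hence a root of the
Bernstein polynomial. -/
theorem IsLambdaPrimitive.eigenvalue {l : ℚ} (h : IsLambdaPrimitive l E) (μ : ℚ) (x : E)
    (hx0 : x ≠ 0) (hx : lin (μ : ℂ) • x = 0) : ∃ z : ℤ, μ = l + z := by
  obtain ⟨-, B, ⟨M, _, _, ι, ⟨⟨hM, -⟩, hι, -⟩, T, hT, rfl⟩, hB⟩ := h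
  let := cModule M
  have htf := torsionFree_of_isABModule hM
  obtain ⟨n, w, hw, hwb⟩ := exists_eq_X_pow_smul_not_mem hM
    (x := ι x) (fun h0 => hx0 (hι (by rw [h0, map_zero])))
  have h1 : lin ((μ : ℂ) - n) • w = 0 := by
    have h2 := lin_smul_X_pow_smul ((μ : ℂ) - n) n w
    rw [sub_add_cancel, ← hw, ← map_smul, hx, map_zero] at h2
    exact htf.pow n h2.symm
  have h2 : a • w = b • (((μ : ℂ) - n) • w) := by
    rw [cModule_smul, ← X_smul, smul_comm, X_smul]
    rw [lin_eq, sub_smul, mul_smul, sub_eq_zero] at h1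
    exact h1
  have h3 : Module.End.HasEigenvector T (-((μ : ℂ) - n)) ((bImage M).mkQ w) := by
    refine ⟨Module.End.mem_eigenspace_iff.mpr ?_, ?_⟩
    · rw [hT _ _ h2, map_smul, neg_smul]
    · rw [Submodule.mkQ_apply, Ne, Submodule.Quotient.mk_eq_zero]
      exact hwb
  have hfd := finiteDimensional_quotient_bImage hM
  have h4 := Module.End.isRoot_of_hasEigenvalue (Module.End.hasEigenvalue_of_hasEigenvector h3)
  obtain ⟨z, hz⟩ := hB _ ((Polynomial.mem_roots (minpoly.ne_zero (Algebra.IsIntegral.isIntegral T))).mpr h4)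
  refine ⟨n - z, ?_⟩
  have h5 : (μ : ℂ) = ((l + (n - z : ℤ) : ℚ) : ℂ) := by
    push_cast
    linear_combination -hz
  exact_mod_cast h5

end Fresco

/-! ### Existence of theme quotients of rank two -/

section Existence

namespace XiOne

variable {l : Set.Ioc (0 : ℚ) 1} {N : ℕ}

theorem lin_smul_eq (μ : ℂ) {x y : XiOne l N}
    (h : ∀ n, y n = ((n : ℂ) + ((l : ℚ) : ℂ) - μ) • x n + logDer N (x n)) :
    lin μ • x = b • y := by
  rw [lin_eq, sub_smul, mul_smul]
  change _ - (PowerSeries.C μ : PowerSeries ℂ) • b • x = _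
  rw [C_smul, a_smul, b_smul, b_smul]
  funext n
  cases n with
  | zero =>
    change (0 : Fin (N + 1) → ℂ) - μ • (0 : Fin (N + 1) → ℂ) = 0
    rw [smul_zero, sub_zero]
  | succ n =>
    change x n - μ • logPrim N ((n : ℂ) + ((l : ℚ) : ℂ)) (x n)
      = logPrim N ((n : ℂ) + ((l : ℚ) : ℂ)) (y n)
    rw [h, sub_smul, sub_add_eq_add_sub, map_sub, logPrim_apply_logDer, map_smul]

end XiOne

namespace Xi

/-- `s^(l - 1 + n) (log s)^j`. -/
def monomial (L : Finset (Set.Ioc (0 : ℚ) 1)) (N n : ℕ) (j : Fin (N + 1)) : Xi L N :=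
  fun _ => (Pi.single n (Pi.single j 1) : ℕ → Fin (N + 1) → ℂ)

theorem lin_smul_monomial_zero (l : Set.Ioc (0 : ℚ) 1) (n : ℕ) :
    lin ((n : ℂ) + ((l : ℚ) : ℂ)) • monomial {l} 1 n 0 = 0 := by
  funext l'
  have hl' : (l' : Set.Ioc (0 : ℚ) 1) = l := Finset.mem_singleton.mp l'.2
  refine (XiOne.lin_smul_eq (x := monomial {l} 1 n 0 l') (y := 0) _ fun m => ?_).trans
    (smul_zero _)
  rw [hl']
  change (0 : Fin 2 → ℂ) = _ • (Pi.single n (Pi.single 0 1) : ℕ → Fin 2 → ℂ) m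
    + logDer 1 ((Pi.single n (Pi.single 0 1) : ℕ → Fin 2 → ℂ) m)
  by_cases hm : m = n
  · subst hm
    rw [sub_self, zero_smul, zero_add]
    funext j
    fin_cases j <;> simp [logDer]
  · rw [Pi.single_eq_of_ne hm, smul_zero, map_zero, add_zero]

theorem lin_smul_monomial_one (l : Set.Ioc (0 : ℚ) 1) (n : ℕ) :
    lin ((n : ℂ) + ((l : ℚ) : ℂ)) • monomial {l} 1 n 1 = b • monomial {l} 1 n 0 := by
  funext l'
  have hl' : (l' : Set.Ioc (0 : ℚ) 1) = l := Finset.mem_singleton.mp l'.2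
  refine XiOne.lin_smul_eq (x := monomial {l} 1 n 1 l') (y := monomial {l} 1 n 0 l') _
    fun m => ?_
  rw [hl']
  change (Pi.single n (Pi.single 0 1) : ℕ → Fin 2 → ℂ) m
    = _ • (Pi.single n (Pi.single 1 1) : ℕ → Fin 2 → ℂ) m
    + logDer 1 ((Pi.single n (Pi.single 1 1) : ℕ → Fin 2 → ℂ) m)
  by_cases hm : m = n
  · subst hm
    rw [sub_self, zero_smul, zero_add]
    funext j
    fin_cases j <;> simp [logDer]
  · rw [Pi.single_eq_of_ne hm, Pi.single_eq_of_ne hm, smul_zero, map_zero, add_zero]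

theorem monomial_ne_zero (l : Set.Ioc (0 : ℚ) 1) (n : ℕ) (j : Fin 2) :
    monomial {l} 1 n j ≠ 0 := by
  intro h
  have h1 : (Pi.single n (Pi.single j 1) : ℕ → Fin 2 → ℂ) n j = 0 :=
    congrFun (congrFun (congrFun h ⟨l, Finset.mem_singleton_self l⟩) n) j
  simp at h1

end Xi

/-- A nontrivial Jordan block of `b⁻¹ a` is independent over `ℂ[[b]]`. -/
theorem log_pair_independent {W : Type*} [AddCommGroup W] [Module ATilde W] (htf : TorsionFree W)
    {μ : ℂ} {p : ℕ} {c : ℂ} (hc : c ≠ 0) {x w : W} (hx0 : x ≠ 0) (hx : lin μ • x = 0)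
    (hw : lin (μ + p) • w = (PowerSeries.C c * PowerSeries.X ^ (p + 1) : PowerSeries ℂ) • x)
    {S T : PowerSeries ℂ} (h : S • w + T • x = 0) : S = 0 ∧ T = 0 := by
  have hS : S = 0 := by
    by_contra hS
    obtain ⟨m, u, hu, rfl⟩ := exists_eq_X_pow_mul hS
    have h1 : (PowerSeries.X ^ m : PowerSeries ℂ) • w = (-(u⁻¹ * T)) • x := by
      rw [neg_smul, mul_smul, eq_neg_of_add_eq_zero_right h, smul_neg, neg_neg, mul_comm,
        mul_smul, unit_inv_smul_smul hu]
    have h2 := lin_smul_X_pow_smul (μ + p) m w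
    rw [hw, h1, lin_smul_smul_eigen hx, ← mul_smul, ← sub_eq_zero, ← sub_smul] at h2
    have h3 : PowerSeries.X * euler (μ - (μ + p + m)) (-(u⁻¹ * T))
        - PowerSeries.X ^ m * (PowerSeries.C c * PowerSeries.X ^ (p + 1)) = 0 := by
      by_contra hne
      exact hx0 (htf.smul_eq_zero hne h2)
    have h4 := congrArg (PowerSeries.coeff (m + p + 1)) h3
    rw [map_sub, PowerSeries.coeff_succ_X_mul, coeff_euler,
      show (PowerSeries.X ^ m * (PowerSeries.C c * PowerSeries.X ^ (p + 1)) : PowerSeries ℂ)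
        = PowerSeries.C c * PowerSeries.X ^ (m + p + 1) by ring,
      PowerSeries.coeff_C_mul_X_pow, if_pos rfl, map_zero] at h4
    apply hc
    push_cast at h4
    linear_combination -h4
  refine ⟨hS, ?_⟩
  by_contra hT
  rw [hS, zero_smul, zero_add] at h
  exact hx0 (htf.smul_eq_zero hT h)

theorem lin_smul_C_smul (μ s : ℂ) {W : Type*} [AddCommGroup W] [Module ATilde W] (x : W) :
    lin μ • (PowerSeries.C s : PowerSeries ℂ) • x = (PowerSeries.C s : PowerSeries ℂ) • lin μ • x := by
  rw [lin_smul_smul (z := lin μ • x) rfl, sub_self]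
  simp [euler]

theorem Xi.exists_log_pair {μ : ℚ} (hμ : 0 < μ) (p : ℕ) (c : ℂ) :
    ∃ (l : Set.Ioc (0 : ℚ) 1) (x w : Xi {l} 1), x ≠ 0 ∧ lin (μ : ℂ) • x = 0 ∧
      lin ((μ : ℂ) + p) • w = (PowerSeries.C c * PowerSeries.X ^ (p + 1) : PowerSeries ℂ) • x := by
  have h1 := Nat.ceil_lt_add_one hμ.le
  have h2 := Nat.le_ceil μ
  obtain ⟨n, hn⟩ := Nat.exists_eq_succ_of_ne_zero (Nat.ceil_pos.mpr hμ).ne'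
  rw [hn] at h1 h2
  push_cast at h1 h2
  -- Here n = ⌈μ⌉ - 1, the choice that puts μ - n in ]0,1]. The vectors are s^(μ-1) and a multiple
  -- of s^(μ+p-1) log s; the constant c' below, defined by s^(μ+p-1) = c' b^p s^(μ-1), fixes that
  -- multiple.
  let l : Set.Ioc (0 : ℚ) 1 := ⟨μ - n, by linarith, by linarith⟩
  have hl : ∀ m : ℕ, ((m : ℂ) + ((l : ℚ) : ℂ)) = (((m : ℚ) + (μ - n) : ℚ) : ℂ) := by
    intro m
    rw [Rat.cast_add, Rat.cast_natCast]
  have e0 := Xi.lin_smul_monomial_zero l n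
  have e1 := Xi.lin_smul_monomial_zero l (n + p)
  have e2 := Xi.lin_smul_monomial_one l (n + p)
  rw [hl] at e0 e1 e2
  obtain ⟨c', hc'⟩ := Xi.simpleEigen.exists_monomial Xi.torsionFree (d := p)
    (by push_cast; ring) (Xi.monomial_ne_zero l n 0) e0 e1
  have hc0 : c' ≠ 0 := by
    rintro rfl
    rw [map_zero, zero_mul, zero_smul] at hc'
    exact Xi.monomial_ne_zero l (n + p) 0 hc'
  refine ⟨l, Xi.monomial {l} 1 n 0,
    (PowerSeries.C (c / c') : PowerSeries ℂ) • Xi.monomial {l} 1 (n + p) 1,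
    Xi.monomial_ne_zero l n 0, ?_, ?_⟩
  · rw [← e0]; congr 2; push_cast; ring
  · have e3 : ((μ : ℂ) + p) = ((((n + p : ℕ) : ℚ) + (μ - n) : ℚ) : ℂ) := by push_cast; ring
    rw [lin_smul_C_smul, e3, e2, ← X_smul, hc', ← mul_smul, ← mul_smul]
    congr 1
    have e4 : (PowerSeries.C c : PowerSeries ℂ) = PowerSeries.C (c / c') * PowerSeries.C c' := by
      rw [← map_mul, div_mul_cancel₀ _ hc0]
    rw [e4]
    ring

theorem abRank_congr {T T' : Type*} [AddCommGroup T] [Module ATilde T] [AddCommGroup T']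
    [Module ATilde T'] (ψ : T ≃ₗ[ATilde] T') : abRank T = abRank T' :=
  LinearEquiv.finrank_eq (R := PowerSeries ℂ)
    { ψ.toAddEquiv with map_smul' := fun S x => map_ps_smul ψ.toLinearMap S x }

theorem abRank_eq_two {T : Type*} [AddCommGroup T] [Module ATilde T] {μ ν : ℂ} {V : PowerSeries ℂ}
    (hV : PowerSeries.constantCoeff V ≠ 0) {z : T} (hz : Submodule.span ATilde {z} = ⊤)
    (hPz : rankTwoElt μ V ν • z = 0)
    (hind : ∀ S S' : PowerSeries ℂ, S • z + S' • lin ν • z = 0 → S = 0 ∧ S' = 0) :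
    abRank T = 2 :=
  (Module.finrank_eq_card_basis (Module.Basis.mk (LinearIndependent.pair_iff.mpr hind)
    (span_pair_eq_top hV hz hPz))).trans (Fintype.card_fin 2)

variable {E : Type*} [AddCommGroup E] [Module ATilde E]

/-- A map from a generator of `E` to `θ` which respects the relations defines a theme quotient. -/
theorem exists_theme_quotient {g : E} (hg : Submodule.span ATilde {g} = ⊤)
    {L : Finset (Set.Ioc (0 : ℚ) 1)} {N : ℕ} {θ : Xi L N}
    (hker : ∀ u : ATilde, u • g = 0 → u • θ = 0) :
    ∃ H : Submodule ATilde E, IsTheme (E ⧸ H) ∧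
      Nonempty ((E ⧸ H) ≃ₗ[ATilde] Submodule.span ATilde {θ}) := by
  let f := LinearMap.toSpanSingleton ATilde E g
  let h := LinearMap.toSpanSingleton ATilde (Xi L N) θ
  have hf : Function.Surjective f := fun x =>
    Submodule.mem_span_singleton.mp (hg ▸ (Submodule.mem_top (x := x)))
  let ψ : E →ₗ[ATilde] Xi L N :=
    (LinearMap.ker f).liftQ h (fun u hu => hker u hu) ∘ₗ (f.quotKerEquivOfSurjective hf).symm
  have hψ : ∀ u : ATilde, ψ (u • g) = u • θ := by
    intro u
    have e : (f.quotKerEquivOfSurjective hf).symm (u • g) = Submodule.Quotient.mk u := by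
      rw [LinearEquiv.symm_apply_eq]
      rfl
    change (LinearMap.ker f).liftQ h (fun u hu => hker u hu) ((f.quotKerEquivOfSurjective hf).symm (u • g)) = _
    rw [e]
    rfl
  have hrange : LinearMap.range ψ = Submodule.span ATilde {θ} := by
    ext t
    rw [LinearMap.mem_range, Submodule.mem_span_singleton]
    constructor
    · rintro ⟨x, rfl⟩
      obtain ⟨u, rfl⟩ := hf x
      exact ⟨u, (hψ u).symm⟩
    · rintro ⟨u, rfl⟩
      exact ⟨u • g, hψ u⟩
  let Φ := ψ.quotKerEquivRange.trans (LinearEquiv.ofEq _ _ hrange)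
  exact ⟨LinearMap.ker ψ, ⟨L, N, θ, ⟨Φ⟩⟩, ⟨Φ⟩⟩

/-- Relations between eigenvectors and a Jordan block carry over from a normal form. -/
theorem IsNormalForm.smul_eq_zero_of_relations {W : Type*} [AddCommGroup W] [Module ATilde W]
    (htf : TorsionFree W) {n : ℕ} {e : ℕ → ℚ} {p : ℕ} {c : ℂ} {M : ℕ}
    {y : ℕ → E} {R : ℕ → PowerSeries ℂ} {g : E} (h : IsNormalForm n e p c M y R g)
    {x w θ : W} (hx : lin ((e 0 + M : ℚ) : ℂ) • x = 0)
    (hw : lin ((e (n + 1) + M : ℚ) : ℂ) • w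
      = (PowerSeries.C c * PowerSeries.X ^ (p + 1) : PowerSeries ℂ) • x)
    (hθ : (PowerSeries.X ^ M : PowerSeries ℂ) • θ = R (n + 1) • w + R 0 • x) {u : ATilde}
    (hu : u • g = 0) : u • θ = 0 := by
  -- The pairs (y_i, q_i) give a normal form of (g, θ) in E × W with the same coefficients R_i.
  -- Hence u acts on g and on θ through the same series T_i, and u g = 0 makes them all vanish.
  let q : ℕ → W := fun i => if i = 0 then x else if i = n + 1 then w else 0
  have hq0 : q 0 = x := if_pos rfl
  have hq1 : q (n + 1) = w := (if_neg (by omega)).trans (if_pos rfl)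
  have hq : ∀ i, i < n → q (i + 1) = 0 := fun i hi =>
    (if_neg (by omega)).trans (if_neg (by omega))
  have hNF : IsNormalForm n e p c M (fun i => ((y i, q i) : E × W)) R ((g, θ) : E × W) := by
    refine ⟨h.strict, h.exponent, ?_, ?_, ?_, ?_, h.unit⟩
    · intro S hS
      have := congrArg Prod.fst hS
      rw [Prod.fst_sum] at this
      exact h.indep S this
    · intro i hi
      refine Prod.ext (h.eigen i hi) ?_
      change lin ((e i + M : ℚ) : ℂ) • q i = 0
      rcases i with _ | i
      · rw [hq0, hx]
      · rw [hq i (by omega), smul_zero]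
    · refine Prod.ext h.log ?_
      change lin ((e (n + 1) + M : ℚ) : ℂ) • q (n + 1)
        = (PowerSeries.C c * PowerSeries.X ^ (p + 1) : PowerSeries ℂ) • q 0
      rw [hq0, hq1, hw]
    · refine Prod.ext (by rw [Prod.fst_sum]; exact h.eq) ?_
      rw [Prod.snd_sum]
      change (PowerSeries.X ^ M : PowerSeries ℂ) • θ = ∑ i ∈ Finset.range (n + 2), R i • q i
      rw [Finset.sum_range_succ, Finset.sum_range_succ', Finset.sum_eq_zero, zero_add, hq0, hq1,
        hθ, add_comm]
      intro i hi
      rw [hq i (Finset.mem_range.mp hi), smul_zero]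
  obtain ⟨T, hT, -⟩ := hNF.exists_smul_eq u
  have h1 := congrArg Prod.fst hT
  rw [Prod.fst_sum] at h1
  have h2 : ∑ i ∈ Finset.range (n + 2), T i • y i = 0 := by
    refine Eq.trans h1.symm ?_
    change (PowerSeries.X ^ M : PowerSeries ℂ) • u • g = 0
    rw [hu, smul_zero]
  have h3 := h.indep T h2
  refine htf.pow M ?_
  change ((PowerSeries.X ^ M : PowerSeries ℂ) • u • ((g, θ) : E × W)).2 = 0
  rw [hT, Finset.sum_eq_zero]
  · rfl
  · intro i hi
    rw [h3 i (Finset.mem_range.mp hi), zero_smul]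

/-- The target is the theme generated by R_{n+1} w + R_0 x, with x a power of s and w logarithmic.
Positivity of e_0 makes these available in Ξ, and c ≠ 0 makes x and w independent over ℂ[[b]]. -/
theorem IsNormalForm.exists_theme_quotient {n : ℕ} {e : ℕ → ℚ} {p : ℕ} {c : ℂ} {M : ℕ}
    {y : ℕ → E} {R : ℕ → PowerSeries ℂ} {g : E} (h : IsNormalForm n e p c M y R g)
    (hg : Submodule.span ATilde {g} = ⊤) (hc : c ≠ 0) (he : 0 < e 0) :
    ∃ H : Submodule ATilde E, IsTheme (E ⧸ H) ∧ abRank (E ⧸ H) = 2 := by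
  obtain ⟨l, x, w, hx0, hx, hw⟩ := Xi.exists_log_pair he p c
  have hexp : (e 0 : ℂ) + p = e (n + 1) := by
    have := h.exponent
    have h1 : e 0 + p = e (n + 1) := by linarith
    exact_mod_cast h1
  set θ : Xi {l} 1 := R (n + 1) • w + R 0 • x with hθ
  have hker : ∀ u : ATilde, u • g = 0 → u • θ = 0 := by
    refine fun u => h.smul_eq_zero_of_relations Xi.torsionFree (x := (PowerSeries.X ^ M : PowerSeries ℂ) • x)
      (w := (PowerSeries.X ^ M : PowerSeries ℂ) • w) ?_ ?_ ?_
    · have := lin_smul_X_pow_smul (e 0 : ℂ) M x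
      rw [hx, smul_zero] at this
      push_cast
      exact this
    · rw [smul_comm (PowerSeries.C c * PowerSeries.X ^ (p + 1) : PowerSeries ℂ), ← hw, hexp, ← lin_smul_X_pow_smul]
      push_cast
      rfl
    · rw [hθ, smul_add, smul_comm _ (R 0), smul_comm _ (R (n + 1))]
  obtain ⟨H, hH, ⟨Φ⟩⟩ := ABTheory.exists_theme_quotient hg hker
  refine ⟨H, hH, (abRank_congr Φ).trans ?_⟩
  have hS := h.unit (n + 1) (by omega)
  have hQ := h.unit 0 (by omega)
  obtain ⟨z, hz, hzy, hPz⟩ := exists_generator_rankTwoElt (Xi.torsionFree (L := {l}) (N := 1))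
    (ε := e 0) (ν := e (n + 1)) (M := 0) (y₀ := x) (y₁ := w) (g := θ) (S := R (n + 1)) (Q := R 0)
    (γ := c * PowerSeries.constantCoeff (R (n + 1)) / PowerSeries.constantCoeff (R 0)) (c := c)
    h.exponent_pos h.exponent (by simpa using hx)
    (by rw [Nat.cast_zero, add_zero, ← hexp, hw]) (by rw [pow_zero, one_smul]) hS hQ
    (by rw [div_mul_cancel₀ _ hQ])
  rw [← hz]
  rw [pow_zero, one_smul] at hzy
  refine abRank_eq_two (z := ⟨z, Submodule.mem_span_singleton_self z⟩) ?_ (span_mk_eq_top z)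
    (Subtype.ext hPz) fun S S' hSS => ?_
  · simp [h.exponent_pos.ne']
  · have h1 : S • z + S' • lin (e (n + 1) : ℂ) • z = 0 := congrArg Subtype.val hSS
    have h2 : lin (e (n + 1) : ℂ) • z = (PowerSeries.X * (PowerSeries.C c * PowerSeries.X ^ p
        - PowerSeries.C (p * (PowerSeries.constantCoeff (R 0)
          / PowerSeries.constantCoeff (R (n + 1)))))) • x := by
      rw [hzy, smul_add, ← hexp, hw, lin_smul_smul_eigen hx, ← add_smul]
      congr 1
      rw [euler]
      simp
      ring
    rw [h2, hzy, smul_add, ← mul_smul, ← mul_smul, add_assoc, ← add_smul] at h1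
    obtain ⟨h3, h4⟩ := log_pair_independent Xi.torsionFree hc hx0 hx hw h1
    refine ⟨h3, ?_⟩
    rw [h3, zero_mul, zero_add, mul_eq_zero] at h4
    refine h4.resolve_right (mul_ne_zero PowerSeries.X_ne_zero fun h5 => ?_)
    have h6 := congrArg PowerSeries.constantCoeff h5
    have hp := h.exponent_pos
    simp [hp.ne', hQ, hS] at h6

end Existence

/-! ### Theme quotients of rank two -/

section Main

/-- Primitivity makes the difference an integer and the principal order makes it nonnegative, so the
floor in `pInv` loses nothing. -/
theorem pInv_eq {lam : ℕ → ℚ} {j : ℕ} {l₀ : ℚ} (h1 : ∃ z : ℤ, lam j = l₀ + z)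
    (h2 : ∃ z : ℤ, lam (j + 1) = l₀ + z) (h : lam j ≤ lam (j + 1) + 1) :
    (pInv lam j : ℚ) = lam (j + 1) - lam j + 1 := by
  obtain ⟨z, hz⟩ := h1
  obtain ⟨w, hw⟩ := h2
  have e : lam (j + 1) - lam j + 1 = ((w - z + 1 : ℤ) : ℚ) := by
    rw [hz, hw]; push_cast; ring
  have hnn : (0 : ℤ) ≤ w - z + 1 := by
    have : (0 : ℚ) ≤ ((w - z + 1 : ℤ) : ℚ) := by rw [← e]; linarith
    exact_mod_cast this
  obtain ⟨d, hd⟩ := Int.eq_ofNat_of_zero_le hnn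
  rw [pInv, e, hd, Int.cast_natCast, Nat.floor_natCast]

theorem sum_pInv_eq {lam e : ℕ → ℚ} {n : ℕ}
    (h : ∀ i < n + 1, (pInv lam (i + 1) : ℚ) = e (i + 1) - e i) (i j : ℕ) (hij : i ≤ j)
    (hj : j ≤ n + 1) : ((∑ m ∈ Finset.Icc (i + 1) j, pInv lam m : ℕ) : ℚ) = e j - e i := by
  induction j, hij using Nat.le_induction with
  | base => simp
  | succ j hij ih =>
    rw [Finset.sum_Icc_succ_top (by omega), Nat.cast_add, ih (by omega), h j (by omega)]
    ring

/-- The partial sums of the p_j telescope to e_j - e_0 in the numerator and e_{n+1} - e_j in the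
denominator. Replacing each e_0 - e_j by its opposite produces (-1)^n = (-1)^(n+2). -/
theorem betaInv_eq {lam e : ℕ → ℚ} {n : ℕ} (hs : ∀ i j, i < j → j < n + 2 → e i < e j)
    (h : ∀ i < n + 1, (pInv lam (i + 1) : ℚ) = e (i + 1) - e i) {p : ℕ}
    (hp : (p : ℚ) = e (n + 1) - e 0) {α γ : ℂ}
    (hγ : γ * ∏ j ∈ Finset.Icc 1 n, (((e (n + 1) - e j) / (e 0 - e j) : ℚ) : ℂ) = -(α * p)) :
    betaInv (n + 2) lam α = -γ / p := by
  have hsum := sum_pInv_eq h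
  have hp0 : (p : ℂ) ≠ 0 := by
    have h1 := hs 0 (n + 1) (by omega) (by omega)
    have h2 : (p : ℚ) ≠ 0 := by rw [hp]; linarith
    exact_mod_cast h2
  have e1 : ∏ j ∈ Finset.Icc 1 n, ((∑ i ∈ Finset.Icc 1 j, pInv lam i : ℕ) : ℂ)
      = ∏ j ∈ Finset.Icc 1 n, ((e j - e 0 : ℚ) : ℂ) := by
    refine Finset.prod_congr rfl fun j hj => ?_
    have := Finset.mem_Icc.mp hj
    rw [← hsum 0 j (by omega) (by omega), Rat.cast_natCast]
  have e2 : ∏ j ∈ Finset.Icc 2 (n + 1), ((∑ i ∈ Finset.Icc j (n + 1), pInv lam i : ℕ) : ℂ)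
      = ∏ j ∈ Finset.Icc 1 n, ((e (n + 1) - e j : ℚ) : ℂ) := by
    symm
    refine Finset.prod_bij (fun j _ => j + 1) ?_ ?_ ?_ ?_
    · intro j hj
      have := Finset.mem_Icc.mp hj
      exact Finset.mem_Icc.mpr (by omega)
    · intro i _ j _ hij
      omega
    · intro j hj
      have := Finset.mem_Icc.mp hj
      exact ⟨j - 1, Finset.mem_Icc.mpr (by omega), by omega⟩
    · intro j hj
      have := Finset.mem_Icc.mp hj
      rw [← hsum j (n + 1) (by omega) (by omega), Rat.cast_natCast]
  have e3 : ∏ j ∈ Finset.Icc 1 n, ((e (n + 1) - e j : ℚ) : ℂ)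
      = (∏ j ∈ Finset.Icc 1 n, (((e (n + 1) - e j) / (e 0 - e j) : ℚ) : ℂ))
        * ((-1) ^ n * ∏ j ∈ Finset.Icc 1 n, ((e j - e 0 : ℚ) : ℂ)) := by
    have e4 : ((-1 : ℂ)) ^ n = ∏ j ∈ Finset.Icc 1 n, (-1 : ℂ) := by simp
    rw [e4, ← Finset.prod_mul_distrib, ← Finset.prod_mul_distrib]
    refine Finset.prod_congr rfl fun j hj => ?_
    have := Finset.mem_Icc.mp hj
    have h1 : ((e 0 - e j : ℚ) : ℂ) ≠ 0 := by
      have := hs 0 j (by omega) (by omega)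
      exact_mod_cast (by linarith : e 0 - e j < 0).ne
    rw [Rat.cast_div, div_mul_eq_mul_div, eq_div_iff h1]
    push_cast
    ring
  have h1 : ∏ j ∈ Finset.Icc 1 n, ((e (n + 1) - e j : ℚ) : ℂ) ≠ 0 := by
    refine Finset.prod_ne_zero_iff.mpr fun j hj => ?_
    have := Finset.mem_Icc.mp hj
    have := hs j (n + 1) (by omega) (by omega)
    exact_mod_cast (by linarith : 0 < e (n + 1) - e j).ne'
  rw [betaInv]
  change (-1) ^ (n + 2) * ((∏ j ∈ Finset.Icc 1 n, _) / ∏ j ∈ Finset.Icc 2 (n + 1), _) * α = _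
  rw [e1]
  change (-1) ^ (n + 2) * (_ / ∏ j ∈ Finset.Icc 2 (n + 1),
    ((∑ i ∈ Finset.Icc j (n + 1), pInv lam i : ℕ) : ℂ)) * α = _
  rw [e2, eq_div_iff hp0, mul_div_assoc', div_mul_eq_mul_div, div_mul_eq_mul_div, div_eq_iff h1]
  rw [e3, pow_add]
  linear_combination ((-1) ^ n * ∏ j ∈ Finset.Icc 1 n, ((e j - e 0 : ℚ) : ℂ)) * hγ

variable {E : Type*} [AddCommGroup E] [Module ATilde E]

/-- The case `p_1 = 0` in rank two. -/
theorem IsPrincipalJH.rank_two_degenerate (hE : IsFresco E) {lam : ℕ → ℚ}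
    {F : ℕ → Submodule ATilde E} (hF : IsPrincipalJH 2 lam F) (hlam : lam 2 = lam 1 - 1) {α : ℂ}
    (hα : IsAlphaInvariant 2 E α) :
    α = 1 ∧ (∃ H : Submodule ATilde E, IsTheme (E ⧸ H) ∧ abRank (E ⧸ H) = 2) ∧
    ∃ z : E, Submodule.span ATilde {z} = ⊤ ∧
      rankTwoElt (lam 1) (1 + PowerSeries.C 1 * PowerSeries.X ^ 0) (lam 2) • z = 0 := by
  have htf := hE.torsionFree
  obtain ⟨g, hg⟩ := hE.exists_generator
  obtain ⟨U, f, hch, ⟨S₀, hS₀, hgS⟩, hsp⟩ := hF.exists_isChain hg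
  have hf0 : lin (lam 1 : ℂ) • f 0 = 0 := hch.zero (by omega)
  have hf1 : lin (lam 2 : ℂ) • f 1 = U 0 • f 0 := hch.succ 0 (by omega)
  have hU : PowerSeries.constantCoeff (U 0) ≠ 0 := hch.unit 0 (by omega)
  set c := PowerSeries.constantCoeff (U 0) with hc
  have hCc : PowerSeries.constantCoeff (PowerSeries.C c : PowerSeries ℂ) ≠ 0 := by simpa using hU
  have hlam' : (lam 2 : ℂ) = lam 1 - 1 := by rw [hlam]; push_cast; ring
  -- Here the weights of f_0 and f_1 differ by 1 and the operator b d/db + 1 has no resonance, so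
  -- all nonconstant terms of U_0 can be removed.
  obtain ⟨Q, hQ⟩ : ∃ Q : PowerSeries ℂ, U 0 + PowerSeries.X * euler 1 Q = PowerSeries.C c := by
    refine ⟨PowerSeries.mk fun n => -(PowerSeries.coeff (n + 1) (U 0)) / (n + 1), ?_⟩
    refine PowerSeries.ext fun n => ?_
    rcases n with _ | n
    · simp [hc]
    · have : (n : ℂ) + 1 ≠ 0 := by exact_mod_cast Nat.succ_ne_zero n
      rw [map_add, PowerSeries.coeff_succ_X_mul, coeff_euler, PowerSeries.coeff_mk,
        PowerSeries.coeff_C, if_neg (by omega), mul_div_cancel₀ _ this, add_neg_cancel]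
  set z := f 1 + Q • f 0 with hz
  have hlz : lin (lam 2 : ℂ) • z = (PowerSeries.C c : PowerSeries ℂ) • f 0 := by
    rw [hz, smul_add, hf1, lin_smul_smul_eigen hf0, ← add_smul, ← hQ, hlam', sub_sub_cancel]
  have hPz : rankTwoElt (lam 1) (1 + PowerSeries.C 1 * PowerSeries.X ^ 0) (lam 2) • z = 0 := by
    rw [rankTwoElt_one, smul_eq, mul_smul, mul_smul (lin _), hlz, lin_smul_C_smul, hf0, smul_zero,
      smul_zero]
  have hV : PowerSeries.constantCoeff
      (1 + PowerSeries.C 1 * PowerSeries.X ^ 0 : PowerSeries ℂ) ≠ 0 := by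
    simp
  have hztop : Submodule.span ATilde {z} = ⊤ := by
    have h0 : f 0 ∈ Submodule.span ATilde {z} := by
      rw [← unit_inv_smul_smul hCc (f 0), ← hlz]
      exact ps_smul_mem _ (Submodule.smul_mem _ _ (Submodule.mem_span_singleton_self z))
    have h1 : f 1 ∈ Submodule.span ATilde {z} := by
      rw [show f 1 = z - Q • f 0 by rw [hz, add_sub_cancel_right]]
      exact Submodule.sub_mem _ (Submodule.mem_span_singleton_self z) (ps_smul_mem _ h0)
    rw [eq_top_iff, ← hg, Submodule.span_singleton_le_iff_mem, hgS]
    exact ps_smul_mem _ h1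
  have hind : ∀ S S' : PowerSeries ℂ, S • z + S' • lin (lam 2 : ℂ) • z = 0 → S = 0 ∧ S' = 0 := by
    intro S S' h
    have h1 : ∑ i ∈ Finset.range 2, (fun i => if i = 0 then S * Q + S' * PowerSeries.C c else S) i
        • f i = 0 := by
      rw [Finset.sum_range_succ, Finset.sum_range_one]
      change (S * Q + S' * PowerSeries.C c) • f 0 + S • f 1 = 0
      rw [← h, hlz, hz, add_smul, mul_smul, mul_smul, smul_add]
      abel
    have h2 := hch.indep _ h1
    have h3 : S = 0 := h2 1 (by omega)
    have h4 : S * Q + S' * PowerSeries.C c = 0 := h2 0 (by omega)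
    refine ⟨h3, ?_⟩
    rw [h3, zero_mul, zero_add, mul_eq_zero] at h4
    exact h4.resolve_right fun h5 => hCc (by rw [h5, map_zero])
  have hrank : abRank E = 2 := abRank_eq_two hV hztop hPz hind
  refine ⟨?_, ?_, z, hztop, hPz⟩
  -- A presentation with q ≥ 1 would give an adapted basis with strictly increasing l_i + i. By
  -- uniqueness its weights would be λ_1 and λ_2 = λ_1 - 1, which forces q = 0.
  · obtain ⟨l₁, q, x, hq, hx, hPx⟩ := exists_generator_of_isAlphaInvariant_two hα
    refine hq ?_
    by_contra hq0
    set V : PowerSeries ℂ := 1 + PowerSeries.C α * PowerSeries.X ^ q with hVdef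
    have hV1 : PowerSeries.constantCoeff V ≠ 0 := by simp [hVdef, hq0]
    have hli : LinearIndependent (PowerSeries ℂ) ![x, lin ((l₁ : ℂ) + q - 1) • x] :=
      linearIndependent_of_top_le_span_of_card_eq_finrank (span_pair_eq_top hV1 hx hPx)
        (by rw [Fintype.card_fin]; exact hrank.symm)
    have hspan := span_pair_eq_top hV1 hx hPx
    have hcast : (((l₁ + q - 1 : ℚ)) : ℂ) = (l₁ : ℂ) + q - 1 := by push_cast; ring
    let f' : ℕ → E := fun i => if i = 0 then V⁻¹ • lin ((l₁ : ℂ) + q - 1) • x else x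
    have hch' : IsChain 2 (fun i => if i = 0 then l₁ else l₁ + q - 1) (fun _ => V) f' := by
      refine ⟨fun _ => ?_, fun i hi => ?_, fun _ _ => hV1, fun S hS => ?_⟩
      · rw [rankTwoElt, mul_smul, mul_smul] at hPx
        exact hPx
      · obtain rfl : i = 0 := by omega
        change lin (((l₁ + q - 1 : ℚ)) : ℂ) • x = V • V⁻¹ • lin ((l₁ : ℂ) + q - 1) • x
        rw [unit_smul_smul hV1, hcast]
      · rw [Finset.sum_range_succ, Finset.sum_range_one] at hS
        have h1 := LinearIndependent.pair_iff.mp hli (S 1) (S 0 * V⁻¹) (by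
          rw [mul_smul, add_comm]; exact hS)
        have h2 : S 0 = 0 := by
          refine (mul_eq_zero.mp h1.2).resolve_right fun h3 => ?_
          have := PowerSeries.mul_inv_cancel V hV1
          rw [h3, mul_zero] at this
          exact zero_ne_one this
        intro i hi
        interval_cases i
        · exact h2
        · exact h1.1
    have hall : ∀ t, PSSpan 2 f' t := by
      intro t
      have h1 := hspan (Submodule.mem_top (x := t))
      rw [Matrix.range_cons, Matrix.range_cons, Matrix.range_empty, Set.union_empty,
        Set.singleton_union, Submodule.mem_span_pair] at h1
      obtain ⟨S, S', rfl⟩ := h1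
      refine PSSpan.add ((PSSpan.self f' (i := 1) (by omega)).smul S) ?_
      have := (PSSpan.self f' (k := 2) (i := 0) (by omega)).smul (S' * V)
      rw [mul_smul] at this
      change PSSpan 2 f' (S' • V • V⁻¹ • lin ((l₁ : ℂ) + q - 1) • x) at this
      rwa [unit_smul_smul hV1] at this
    have huniq := (hch'.unique hch (fun t => ⟨fun _ => (hsp 2 le_rfl t).mp (by
        rw [hF.top]; trivial), fun _ => hall t⟩) (fun i j hij hj => ?_)
      (fun i j hij hj => hF.monotone i j hij hj) 2 le_rfl).1
    · have h1 : l₁ = lam 1 := huniq 0 (by omega)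
      have h2 : l₁ + q - 1 = lam 2 := huniq 1 (by omega)
      have h3 : (q : ℚ) = 0 := by linarith
      exact hq0 (by exact_mod_cast h3)
    · obtain rfl : i = 0 := by omega
      obtain rfl : j = 1 := by omega
      have : (0 : ℚ) < q := by exact_mod_cast Nat.pos_of_ne_zero hq0
      change l₁ + (0 : ℕ) < l₁ + q - 1 + (1 : ℕ)
      push_cast
      linarith
  · have hpos : 0 < lam 2 := by
      have := hE.chain_pos hch
      rw [hlam]
      simpa using this
    -- w is a multiple of s^(λ_2-1) log s: a - λ_2 b sends it to b x, which a - λ_1 b kills since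
    -- λ_1 = λ_2 + 1.
    obtain ⟨l, x, w, hx0, hx, hw⟩ := Xi.exists_log_pair hpos 0 1
    have hw' : lin (lam 2 : ℂ) • w = (PowerSeries.C 1 * PowerSeries.X ^ (0 + 1) : PowerSeries ℂ) • x := by
      rw [← hw, Nat.cast_zero, add_zero]
    have hPw : rankTwoElt (lam 1) (1 + PowerSeries.C 1 * PowerSeries.X ^ 0) (lam 2) • w = 0 := by
      have h1 := lin_smul_X_pow_smul (lam 2 : ℂ) 1 x
      rw [hx, smul_zero, hlam', Nat.cast_one, sub_add_cancel] at h1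
      rw [rankTwoElt_one, smul_eq, mul_smul, mul_smul (lin _), hw', map_one, one_mul, zero_add, h1,
        smul_zero]
    obtain ⟨H, hH, ⟨Φ⟩⟩ := exists_theme_quotient hztop (θ := w) fun u hu => by
      obtain ⟨q, S, S', rfl⟩ := exists_mul_rankTwoElt_add (lam 1 : ℂ) (lam 2 : ℂ) hV u
      rw [add_smul, mul_smul, hPz, smul_zero, zero_add, add_smul, mul_smul] at hu
      obtain ⟨h1, h2⟩ := hind S S' (by rw [add_comm]; exact hu)
      rw [h1, h2, map_zero, zero_mul, zero_add, add_zero, mul_smul, hPw, smul_zero]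
    refine ⟨H, hH, (abRank_congr Φ).trans ?_⟩
    refine abRank_eq_two (z := ⟨w, Submodule.mem_span_singleton_self w⟩) hV (span_mk_eq_top w)
      (Subtype.ext hPw) fun S S' hSS => ?_
    have h1 : S • w + S' • lin (lam 2 : ℂ) • w = 0 := congrArg Subtype.val hSS
    rw [hw', ← mul_smul] at h1
    obtain ⟨h2, h3⟩ := log_pair_independent Xi.torsionFree one_ne_zero hx0 hx hw h1
    refine ⟨h2, (mul_eq_zero.mp h3).resolve_right ?_⟩
    rw [map_one, one_mul, zero_add, pow_one]
    exact PowerSeries.X_ne_zero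

theorem span_mkQ_eq_top {g : E} (hg : Submodule.span ATilde {g} = ⊤) (H : Submodule ATilde E) :
    Submodule.span ATilde {H.mkQ g} = ⊤ := by
  rw [← Set.image_singleton, ← Submodule.map_span, hg, Submodule.map_top, Submodule.range_mkQ]

end Main

end ABTheory

end

/-! ### Conclusion: existence and shape of the rank two theme quotients -/

theorem mainTheorem8 {E : Type*} [AddCommGroup E] [Module ATilde E]
    (l : ℚ) (hl : l ∈ Set.Ioc (0 : ℚ) 1) (k : ℕ) (hk : 2 ≤ k)
    (hE : IsFresco E) (hprim : IsLambdaPrimitive l E)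
    (lam : ℕ → ℚ) (F : ℕ → Submodule ATilde E) (hF : IsPrincipalJH k lam F)
    (hss : IsSemisimple (F (k - 1))) (hss' : IsSemisimple (E ⧸ F 1))
    (α : ℂ) (hα : IsAlphaInvariant k E α) (hα0 : α ≠ 0) :
    (∃ H : Submodule ATilde E, IsTheme (E ⧸ H) ∧ abRank (E ⧸ H) = 2) ∧
    ∀ H : Submodule ATilde E, IsTheme (E ⧸ H) → abRank (E ⧸ H) = 2 →
      Nonempty ((E ⧸ H) ≃ₗ[ATilde] Cyc (rankTwoElt (lam 1 - k + 2)
        (1 + PowerSeries.C (betaInv k lam α) * PowerSeries.X ^ pTotal k lam) (lam k))) := by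
  obtain ⟨n, rfl⟩ : ∃ n, k = n + 2 := ⟨k - 2, by omega⟩
  -- The case e_0 = e_1, which has no normal form with strictly increasing exponents. Here β = 1 and
  -- p(E) = 0, so the factor 1 + β b^p(E) is the constant 2.
  by_cases hdeg : n = 0 ∧ lam 2 = lam 1 - 1
  · obtain ⟨rfl, hlam⟩ := hdeg
    obtain ⟨rfl, h1, z, hz, hPz⟩ := IsPrincipalJH.rank_two_degenerate hE hF hlam hα
    refine ⟨h1, fun H hH hr => ?_⟩
    have e1 : betaInv 2 lam 1 = 1 := by simp [betaInv]
    have e2 : pTotal 2 lam = 0 := by simp [pTotal, pInv, hlam]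
    have e3 : (lam 1 : ℂ) - ((0 + 2 : ℕ) : ℂ) + 2 = lam 1 := by push_cast; ring
    rw [e3, e1, e2]
    refine nonempty_equiv_cyc_rankTwoElt ?_ (span_mkQ_eq_top hz H)
      (by rw [← map_smul, hPz, map_zero]) hr
    simp
  obtain ⟨g, hg⟩ := hE.exists_generator
  obtain ⟨U, f, hch, ⟨S₀, hS₀, hgS⟩, hsp⟩ := hF.exists_isChain hg
  have hmono := hF.monotone
  obtain ⟨hint, p, c, M, y, R, hNF⟩ := hch.exists_isNormalForm
    (fun i j hij hj => hmono i j hij hj)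
    (fun hn => by
      subst hn
      have h1 := hmono 0 1 (by omega) (by omega)
      push_cast at h1
      exact lt_of_le_of_ne (by linarith) fun h2 => hdeg ⟨rfl, by linarith⟩)
    (fun μ x hx h => by
      have := hss.noLog μ ⟨x, (hsp (n + 1) (by omega) x).mpr hx⟩ (Subtype.ext h)
      exact congrArg Subtype.val this)
    (fun μ x h => by
      refine (hsp 1 (by omega) _).mp ?_
      have := hss'.noLog μ ((F 1).mkQ x) (by rw [← map_smul, ← map_smul, h, map_zero])
      rwa [← map_smul, Submodule.mkQ_apply, Submodule.Quotient.mk_eq_zero] at this)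
    l hprim.eigenvalue
  have hg' : Submodule.span ATilde {f (n + 1)} = ⊤ := by
    rw [← hg, hgS, span_unit_smul hS₀]
  -- With k = n + 2: λ_1 - k + 2 = e_0 + 1, λ_k = e_{n+1} and p_{i+1} = e_{i+1} - e_i.
  set e : ℕ → ℚ := fun i => lam (i + 1) + i - (n + 1 : ℕ) with he
  have hpInv : ∀ i < n + 1, (pInv lam (i + 1) : ℚ) = e (i + 1) - e i := by
    intro i hi
    have h1 := hmono i (i + 1) (by omega) (by omega)
    rw [pInv_eq (hint i (by omega)) (hint (i + 1) (by omega)) (by push_cast at h1; linarith), he]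
    push_cast
    ring
  have hR0 := hNF.unit 0 (by omega)
  set γ : ℂ := c * PowerSeries.constantCoeff (R (n + 1)) / PowerSeries.constantCoeff (R 0) with hγ
  have hγ' : c * PowerSeries.constantCoeff (R (n + 1)) = γ * PowerSeries.constantCoeff (R 0) := by
    rw [hγ, div_mul_cancel₀ _ hR0]
  have hαγ := IsNormalForm.alpha_eq hE.torsionFree n E LinearMap.id Function.injective_id hNF hg'
    hα0 hα γ hγ'
  have hp := hNF.exponent_pos
  -- If c = 0 then γ = 0, and the formula for α in terms of γ would give α p = 0.
  have hc : c ≠ 0 := by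
    rintro rfl
    have : γ = 0 := by rw [hγ, zero_mul, zero_div]
    rw [this, zero_mul, eq_comm, neg_eq_zero] at hαγ
    exact mul_ne_zero hα0 (by exact_mod_cast hp.ne') hαγ
  have hpos : 0 < e 0 := by
    have := hE.chain_pos hch
    simpa [he] using this
  refine ⟨hNF.exists_theme_quotient hg' hc hpos, fun H hH hr => ?_⟩
  obtain ⟨z, hz, hPz⟩ := hNF.exists_generator_quotient hg'
    (fun i hi => ⟨∑ m ∈ Finset.Icc 1 i, pInv lam m, by
      have := sum_pInv_eq hpInv 0 i (by omega) (by omega)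
      rw [zero_add] at this
      rw [this]
      ring⟩) hγ' H.mkQ H.mkQ_surjective hH.torsionFree hH.simpleEigen hr
  have e1 : betaInv (n + 2) lam α = -γ / p := betaInv_eq hNF.strict hpInv hNF.exponent hαγ
  have e2 : pTotal (n + 2) lam = p := by
    have h1 := sum_pInv_eq hpInv 0 (n + 1) (by omega) le_rfl
    rw [← hNF.exponent] at h1
    exact_mod_cast h1
  have e3 : (lam 1 : ℂ) - ((n + 2 : ℕ) : ℂ) + 2 = ((e 0 + 1 : ℚ) : ℂ) := by
    rw [he]; push_cast; ring
  have e4 : (lam (n + 2) : ℂ) = (e (n + 1) : ℂ) := by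
    rw [he]; push_cast; ring
  rw [e1, e2, e3, e4]
  exact nonempty_equiv_cyc_rankTwoElt (by simp [hp.ne']) hz hPz hr
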